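/- Let $H$ be a complex Hilbert space and let $A,B\subseteq\mathcal B(H)$ be (not necessarily non-degenerate, unital or separable) $C^*$-subalgebras. Let $\mathcal K$ be the compact operators on $\ell^2(\mathbb N)$. Write $d(A,B)$ for the Hausdorff distance, in operator norm, between the closed unit balls of $A$ and $B$, and put $d_{\mathrm{cb}}(A,B)=d(A\otimes\mathcal K,B\otimes\mathcal K)$, computed in $\mathcal B(H\otimes\ell^2(\mathbb N))$. For positive $a,b\in A\otimes\mathcal K$ write $a\precsim b$ if there are $v_n\in A\otimes\mathcal K$ with $v_nbv_n^*\to a$ in norm. A lower semicontinuous $2$-quasitrace on $A$ is identified with its unique extension to $A\otimes\mathcal K$, that is, with a lower semicontinuous function $\tau:(A\otimes\mathcal K)_+\to[0,\infty]$ such that $\tau(0)=0$, $\tau(x^*x)=\tau(xx^*)$ for all $x\in A\otimes\mathcal K$, and $\tau$ is linear (additive and $\mathbb{R}_{\geq 0}$-homogeneous) on commuting positive elements; put $d_\tau(a)=\lim_{n\to\infty}\tau(a^{1/n})$. Say that $A$ has *strict comparison* if, for all positive $a,b\in A\otimes\mathcal K$ with $a$ in the closed two-sided ideal generated by $b$,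 the condition that $d_\tau(a)<d_\tau(b)$ for every lower semicontinuous $2$-quasitrace $\tau$ with $d_\tau(b)=1$ implies $a\precsim b$. If $d_{\mathrm{cb}}(A,B)<1/42$ and $A$ has strict comparison, then $B$ has strict comparison. -/

import Mathlib

open Filter Topology
open scoped ENNReal

noncomputable section

namespace CompletelyClose

/-! ### Cuntz comparison and quasitraces on a C*-algebra -/

section Abstract

variable {D : Type*} [NonUnitalCStarAlgebra D]

/-- Positive elements of a C*-algebra: the elements of the form `x* x`. -/
def IsPos (a : D) : Prop := ∃ x : D, a = star x * x

/-- Cuntz comparison `a ≾ b`: there are `vₙ` in the algebra with `vₙ b vₙ* → a` in norm. -/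
def CuntzLE (a b : D) : Prop :=
  ∃ v : ℕ → D, Tendsto (fun n => v n * b * star (v n)) atTop (𝓝 a)

/-- `τ` is a lower semicontinuous quasitrace with values in `[0, ∞]`: it vanishes at `0`, satisfies
the trace identity, is linear on commuting positive elements and is lower semicontinuous on the
positive cone.  Only the values of `τ` on positive elements matter. -/
structure IsLscQuasitrace (τ : D → ℝ≥0∞) : Prop where
  map_zero : τ 0 = 0
  trace : ∀ x : D, τ (star x * x) = τ (x * star x)
  map_add : ∀ a b : D, IsPos a → IsPos b → Commute a b → τ (a + b) = τ a + τ b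
  map_smul : ∀ (t : ℝ) (a : D), 0 ≤ t → IsPos a → τ ((t : ℂ) • a) = ENNReal.ofReal t * τ a
  lsc : LowerSemicontinuousOn τ {a | IsPos a}

/-- The root `a^{1/n}` of a positive element (for `n ≥ 1`), by continuous functional calculus. -/
def root (a : D) (n : ℕ) : D := cfcₙ (fun t : ℝ => t ^ (1 / (n : ℝ))) a

/-- The dimension function `d_τ(a) = lim τ(a^{1/n})` of a quasitrace, at a positive element.  (For a
lower semicontinuous quasitrace the limit always exists in `[0, ∞]`.) -/
def dimFn (τ : D → ℝ≥0∞) (a : D) : ℝ≥0∞ := limsup (fun n : ℕ => τ (root a n)) atTop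

/-- `a` lies in the closed two-sided ideal generated by `b`. -/
def MemClosedIdeal (a b : D) : Prop := a ∈ closure (TwoSidedIdeal.span ({b} : Set D) : Set D)

end Abstract

/-! ### Stabilization, the completely bounded distance and strict comparison -/

section Concrete

variable {H : Type*} [NormedAddCommGroup H] [InnerProductSpace ℂ H] [CompleteSpace H]

/-- The Hilbert space `ℓ²(ℕ; H) = H ⊗ ℓ²(ℕ)`. -/
abbrev Ampl (H : Type*) [NormedAddCommGroup H] [InnerProductSpace ℂ H] : Type _ :=
  lp (fun _ : ℕ => H) 2

/-- The operator `x ⊗ e_{ij}` on `H ⊗ ℓ²(ℕ)`, whose only nonzero matrix entry is `x`, at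
position `(i, j)`. -/
def unitTensor (x : H →L[ℂ] H) (i j : ℕ) : Ampl H →L[ℂ] Ampl H :=
  (lp.singleContinuousLinearMap ℂ (fun _ : ℕ => H) 2 i).comp
    (x.comp (lp.evalCLM ℂ (fun _ : ℕ => H) 2 j))

/-- The stabilization `A ⊗ 𝒦` of `A ⊆ B(H)`, `𝒦` the compact operators on `ℓ²(ℕ)`, realised on
`H ⊗ ℓ²(ℕ)`: the C*-algebra generated by all `x ⊗ e_{ij}` with `x ∈ A`. -/
def stabilization (A : NonUnitalStarSubalgebra ℂ (H →L[ℂ] H)) :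
    NonUnitalStarSubalgebra ℂ (Ampl H →L[ℂ] Ampl H) :=
  (NonUnitalStarAlgebra.adjoin ℂ {T | ∃ x ∈ A, ∃ i j : ℕ, T = unitTensor x i j}).topologicalClosure

instance stabilizationCStarAlgebra (A : NonUnitalStarSubalgebra ℂ (H →L[ℂ] H)) :
    NonUnitalCStarAlgebra (stabilization A) :=
  haveI : IsClosed (stabilization A : Set (Ampl H →L[ℂ] Ampl H)) :=
    NonUnitalStarSubalgebra.isClosed_topologicalClosure _
  NonUnitalStarSubalgebra.nonUnitalCStarAlgebra _

/-- The unit ball of a subalgebra of `B(H)`. -/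
def unitBall (A : NonUnitalStarSubalgebra ℂ (H →L[ℂ] H)) : Set (H →L[ℂ] H) := {x | x ∈ A ∧ ‖x‖ ≤ 1}

/-- The Kadison-Kastler distance `d(A, B)`: the Hausdorff distance of the unit balls. -/
def kkDist (A B : NonUnitalStarSubalgebra ℂ (H →L[ℂ] H)) : ℝ :=
  Metric.hausdorffDist (unitBall A) (unitBall B)

/-- The complete distance `d_cb(A, B) = d(A ⊗ 𝒦, B ⊗ 𝒦)`. -/
def cbDist (A B : NonUnitalStarSubalgebra ℂ (H →L[ℂ] H)) : ℝ :=
  kkDist (stabilization A) (stabilization B)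

/-- Strict comparison (of positive elements by lower semicontinuous 2-quasitraces): for positive
`a, b` in `A ⊗ 𝒦` with `a` in the closed ideal generated by `b`, if `d_τ(a) < d_τ(b)` for every
lower semicontinuous 2-quasitrace `τ` normalised by `d_τ(b) = 1`, then `a ≾ b`.  Lower
semicontinuous 2-quasitraces of `A` are given by their unique extensions to `A ⊗ 𝒦`, which are
exactly the lower semicontinuous quasitraces of `A ⊗ 𝒦`. -/
def HasStrictComparison (A : NonUnitalStarSubalgebra ℂ (H →L[ℂ] H)) : Prop :=
  ∀ a b : stabilization A, IsPos a → IsPos b → MemClosedIdeal a b →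
    (∀ τ : stabilization A → ℝ≥0∞, IsLscQuasitrace τ → dimFn τ b = 1 → dimFn τ a < dimFn τ b) →
    CuntzLE a b

end Concrete

end CompletelyClose

end

set_option linter.unusedSectionVars false

noncomputable section

namespace CompletelyClose

/-! ### Functional calculus in a closed subalgebra of a unital C*-algebra -/

section Cuntz

variable {M : Type*} [CStarAlgebra M] [PartialOrder M] [StarOrderedRing M]
  {D : NonUnitalStarSubalgebra ℂ M}

/-! Write D = A ⊗ 𝒦 and E = B ⊗ 𝒦. Cuntz comparison is not stable under small perturbations, but
comparison below a local unit is. If e in E is a unit for y and c ≾ y, then c ≈ z*z = 2 z*(e - 1/2)z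
for a contraction z in E. Replacing c, e, z by nearby x, x', w from D gives (x - 1/4)₊ ≾ (x' - 1/2)₊
in D (`UnitBallNear.cuntzSub_of_unit`). The gap between the levels 1/4 and 1/2 lets such comparisons
be chained, and the bound 1/42 keeps the total error below 1/4. Hence local units eₙ of b ∈ E, taken
along spectral levels tending to 0, become a rapidly increasing sequence of Cuntz classes in D. By
stability this sequence has a supremum b' in D (`exists_cuntz_sup`), the counterpart of b.

The same device pulls a functional φ on the Cuntz classes of D back to a functional ψ on those of E
(`transfer`, `IsFunctionalOn.transfer`), with ψ(b) = φ(b'). To use a hypothesis about quasitraces of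
E, ψ must be the dimension function of one: take τ(a) = ∫₀^∞ ψ((a - t)₊) dt (`layerCake`). The
delicate point is additivity on commuting elements. On functions of a single normal element, ψ sees
only supports and so defines a Borel measure, and τ is integration against it
(`IsSupportFunctional.exists_measure`, `IsSupportFunctional.lintegral_cut_add`).

Now let a, b ∈ E satisfy the hypotheses of strict comparison, let c be a local unit of a, and let x
∈ D be close to c. A normalised quasitrace of D separates (x - 1/2)₊ strictly from b', because its
transfer separates a from b. So (x - 1/2)₊ ≾ b' in D, and `UnitBallNear.cuntzSub_reverse` carries
this back to (c - 19/20)₊ ≾ b in E. Since c is 1 on the part of the spectrum of a above ε, this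
gives (a - ε)₊ ≾ b. The closed ideal condition is handled throughout as comparison with finite
multiples of b (`MultipleSub`), which passes between close algebras. -/

theorem cfc_mem_of_map_zero [IsClosed (D : Set M)] {a : M} (ha : a ∈ D) {f : ℝ → ℝ}
    (hf : Continuous f) (h0 : f 0 = 0) : cfc f a ∈ D := by
  rw [← cfcₙ_eq_cfc (hf.continuousOn) h0]
  exact cfcₙ_mem (𝕜' := ℂ) f ha

theorem norm_cfc_sub_le {a : M} {f g : ℝ → ℝ} (hf : Continuous f) (hg : Continuous g) {c : ℝ}
    (hc : 0 ≤ c) (h : ∀ x ∈ spectrum ℝ a, |f x - g x| ≤ c) : ‖cfc f a - cfc g a‖ ≤ c := by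
  rw [← cfc_sub f g a hf.continuousOn hg.continuousOn]
  exact norm_cfc_le hc h

theorem cfc_conj {a : M} {f k : ℝ → ℝ} (hf : Continuous f) (hk : Continuous k) :
    cfc k a * cfc f a * cfc k a = cfc (fun t => k t * f t * k t) a := by
  rw [← cfc_mul k f a hk.continuousOn hf.continuousOn,
    ← cfc_mul (fun t => k t * f t) k a (hk.mul hf).continuousOn hk.continuousOn]

theorem star_cfc_real (f : ℝ → ℝ) (a : M) : star (cfc f a) = cfc f a :=
  (cfc_predicate (p := IsSelfAdjoint) f a).star_eq

theorem spectrum_real_nonneg {a : M} (ha : 0 ≤ a) {x : ℝ} (hx : x ∈ spectrum ℝ a) : 0 ≤ x :=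
  spectrum_nonneg_of_nonneg ha hx

/-! ### Ramps and cut-downs. -/

/-- The piecewise linear function that is `0` up to `l` and `1` from `u` on. -/
def ramp (l u : ℝ) : ℝ → ℝ := fun s => min 1 (max (s - l) 0 / (u - l))

@[fun_prop]
theorem continuous_ramp (l u : ℝ) : Continuous (ramp l u) := by
  unfold ramp; fun_prop

theorem ramp_of_le {l u s : ℝ} (h : s ≤ l) : ramp l u s = 0 := by
  simp [ramp, max_eq_right (sub_nonpos.2 h)]

theorem ramp_of_ge {l u s : ℝ} (hlu : l < u) (h : u ≤ s) : ramp l u s = 1 := by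
  have : 1 ≤ max (s - l) 0 / (u - l) := by
    rw [le_div_iff₀ (by linarith)]
    exact le_max_of_le_left (by linarith)
  simp [ramp, this]

theorem ramp_nonneg {l u : ℝ} (hlu : l < u) (s : ℝ) : 0 ≤ ramp l u s :=
  le_min zero_le_one (div_nonneg (le_max_right _ _) (by linarith))

theorem ramp_le_one (l u s : ℝ) : ramp l u s ≤ 1 := min_le_left _ _

theorem ramp_zero {l u : ℝ} (h : 0 ≤ l) : ramp l u 0 = 0 := ramp_of_le h

theorem ramp_le_max_div (l u s : ℝ) : ramp l u s ≤ max (s - l) 0 / (u - l) := min_le_right _ _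

/-- The positive part `(a - t)₊`. -/
def posCut (a : M) (t : ℝ) : M := cfc (fun s : ℝ => max (s - t) 0) a

theorem posCut_nonneg (a : M) (t : ℝ) : 0 ≤ posCut a t := cfc_nonneg fun _ _ => le_max_right _ _

theorem posCut_mem [IsClosed (D : Set M)] {a : M} (ha : a ∈ D) {t : ℝ} (ht : 0 ≤ t) :
    posCut a t ∈ D :=
  cfc_mem_of_map_zero ha (by fun_prop) (by simpa using ht)

theorem cfc_posCut {a : M} (ha : IsSelfAdjoint a) {f : ℝ → ℝ} (hf : Continuous f) (t : ℝ) :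
    cfc f (posCut a t) = cfc (fun s => f (max (s - t) 0)) a := by
  rw [posCut, ← cfc_comp' f (fun s : ℝ => max (s - t) 0) a hf.continuousOn (by fun_prop)]

theorem posCut_posCut {a : M} (ha : IsSelfAdjoint a) {s t : ℝ} (ht : 0 ≤ t) :
    posCut (posCut a s) t = posCut a (s + t) := by
  conv_lhs => rw [posCut, cfc_posCut ha (by fun_prop)]
  refine cfc_congr fun x _ => ?_
  rcases le_total (x - s) 0 with h | h
  · rw [max_eq_right h, max_eq_right (by linarith), max_eq_right (by linarith)]
  · rw [max_eq_left h, sub_sub]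

theorem norm_sub_posCut_le {a : M} (ha : 0 ≤ a) {t : ℝ} (ht : 0 ≤ t) :
    ‖posCut a t - a‖ ≤ t := by
  have h := norm_cfc_sub_le (a := a) (f := fun s => max (s - t) 0) (g := fun s => s)
    (by fun_prop) (by fun_prop) ht
  rw [cfc_id' ℝ a] at h
  refine h fun x hx => ?_
  have := spectrum_real_nonneg ha hx
  rcases le_total x t with h | h
  · rw [max_eq_right (by linarith), abs_le]; constructor <;> linarith
  · rw [max_eq_left (by linarith), abs_le]; constructor <;> linarith

theorem sub_le_posCut {a : M} (ha : IsSelfAdjoint a) (t : ℝ) :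
    a - algebraMap ℝ M t ≤ posCut a t := by
  rw [sub_le_iff_le_add]
  conv_lhs => rw [← cfc_id' ℝ a]
  rw [posCut, ← cfc_add_const t _ a (by fun_prop)]
  exact cfc_mono fun x _ => by
    have := le_max_left (x - t) 0
    linarith

theorem le_posCut_add {a : M} (ha : IsSelfAdjoint a) (t : ℝ) :
    a ≤ posCut a t + algebraMap ℝ M t := sub_le_iff_le_add.1 (sub_le_posCut ha t)

/-! ### Cuntz comparison with witnesses in a subalgebra. -/

/-- Cuntz comparison relative to the subalgebra `D`. -/
def CuntzSub (D : NonUnitalStarSubalgebra ℂ M) (a b : M) : Prop :=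
  ∀ ε > 0, ∃ v ∈ D, ‖v * b * star v - a‖ < ε

theorem CuntzSub.trans {a b c : M} (hab : CuntzSub D a b) (hbc : CuntzSub D b c) :
    CuntzSub D a c := by
  intro ε hε
  obtain ⟨v, hv, hva⟩ := hab (ε / 2) (by positivity)
  obtain ⟨w, hw, hwb⟩ := hbc (ε / (2 * (‖v‖ * ‖v‖ + 1))) (by positivity)
  refine ⟨v * w, mul_mem hv hw, ?_⟩
  have h1 : v * w * c * star (v * w) - a
      = v * (w * c * star w - b) * star v + (v * b * star v - a) := by
    simp only [star_mul]; noncomm_ring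
  have h2 : ‖v * (w * c * star w - b) * star v‖ ≤ ε / 2 := by
    calc _ ≤ ‖v‖ * ‖w * c * star w - b‖ * ‖star v‖ :=
          (norm_mul_le _ _).trans (by gcongr; exact norm_mul_le _ _)
      _ ≤ ‖v‖ * (ε / (2 * (‖v‖ * ‖v‖ + 1))) * ‖v‖ := by rw [norm_star]; gcongr
      _ = ε / 2 * ((‖v‖ * ‖v‖) / (‖v‖ * ‖v‖ + 1)) := by field_simp
      _ ≤ ε / 2 * 1 := by
          gcongr
          rw [div_le_one (by positivity)]; linarith
      _ = ε / 2 := mul_one _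
  rw [h1]
  linarith [norm_add_le (v * (w * c * star w - b) * star v) (v * b * star v - a)]

theorem CuntzSub.of_approx {a b : M} (h : ∀ ε > 0, ∃ a', ‖a' - a‖ < ε ∧ CuntzSub D a' b) :
    CuntzSub D a b := by
  intro ε hε
  obtain ⟨a', h1, h2⟩ := h (ε / 2) (by positivity)
  obtain ⟨v, hv, h3⟩ := h2 (ε / 2) (by positivity)
  refine ⟨v, hv, ?_⟩
  have : v * b * star v - a = (v * b * star v - a') + (a' - a) := by abel
  rw [this]
  linarith [norm_add_le (v * b * star v - a') (a' - a)]

theorem CuntzSub.of_conj_mem {b v : M} (hv : v ∈ D) : CuntzSub D (v * b * star v) b :=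
  fun _ hε => ⟨v, hv, by simpa using hε⟩

/-- The ramp of `a` is an approximate unit for `a` inside C*(a). It stands in for the missing unit
of `D` whenever a multiplier has to be turned into an element of `D`. -/
theorem norm_ramp_conj_sub_le {a : M} (ha : 0 ≤ a) {δ : ℝ} (hδ : 0 < δ) :
    ‖cfc (ramp δ (2 * δ)) a * a * cfc (ramp δ (2 * δ)) a - a‖ ≤ 2 * δ := by
  have h : cfc (ramp δ (2 * δ)) a * a * cfc (ramp δ (2 * δ)) a
      = cfc (fun t => ramp δ (2 * δ) t * t * ramp δ (2 * δ) t) a := by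
    rw [← cfc_conj (f := fun t => t) (by fun_prop) (by fun_prop), cfc_id' ℝ a]
  rw [h]
  conv_lhs => enter [1, 2]; rw [← cfc_id' ℝ a]
  refine norm_cfc_sub_le (by fun_prop) (by fun_prop) (by positivity) fun x hx => ?_
  have hx := spectrum_real_nonneg ha hx
  have h0 := ramp_nonneg (l := δ) (u := 2 * δ) (by linarith) x
  have h1 := ramp_le_one δ (2 * δ) x
  rcases le_total x (2 * δ) with h | h
  · rw [abs_le]
    constructor
    · nlinarith [mul_nonneg (mul_nonneg h0 hx) h0]
    · nlinarith [mul_le_mul h1 h1 h0 zero_le_one]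
  · rw [ramp_of_ge (by linarith) h]; simp; linarith

/-- A multiplier `v` is not itself an admissible witness, but v h is, for h an approximate unit of
`q` taken from C*(q). The loss is controlled by ‖v‖². -/
theorem CuntzSub.of_multiplier [IsClosed (D : Set M)] {q v : M} (hq : q ∈ D) (hq0 : 0 ≤ q)
    (hv : ∀ x ∈ D, v * x ∈ D) : CuntzSub D (v * q * star v) q := by
  refine CuntzSub.of_approx fun ε hε => ?_
  set δ := ε / (4 * (‖v‖ * ‖v‖ + 1)) with hδdef
  have hδ : 0 < δ := by positivity
  set h := cfc (ramp δ (2 * δ)) q with hh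
  have hhD : h ∈ D := cfc_mem_of_map_zero hq (by fun_prop) (ramp_zero hδ.le)
  have hst : star h = h := star_cfc_real _ _
  refine ⟨(v * h) * q * star (v * h), ?_, .of_conj_mem (hv h hhD)⟩
  have e1 : (v * h) * q * star (v * h) - v * q * star v = v * (h * q * h - q) * star v := by
    rw [star_mul, hst]; noncomm_ring
  rw [e1]
  calc _ ≤ ‖v‖ * ‖h * q * h - q‖ * ‖star v‖ :=
          (norm_mul_le _ _).trans (by gcongr; exact norm_mul_le _ _)
    _ ≤ ‖v‖ * (2 * δ) * ‖v‖ := by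
        rw [norm_star]; gcongr; exact norm_ramp_conj_sub_le hq0 hδ
    _ = ε / 2 * ((‖v‖ * ‖v‖) / (‖v‖ * ‖v‖ + 1)) := by rw [hδdef]; field_simp; ring
    _ ≤ ε / 2 * 1 := by
          gcongr
          rw [div_le_one (by positivity)]; linarith
    _ < ε := by linarith

/-- The scalar √r is a multiplier of `D`, although 1 need not lie in `D`. -/
theorem CuntzSub.smul_left [IsClosed (D : Set M)] {a : M} (ha : a ∈ D) (ha0 : 0 ≤ a) {r : ℝ}
    (hr : 0 ≤ r) : CuntzSub D (r • a) a := by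
  have := CuntzSub.of_multiplier (v := (Real.sqrt r) • (1 : M)) ha ha0 (fun x hx => by
    rw [smul_mul_assoc, one_mul]
    exact SMulMemClass.ofIsScalarTower (NonUnitalStarSubalgebra ℂ M) ℝ ℂ M |>.smul_mem _ hx)
  simpa [smul_smul, Real.mul_self_sqrt hr] using this

end Cuntz

/-! ### Square roots, polar decomposition and Rørdam-type lemmas. -/

section Cuntz

variable {M : Type*} [CStarAlgebra M] [PartialOrder M] [StarOrderedRing M]
  {D : NonUnitalStarSubalgebra ℂ M}

theorem real_smul_mem {x : M} (hx : x ∈ D) (r : ℝ) : r • x ∈ D :=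
  SMulMemClass.ofIsScalarTower (NonUnitalStarSubalgebra ℂ M) ℝ ℂ M |>.smul_mem _ hx

theorem cfc_mul_eq_of_eqOn {a : M} {f g h : ℝ → ℝ} (hf : Continuous f) (hg : Continuous g)
    (hfg : ∀ x ∈ spectrum ℝ a, f x * g x = h x) : cfc f a * cfc g a = cfc h a := by
  rw [← cfc_mul f g a hf.continuousOn hg.continuousOn]
  exact cfc_congr hfg

/-- The square root of a positive element, by functional calculus. -/
def sqrtPos (a : M) : M := cfc Real.sqrt a

theorem sqrtPos_mem [IsClosed (D : Set M)] {a : M} (ha : a ∈ D) : sqrtPos a ∈ D :=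
  cfc_mem_of_map_zero ha Real.continuous_sqrt Real.sqrt_zero

theorem star_sqrtPos (a : M) : star (sqrtPos a) = sqrtPos a := star_cfc_real _ _

theorem sqrtPos_mul_self {a : M} (ha : 0 ≤ a) : sqrtPos a * sqrtPos a = a := by
  conv_rhs => rw [← cfc_id' ℝ a]
  exact cfc_mul_eq_of_eqOn Real.continuous_sqrt Real.continuous_sqrt
    fun x hx => Real.mul_self_sqrt (spectrum_real_nonneg ha hx)

/-- By the C*-identity, since (x√a)(x√a)* = x a x* = 0. -/
theorem mul_sqrtPos_eq_zero {a x : M} (ha : 0 ≤ a) (h : x * a = 0) : x * sqrtPos a = 0 := by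
  have : (x * sqrtPos a) * star (x * sqrtPos a) = 0 := by
    rw [star_mul, star_sqrtPos, mul_assoc, ← mul_assoc (sqrtPos a), sqrtPos_mul_self ha,
      ← mul_assoc, h, zero_mul]
  exact CStarRing.mul_star_self_eq_zero_iff _ |>.1 this

theorem mul_sqrtPos_eq {a e : M} (ha : 0 ≤ a) (h : e * a = a) : e * sqrtPos a = sqrtPos a := by
  have := mul_sqrtPos_eq_zero (x := e - 1) ha (by rw [sub_mul, h, one_mul, sub_self])
  rwa [sub_mul, one_mul, sub_eq_zero] at this

/-- The square of the norm is ‖u(q) p u(q)‖ ≤ ‖u(q) q u(q)‖, which turns the order relation into a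
scalar estimate on the spectrum of `q`. -/
theorem norm_cfc_mul_sqrtPos_le {p q : M} (hp : 0 ≤ p) (hpq : p ≤ q) {u : ℝ → ℝ}
    (hu : Continuous u) {c : ℝ} (hc : 0 ≤ c) (h : ∀ t, 0 ≤ t → u t * t * u t ≤ c * c) :
    ‖cfc u q * sqrtPos p‖ ≤ c := by
  have hq : 0 ≤ q := hp.trans hpq
  have h1 : (cfc u q * sqrtPos p) * star (cfc u q * sqrtPos p) = cfc u q * p * cfc u q := by
    rw [star_mul, star_sqrtPos, star_cfc_real, mul_assoc, ← mul_assoc (sqrtPos p),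
      sqrtPos_mul_self hp, ← mul_assoc]
  have hsa : IsSelfAdjoint (cfc u q) := star_cfc_real _ _
  have h2 : cfc u q * p * cfc u q ≤ cfc u q * q * cfc u q := hsa.conjugate_le_conjugate hpq
  have h3 : ‖cfc u q * q * cfc u q‖ ≤ c * c := by
    have : cfc u q * q * cfc u q = cfc (fun t => u t * t * u t) q := by
      rw [← cfc_conj (f := fun t => t) (by fun_prop) hu, cfc_id' ℝ q]
    rw [this]
    refine norm_cfc_le (by positivity) fun x hx => ?_
    have hx := spectrum_real_nonneg hq hx
    rw [Real.norm_of_nonneg (by nlinarith [mul_self_nonneg (u x)])]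
    exact h x hx
  have h4 := CStarAlgebra.norm_le_norm_of_nonneg_of_le (hsa.conjugate_nonneg hp) h2
  rw [← h1, CStarRing.norm_self_mul_star] at h4
  exact abs_le_of_sq_le_sq' (by nlinarith) hc |>.2

/-- Approximate polar decomposition. With q = Q*Q and wₙ = q^{1/2}(q + δₙ)^{-1} p^{1/2}, one has |Q|
wₙ = q(q + δₙ)^{-1} p^{1/2} → p^{1/2}. Since ‖Qx‖ = ‖|Q|x‖, the sequence Q wₙ is Cauchy as well. -/
theorem exists_polar [IsClosed (D : Set M)] {p Q : M} (hpD : p ∈ D) (hQ : Q ∈ D) (hp : 0 ≤ p)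
    (hpQ : p ≤ star Q * Q) : ∃ w : ℕ → M, (∀ n, w n ∈ D) ∧
      ∃ Y, Tendsto (fun n => Q * w n) atTop (𝓝 Y) ∧ star Y * Y = p := by
  set q := star Q * Q with hq
  have hq0 : 0 ≤ q := star_mul_self_nonneg Q
  have hqD : q ∈ D := mul_mem (star_mem hQ) hQ
  let δ : ℕ → ℝ := fun n => 1 / (n + 1)
  have hδ : ∀ n, 0 < δ n := fun n => by positivity
  have hne : ∀ n (t : ℝ), |t| + δ n ≠ 0 := fun n t => by have := hδ n; positivity
  -- The absolute values only serve to make the functions continuous on all of ℝ; the spectrum of q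
  -- is nonnegative.
  let g : ℕ → ℝ → ℝ := fun n t => Real.sqrt |t| / (|t| + δ n)
  have hg : ∀ n, Continuous (g n) := fun n =>
    (by fun_prop : Continuous fun t : ℝ => Real.sqrt |t|).div (by fun_prop) (hne n)
  let f : ℕ → ℝ → ℝ := fun n t => |t| / (|t| + δ n)
  have hf : ∀ n, Continuous (f n) := fun n =>
    (by fun_prop : Continuous fun t : ℝ => |t|).div (by fun_prop) (hne n)
  let w : ℕ → M := fun n => cfc (g n) q * sqrtPos p
  have hw : ∀ n, w n ∈ D := fun n =>
    mul_mem (cfc_mem_of_map_zero hqD (hg n) (by simp [g])) (sqrtPos_mem hpD)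
  have hrw : ∀ n, sqrtPos q * w n = cfc (f n) q * sqrtPos p := fun n => by
    rw [← mul_assoc]
    congr 1
    refine cfc_mul_eq_of_eqOn Real.continuous_sqrt (hg n) fun x hx => ?_
    have hx := spectrum_real_nonneg hq0 hx
    simp only [g, f, abs_of_nonneg hx]
    rw [← mul_div_assoc, Real.mul_self_sqrt hx]
  have hlim : Tendsto (fun n => sqrtPos q * w n) atTop (𝓝 (sqrtPos p)) := by
    rw [tendsto_iff_norm_sub_tendsto_zero]
    refine squeeze_zero (g := fun n => Real.sqrt (δ n)) (fun _ => norm_nonneg _) (fun n => ?_) ?_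
    · have : sqrtPos q * w n - sqrtPos p = cfc (fun t => f n t - 1) q * sqrtPos p := by
        rw [hrw, cfc_sub (f n) (fun _ => 1) q (hf n).continuousOn (by fun_prop),
          cfc_const_one ℝ q, sub_mul, one_mul]
      rw [this]
      refine norm_cfc_mul_sqrtPos_le hp hpQ ((hf n).sub continuous_const) (Real.sqrt_nonneg _)
        fun t ht => ?_
      rw [Real.mul_self_sqrt (hδ n).le]
      have h1 : f n t - 1 = - (δ n / (t + δ n)) := by
        have := hδ n
        simp only [f, abs_of_nonneg ht]
        field_simp; ring
      change (f n t - 1) * t * (f n t - 1) ≤ δ n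
      rw [h1]
      have h2 : -(δ n / (t + δ n)) * t * -(δ n / (t + δ n))
          = δ n * ((δ n * t) / ((t + δ n) * (t + δ n))) := by
        have := hδ n
        field_simp
      rw [h2]
      refine mul_le_of_le_one_right (hδ n).le ?_
      have := hδ n
      rw [div_le_one (by positivity)]
      nlinarith [mul_nonneg ht (hδ n).le]
    · have : Tendsto δ atTop (𝓝 0) := tendsto_one_div_add_atTop_nhds_zero_nat
      simpa [Function.comp_def] using (Real.continuous_sqrt.tendsto 0).comp this
  have hst : ∀ x : M, star (Q * x) * (Q * x) = star (sqrtPos q * x) * (sqrtPos q * x) := by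
    intro x
    have : star (sqrtPos q * x) * (sqrtPos q * x) = star x * (sqrtPos q * sqrtPos q) * x := by
      rw [star_mul, star_sqrtPos]; noncomm_ring
    rw [this, sqrtPos_mul_self hq0, hq, star_mul]; noncomm_ring
  have hnorm : ∀ x : M, ‖Q * x‖ = ‖sqrtPos q * x‖ := fun x => by
    have := congrArg norm (hst x)
    rw [CStarRing.norm_star_mul_self, CStarRing.norm_star_mul_self] at this
    exact (mul_self_inj (norm_nonneg _) (norm_nonneg _)).1 this
  have hcau : CauchySeq fun n => Q * w n := by
    have := hlim.cauchySeq
    rw [Metric.cauchySeq_iff] at this ⊢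
    intro ε hε
    obtain ⟨N, hN⟩ := this ε hε
    refine ⟨N, fun m hm n hn => ?_⟩
    have := hN m hm n hn
    rw [dist_eq_norm, ← mul_sub] at this ⊢
    rwa [hnorm]
  obtain ⟨Y, hY⟩ := cauchySeq_tendsto_of_complete hcau
  refine ⟨w, hw, Y, hY, tendsto_nhds_unique (hY.star.mul hY) ?_⟩
  simp_rw [hst]
  have := hlim.star.mul hlim
  rwa [star_sqrtPos, sqrtPos_mul_self hp] at this

/-- The limit Y lies in the closure of Q D, so it inherits every left unit of `Q`. -/
theorem exists_star_mul_self_eq [IsClosed (D : Set M)] {p Q : M} (hpD : p ∈ D) (hQ : Q ∈ D)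
    (hp : 0 ≤ p) (hpQ : p ≤ star Q * Q) :
    ∃ Y ∈ D, star Y * Y = p ∧ ∀ e, e * Q = Q → e * Y = Y := by
  obtain ⟨w, hw, Y, hY, h⟩ := exists_polar hpD hQ hp hpQ
  refine ⟨Y, ?_, h, fun e he => ?_⟩
  · exact (inferInstance : IsClosed (D : Set M)).mem_of_tendsto hY
      (Eventually.of_forall fun n => mul_mem hQ (hw n))
  · refine tendsto_nhds_unique (hY.const_mul e) ?_
    simpa only [← mul_assoc, he] using hY

theorem CuntzSub.of_tendsto {a b : M} {v : ℕ → M} (hv : ∀ n, v n ∈ D)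
    (h : Tendsto (fun n => v n * b * star (v n)) atTop (𝓝 a)) : CuntzSub D a b := by
  intro ε hε
  obtain ⟨n, hn⟩ := (Metric.tendsto_atTop.1 h ε hε)
  exact ⟨v n, hv n, by simpa [dist_eq_norm] using hn n le_rfl⟩

/-- Take Q = √q in the polar decomposition: wₙ* q wₙ = (Q wₙ)*(Q wₙ) → p. -/
theorem CuntzSub.of_le [IsClosed (D : Set M)] {p q : M} (hpD : p ∈ D) (hqD : q ∈ D)
    (hp : 0 ≤ p) (hpq : p ≤ q) : CuntzSub D p q := by
  have hq := hp.trans hpq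
  obtain ⟨w, hw, Y, hY, h⟩ := exists_polar hpD (sqrtPos_mem hqD) hp
    (by rwa [star_sqrtPos, sqrtPos_mul_self hq])
  refine CuntzSub.of_tendsto (v := fun n => star (w n)) (fun n => star_mem (hw n)) ?_
  rw [← h]
  refine (hY.star.mul hY).congr fun n => ?_
  rw [star_mul, star_sqrtPos, star_star, mul_assoc, ← mul_assoc (sqrtPos q), sqrtPos_mul_self hq,
    mul_assoc]

theorem CuntzSub.of_le_smul [IsClosed (D : Set M)] {p q : M} (hpD : p ∈ D) (hqD : q ∈ D)
    (hp : 0 ≤ p) (hq : 0 ≤ q) {r : ℝ} (hr : 0 ≤ r) (hpq : p ≤ r • q) : CuntzSub D p q :=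
  (CuntzSub.of_le hpD (real_smul_mem hqD r) hp hpq).trans (.smul_left hqD hq hr)

theorem CuntzSub.cfc_of_le [IsClosed (D : Set M)] {a : M} (ha : a ∈ D) {f g : ℝ → ℝ}
    (hf : Continuous f) (hg : Continuous g) (hf0 : f 0 = 0) (hg0 : g 0 = 0)
    (hf' : ∀ x ∈ spectrum ℝ a, 0 ≤ f x) (hg' : ∀ x ∈ spectrum ℝ a, 0 ≤ g x)
    {r : ℝ} (hr : 0 ≤ r) (h : ∀ x ∈ spectrum ℝ a, f x ≤ r * g x) :
    CuntzSub D (cfc f a) (cfc g a) := by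
  refine .of_le_smul (cfc_mem_of_map_zero ha hf hf0) (cfc_mem_of_map_zero ha hg hg0)
    (cfc_nonneg hf') (cfc_nonneg hg') hr ?_
  rw [← cfc_smul r g a hg.continuousOn]
  exact cfc_mono (fun x hx => by simpa using h x hx) hf.continuousOn (by fun_prop)

/-- With k a ramp of `a` starting just above `s`, k(a - s)k is positive, close to (a - s)₊, and at
most k b k ≾ b. Only a one-sided inequality is needed, not closeness in norm. -/
theorem CuntzSub.posCut_of_le [IsClosed (D : Set M)] {a b : M} (ha : a ∈ D) (hb : b ∈ D)
    (hsa : IsSelfAdjoint a) {s : ℝ} (hs : 0 ≤ s)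
    (h : a ≤ b + algebraMap ℝ M s) : CuntzSub D (posCut a s) b := by
  refine .of_approx fun ε hε => ?_
  set η := ε / 4
  have hη : 0 < η := by positivity
  set k : ℝ → ℝ := ramp (s + η) (s + 2 * η)
  have hk : Continuous k := continuous_ramp _ _
  have hkD : cfc k a ∈ D := cfc_mem_of_map_zero ha hk (ramp_zero (by positivity))
  have hksa : IsSelfAdjoint (cfc k a) := star_cfc_real _ _
  have hp : cfc (fun t => k t * (t - s) * k t) a
      = cfc k a * (a - algebraMap ℝ M s) * cfc k a := by
    rw [← cfc_conj (f := fun t => t - s) (by fun_prop) hk,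
      cfc_sub (fun t => t) (fun _ => s) a, cfc_id' ℝ a, cfc_const s a]
  refine ⟨cfc (fun t => k t * (t - s) * k t) a, ?_, ?_⟩
  · refine (norm_cfc_sub_le (c := 2 * η) (by fun_prop) (by fun_prop) (by positivity)
      fun t _ => ?_).trans_lt (by simp only [η]; linarith)
    have h0 := ramp_nonneg (l := s + η) (u := s + 2 * η) (by linarith) t
    have h1 := ramp_le_one (s + η) (s + 2 * η) t
    rcases le_total t s with hts | hts
    · rw [max_eq_right (by linarith)]
      simp only [k]
      rw [ramp_of_le (by linarith)]
      simp; positivity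
    rw [max_eq_left (by linarith)]
    rcases le_total t (s + 2 * η) with hts' | hts'
    · rw [abs_le]
      constructor
      · nlinarith [mul_nonneg (mul_nonneg h0 (sub_nonneg.2 hts)) h0]
      · nlinarith [mul_le_mul h1 h1 h0 zero_le_one, mul_nonneg h0 h0]
    · simp only [k]
      rw [ramp_of_ge (by linarith) hts']
      simp; positivity
  · refine CuntzSub.trans (b := cfc k a * b * cfc k a) ?_ ?_
    · refine .of_le (cfc_mem_of_map_zero ha (by fun_prop) (by simp [k, ramp_zero (by positivity : 0 ≤ s + η)]))
        (mul_mem (mul_mem hkD hb) hkD) ?_ ?_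
      · refine cfc_nonneg fun t _ => ?_
        rcases le_total t s with hts | hts
        · simp only [k]; rw [ramp_of_le (by linarith)]; simp
        · have h0 := ramp_nonneg (l := s + η) (u := s + 2 * η) (by linarith) t
          exact mul_nonneg (mul_nonneg h0 (sub_nonneg.2 hts)) h0
      · rw [hp]
        exact hksa.conjugate_le_conjugate (sub_le_iff_le_add.2 h)
    · have := CuntzSub.of_conj_mem (D := D) (b := b) hkD
      rwa [hksa.star_eq] at this

theorem le_add_of_norm_sub_le {a b : M} (ha : IsSelfAdjoint a) (hb : IsSelfAdjoint b) {s : ℝ}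
    (h : ‖a - b‖ ≤ s) : a ≤ b + algebraMap ℝ M s := by
  have h1 := (ha.sub hb).le_algebraMap_norm_self
  have h2 : algebraMap ℝ M ‖a - b‖ ≤ algebraMap ℝ M s := algebraMap_mono M h
  exact (sub_le_iff_le_add'.1 (h1.trans h2))

theorem CuntzSub.posCut_of_norm [IsClosed (D : Set M)] {a b : M} (ha : a ∈ D) (hb : b ∈ D)
    (hsa : IsSelfAdjoint a) (hb0 : 0 ≤ b) {s : ℝ} (h : ‖a - b‖ ≤ s) :
    CuntzSub D (posCut a s) b :=
  .posCut_of_le ha hb hsa ((norm_nonneg _).trans h)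
    (le_add_of_norm_sub_le hsa hb0.isSelfAdjoint h)

theorem CuntzSub.posCut_posCut [IsClosed (D : Set M)] {a b : M} (ha : a ∈ D) (hb : b ∈ D)
    (hsa : IsSelfAdjoint a) (hsb : IsSelfAdjoint b) {s t : ℝ} (ht : 0 ≤ t) (h : ‖a - b‖ ≤ s) :
    CuntzSub D (posCut a (t + s)) (posCut b t) := by
  have hs := (norm_nonneg _).trans h
  refine .posCut_of_le ha (posCut_mem hb ht) hsa (by positivity) ?_
  refine (le_add_of_norm_sub_le hsa hsb h).trans ?_
  rw [map_add, ← add_assoc]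
  gcongr
  exact le_posCut_add hsb t

theorem CuntzSub.posCut_anti [IsClosed (D : Set M)] {a : M} (ha : a ∈ D) {s t : ℝ}
    (hs : 0 ≤ s) (h : s ≤ t) : CuntzSub D (posCut a t) (posCut a s) :=
  .cfc_of_le ha (by fun_prop) (by fun_prop) (by simp; linarith) (by simp; linarith)
    (fun _ _ => le_max_right _ _) (fun _ _ => le_max_right _ _) zero_le_one
    fun x _ => by rw [one_mul]; gcongr

theorem CuntzSub.posCut_self [IsClosed (D : Set M)] {a : M} (ha : a ∈ D) (ha0 : 0 ≤ a) {t : ℝ}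
    (ht : 0 ≤ t) : CuntzSub D (posCut a t) a :=
  .posCut_of_le ha ha ha0.isSelfAdjoint ht (by
    have : 0 ≤ algebraMap ℝ M t := by simpa using algebraMap_mono M ht
    exact le_add_of_nonneg_right this)

/-- Rørdam's lemma: an approximate witness v for a ≾ b tolerates cutting `b` at a level δ of order
ε/‖v‖², and cutting `a` at `ε` absorbs the remaining error. -/
theorem CuntzSub.exists_posCut [IsClosed (D : Set M)] {a b : M} (ha : a ∈ D) (hb : b ∈ D)
    (hsa : IsSelfAdjoint a) (hb0 : 0 ≤ b) (h : CuntzSub D a b) {ε : ℝ} (hε : 0 < ε) :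
    ∃ δ > 0, CuntzSub D (posCut a ε) (posCut b δ) := by
  obtain ⟨v, hv, hva⟩ := h (ε / 2) (by positivity)
  refine ⟨ε / (2 * (‖v‖ * ‖v‖ + 1)), by positivity, ?_⟩
  set δ := ε / (2 * (‖v‖ * ‖v‖ + 1)) with hδ
  have hδ0 : 0 < δ := by positivity
  have hbD := posCut_mem hb hδ0.le
  refine CuntzSub.trans (.posCut_of_norm ha (mul_mem (mul_mem hv hbD) (star_mem hv)) hsa
    (star_right_conjugate_nonneg (posCut_nonneg _ _) v) ?_) (.of_conj_mem hv)
  have e1 : a - v * posCut b δ * star v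
      = - (v * b * star v - a) - v * (posCut b δ - b) * star v := by noncomm_ring
  have h2 : ‖v * (posCut b δ - b) * star v‖ ≤ ε / 2 := by
    calc _ ≤ ‖v‖ * ‖posCut b δ - b‖ * ‖star v‖ :=
          (norm_mul_le _ _).trans (by gcongr; exact norm_mul_le _ _)
      _ ≤ ‖v‖ * δ * ‖v‖ := by rw [norm_star]; gcongr; exact norm_sub_posCut_le hb0 hδ0.le
      _ = ε / 2 * ((‖v‖ * ‖v‖) / (‖v‖ * ‖v‖ + 1)) := by rw [hδ]; field_simp
      _ ≤ ε / 2 * 1 := by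
          gcongr
          rw [div_le_one (by positivity)]; linarith
      _ = ε / 2 := mul_one _
  rw [e1]
  refine (norm_sub_le _ _).trans ?_
  rw [norm_neg]
  linarith

theorem CuntzSub.of_posCut {a b : M} (ha0 : 0 ≤ a)
    (h : ∀ ε > 0, CuntzSub D (posCut a ε) b) : CuntzSub D a b :=
  .of_approx fun ε hε => ⟨posCut a (ε / 2),
    (norm_sub_posCut_le ha0 (by positivity)).trans_lt (by linarith), h _ (by positivity)⟩

/-- Passes through the square: x*x ≾ (x*x)² = x*(x x*)x ≾ x x*. -/
theorem CuntzSub.star_mul_self [IsClosed (D : Set M)] {x : M} (hx : x ∈ D) :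
    CuntzSub D (star x * x) (x * star x) := by
  have ha : star x * x ∈ D := mul_mem (star_mem hx) hx
  have ha0 := star_mul_self_nonneg x
  refine CuntzSub.trans (b := (star x * x) * (star x * x)) (.of_posCut ha0 fun ε hε => ?_) ?_
  · have : (star x * x) * (star x * x) = cfc (fun t : ℝ => t * t) (star x * x) := by
      rw [cfc_mul (fun t : ℝ => t) (fun t => t) _, cfc_id' ℝ (star x * x)]
    rw [this]
    refine .cfc_of_le ha (by fun_prop) (by fun_prop) (by simpa using hε.le) (by simp)
      (fun _ _ => le_max_right _ _) (fun _ _ => mul_self_nonneg _) (r := 1 / ε) (by positivity)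
      fun t ht => ?_
    have ht := spectrum_real_nonneg ha0 ht
    refine max_le ?_ (by positivity)
    rw [one_div, ← div_eq_inv_mul, le_div_iff₀ hε]
    nlinarith [sq_nonneg (t - ε)]
  · have := CuntzSub.of_conj_mem (D := D) (b := x * star x) (star_mem hx)
    rwa [star_star, ← mul_assoc, mul_assoc (star x * x)] at this

/-- A contraction implementing `a ≾ y` up to `η`, in the form `√y * u`. -/
theorem CuntzSub.exists_contraction [IsClosed (D : Set M)] {a y : M} (hy0 : 0 ≤ y)
    (h : CuntzSub D a y) (ha : ‖a‖ ≤ 1) {η : ℝ} (hη : 0 < η) :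
    ∃ u ∈ D, ‖sqrtPos y * u‖ ≤ 1 ∧ ‖star (sqrtPos y * u) * (sqrtPos y * u) - a‖ ≤ η := by
  obtain ⟨v, hv, hva⟩ := h (η / 2) (by positivity)
  set z := sqrtPos y * star v with hz
  have hzz : star z * z = v * y * star v := by
    rw [hz, star_mul, star_star, star_sqrtPos, mul_assoc, ← mul_assoc (sqrtPos y),
      sqrtPos_mul_self hy0, mul_assoc]
  have hzn : ‖z‖ * ‖z‖ ≤ 1 + η / 2 := by
    rw [← CStarRing.norm_star_mul_self, hzz]
    have := norm_add_le (v * y * star v - a) a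
    rw [sub_add_cancel] at this
    linarith
  -- Since ‖z‖² ≤ ‖a‖ + η/2 ≤ 1 + η/2, this factor makes z a contraction and moves z*z by at most
  -- η/2.
  set r := (Real.sqrt (1 + η / 2))⁻¹ with hr
  have hrr : r * r = (1 + η / 2)⁻¹ := by
    rw [hr, ← mul_inv, Real.mul_self_sqrt (by positivity)]
  have hr0 : 0 ≤ r := by positivity
  have hz' : sqrtPos y * (r • star v) = r • z := mul_smul_comm _ _ _
  have hstar : star (r • z) * (r • z) = (r * r) • (v * y * star v) := by
    rw [star_smul, star_trivial, smul_mul_smul_comm, hzz]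
  refine ⟨r • star v, real_smul_mem (star_mem hv) r, ?_, ?_⟩
  · rw [hz', norm_smul, Real.norm_of_nonneg hr0]
    refine abs_le_of_sq_le_sq' ?_ zero_le_one |>.2
    calc (r * ‖z‖) ^ 2 = (r * r) * (‖z‖ * ‖z‖) := by ring
      _ ≤ (1 + η / 2)⁻¹ * (1 + η / 2) := by rw [hrr]; gcongr
      _ = 1 ^ 2 := by rw [inv_mul_cancel₀ (by positivity)]; norm_num
  · rw [hz', hstar, hrr]
    have e : (1 + η / 2)⁻¹ • (v * y * star v) - a
        = (v * y * star v - a) - (1 - (1 + η / 2)⁻¹) • (v * y * star v) := by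
      rw [sub_smul, one_smul]; abel
    rw [e]
    have h1 : ‖(1 - (1 + η / 2)⁻¹) • (v * y * star v)‖ ≤ η / 2 := by
      have hp : 0 ≤ 1 - (1 + η / 2)⁻¹ := by
        rw [sub_nonneg]; exact inv_le_one_of_one_le₀ (by linarith)
      rw [norm_smul, Real.norm_of_nonneg hp, ← hzz, CStarRing.norm_star_mul_self]
      calc _ ≤ (1 - (1 + η / 2)⁻¹) * (1 + η / 2) := by gcongr
        _ = η / 2 := by rw [sub_mul, inv_mul_cancel₀ (by positivity)]; ring
    linarith [norm_sub_le (v * y * star v - a) ((1 - (1 + η / 2)⁻¹) • (v * y * star v))]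

end Cuntz

/-! ### Orthogonal sums in a stable subalgebra -/

section Diagonal

variable {M : Type*} [CStarAlgebra M] [PartialOrder M] [StarOrderedRing M]
  {D E : NonUnitalStarSubalgebra ℂ M} {s : ℕ → M}

/-- Isometries `s i` with pairwise orthogonal ranges that multiply `D` into itself. -/
structure Stabilizes (s : ℕ → M) (D : NonUnitalStarSubalgebra ℂ M) : Prop where
  orth : ∀ i j, star (s i) * s j = if i = j then 1 else 0
  mul_mem : ∀ i, ∀ x ∈ D, s i * x ∈ D

theorem Stabilizes.mul_star_mem (hs : Stabilizes s D) (i : ℕ) {x : M} (hx : x ∈ D) :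
    x * star (s i) ∈ D := by
  have := star_mem (hs.mul_mem i _ (star_mem hx))
  rwa [star_mul, star_star] at this

theorem Stabilizes.conj_mem (hs : Stabilizes s D) (i : ℕ) {x : M} (hx : x ∈ D) :
    s i * x * star (s i) ∈ D := hs.mul_star_mem i (hs.mul_mem i x hx)

/-- The orthogonal sum of `f 0, …, f (n - 1)`. -/
def diag (s : ℕ → M) (n : ℕ) (f : ℕ → M) : M := ∑ i ∈ Finset.range n, s i * f i * star (s i)

theorem diag_mem (hs : Stabilizes s D) {n : ℕ} {f : ℕ → M} (hf : ∀ i, f i ∈ D) :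
    diag s n f ∈ D := sum_mem fun i _ => hs.conj_mem i (hf i)

theorem diag_nonneg (s : ℕ → M) (n : ℕ) {f : ℕ → M} (hf : ∀ i, 0 ≤ f i) : 0 ≤ diag s n f :=
  Finset.sum_nonneg fun i _ => star_right_conjugate_nonneg (hf i) _

theorem diag_mono (s : ℕ → M) (n : ℕ) {f g : ℕ → M} (hf : ∀ i, f i ≤ g i) :
    diag s n f ≤ diag s n g :=
  Finset.sum_le_sum fun i _ => star_right_conjugate_le_conjugate (hf i) _

theorem star_diag (s : ℕ → M) (n : ℕ) (f : ℕ → M) :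
    star (diag s n f) = diag s n fun i => star (f i) := by
  simp [diag, star_sum, mul_assoc]

theorem diag_sub (s : ℕ → M) (n : ℕ) (f g : ℕ → M) :
    diag s n (fun i => f i - g i) = diag s n f - diag s n g := by
  simp [diag, mul_sub, sub_mul, Finset.sum_sub_distrib]

theorem diag_smul (s : ℕ → M) (n : ℕ) (r : ℝ) (f : ℕ → M) :
    diag s n (fun i => r • f i) = r • diag s n f := by
  simp [diag, Finset.smul_sum]

theorem Stabilizes.diag_mul (hs : Stabilizes s D) (n : ℕ) (f g : ℕ → M) :
    diag s n f * diag s n g = diag s n fun i => f i * g i := by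
  simp only [diag, Finset.sum_mul_sum]
  refine Finset.sum_congr rfl fun i hi => ?_
  rw [Finset.sum_eq_single i]
  · have : s i * f i * star (s i) * (s i * g i * star (s i))
        = s i * f i * (star (s i) * s i) * g i * star (s i) := by noncomm_ring
    rw [this, hs.orth]; simp [mul_assoc]
  · intro j _ hj
    have : s i * f i * star (s i) * (s j * g j * star (s j))
        = s i * f i * (star (s i) * s j) * g j * star (s j) := by noncomm_ring
    rw [this, hs.orth, if_neg (Ne.symm hj)]; simp
  · exact fun h => absurd hi h

/-- The element P = ∑ sᵢ sᵢ* is a projection, so 1 - P = (1 - P)*(1 - P). -/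
theorem Stabilizes.diag_one_le (hs : Stabilizes s D) (n : ℕ) : diag s n (fun _ => 1) ≤ 1 := by
  have h1 : star (diag s n fun _ => (1 : M)) = diag s n fun _ => 1 := by simp [star_diag]
  have h2 := hs.diag_mul n (fun _ => 1) (fun _ => 1)
  have h3 := star_mul_self_nonneg (1 - diag s n fun _ => (1 : M))
  rw [star_sub, star_one, h1, mul_sub, mul_one, sub_mul, one_mul, h2] at h3
  simpa using h3

theorem Stabilizes.diag_algebraMap_le (hs : Stabilizes s D) (n : ℕ) {t : ℝ} (ht : 0 ≤ t) :
    diag s n (fun _ => algebraMap ℝ M t) ≤ algebraMap ℝ M t := by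
  simp only [Algebra.algebraMap_eq_smul_one]
  rw [diag_smul]
  exact smul_le_smul_of_nonneg_left (hs.diag_one_le n) ht

theorem Stabilizes.norm_diag_le (hs : Stabilizes s D) (n : ℕ) {f : ℕ → M} {c : ℝ} (hc : 0 ≤ c)
    (hf : ∀ i, IsSelfAdjoint (f i)) (hfc : ∀ i, ‖f i‖ ≤ c) : ‖diag s n f‖ ≤ c := by
  have hI : ∀ i, f i ∈ Set.Icc (-algebraMap ℝ M c) (algebraMap ℝ M c) := fun i => by
    have h1 := (hf i).le_algebraMap_norm_self
    have h2 := (hf i).neg_algebraMap_norm_le_self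
    have h3 : algebraMap ℝ M ‖f i‖ ≤ algebraMap ℝ M c := algebraMap_mono M (hfc i)
    exact ⟨(neg_le_neg h3).trans h2, h1.trans h3⟩
  have hsa : IsSelfAdjoint (diag s n f) := by
    rw [IsSelfAdjoint, star_diag]; congr 1; ext i; exact (hf i).star_eq
  have hup : diag s n f ≤ algebraMap ℝ M c :=
    (diag_mono s n fun i => (hI i).2).trans (hs.diag_algebraMap_le n hc)
  have hlo : -algebraMap ℝ M c ≤ diag s n f := by
    have h := (diag_mono s n (f := fun i => 0 - f i) (g := fun _ => algebraMap ℝ M c)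
      fun i => by simpa using neg_le.1 (hI i).1).trans (hs.diag_algebraMap_le n hc)
    rw [diag_sub] at h
    have h0 : diag s n (fun _ => (0 : M)) = 0 := by simp [diag]
    rw [h0, zero_sub] at h
    exact neg_le.1 h
  have := norm_cfc_le (f := fun x : ℝ => x) (a := diag s n f) hc fun x hx => by
    rw [Real.norm_eq_abs, abs_le]
    rw [← map_neg] at hlo
    exact ⟨(algebraMap_le_iff_le_spectrum (R := ℝ)).1 hlo x hx,
      (le_algebraMap_iff_spectrum_le (R := ℝ)).1 hup x hx⟩
  rwa [cfc_id' ℝ (diag s n f)] at this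

theorem posCut_eq_posPart {a : M} (ha : IsSelfAdjoint a) (t : ℝ) :
    posCut a t = (a - algebraMap ℝ M t)⁺ := by
  have h : a - algebraMap ℝ M t = cfc (fun x : ℝ => x - t) a := by
    rw [cfc_sub (fun t => t) (fun _ => t) a, cfc_id' ℝ a, cfc_const t a]
  rw [CFC.posPart_def, cfcₙ_eq_cfc, h, ← cfc_comp' _ _ a]
  rfl

/-- Uniqueness of the Jordan decomposition of diag(f) - t. Its negative part is diag((f - t)₋) + t(1
- P), with P the sum of the range projections; positivity of the last term is where t ≥ 0 enters. -/
theorem Stabilizes.posCut_diag (hs : Stabilizes s D) (n : ℕ) {f : ℕ → M}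
    (hf : ∀ i, IsSelfAdjoint (f i)) {t : ℝ} (ht : 0 ≤ t) :
    posCut (diag s n f) t = diag s n fun i => posCut (f i) t := by
  have hsa : IsSelfAdjoint (diag s n f) := by
    rw [IsSelfAdjoint, star_diag]; congr 1; ext i; exact (hf i).star_eq
  have hp : ∀ i, posCut (f i) t = (f i - algebraMap ℝ M t)⁺ := fun i => posCut_eq_posPart (hf i) t
  have hsub : ∀ i, IsSelfAdjoint (f i - algebraMap ℝ M t) := fun i =>
    (hf i).sub (IsSelfAdjoint.algebraMap M (.all t))
  set N := diag s n (fun i => (f i - algebraMap ℝ M t)⁻)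
    + (algebraMap ℝ M t - diag s n fun _ => algebraMap ℝ M t) with hN
  rw [posCut_eq_posPart hsa]
  simp only [hp]
  refine (CFC.posPart_negPart_unique (c := N) ?_ ?_ ?_ ?_).1
  · have : diag s n f - (diag s n fun _ => algebraMap ℝ M t)
        = diag s n (fun i => (f i - algebraMap ℝ M t)⁺)
          - diag s n (fun i => (f i - algebraMap ℝ M t)⁻) := by
      rw [← diag_sub, ← diag_sub]
      congr 1; ext i
      exact (CFC.posPart_sub_negPart _ (hsub i)).symm
    rw [hN, ← sub_sub, ← this]; abel
  · rw [hN, mul_add, mul_sub, hs.diag_mul, hs.diag_mul]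
    simp only [CFC.posPart_mul_negPart, Algebra.algebraMap_eq_smul_one, mul_smul_comm, mul_one]
    rw [diag_smul]; simp [diag]
  · exact diag_nonneg s n fun i => CFC.posPart_nonneg _
  · exact add_nonneg (diag_nonneg s n fun i => CFC.negPart_nonneg _)
      (sub_nonneg.2 (hs.diag_algebraMap_le n ht))

theorem CuntzSub.diag (hs : Stabilizes s D) (n : ℕ) {f g : ℕ → M} (hf : ∀ i, 0 ≤ f i)
    (hg : ∀ i, 0 ≤ g i) (h : ∀ i, CuntzSub D (f i) (g i)) :
    CuntzSub D (diag s n f) (diag s n g) := by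
  intro ε hε
  choose v hv hvε using fun i => h i (ε / 2) (by positivity)
  refine ⟨CompletelyClose.diag s n v, diag_mem hs hv, ?_⟩
  rw [star_diag, hs.diag_mul, hs.diag_mul, ← diag_sub]
  refine (hs.norm_diag_le n (c := ε / 2) (by positivity) (fun i => ?_) fun i =>
    (hvε i).le).trans_lt (by linarith)
  exact (star_right_conjugate_nonneg (hg i) _).isSelfAdjoint.sub (hf i).isSelfAdjoint

/-- The row v = ∑ rⱼ sⱼ* satisfies v sᵢ = rᵢ, so conjugating the orthogonal sum by v collapses it to
the ordinary sum. -/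
theorem CuntzSub.sum_conj (hs : Stabilizes s D) (n : ℕ) {r b : ℕ → M} (hr : ∀ i, r i ∈ D) :
    CuntzSub D (∑ i ∈ Finset.range n, r i * b i * star (r i)) (CompletelyClose.diag s n b) := by
  have hv : ∑ i ∈ Finset.range n, r i * star (s i) ∈ D :=
    sum_mem fun i _ => hs.mul_star_mem i (hr i)
  convert CuntzSub.of_conj_mem (b := CompletelyClose.diag s n b) hv using 1
  have hmul : ∀ i ∈ Finset.range n, (∑ j ∈ Finset.range n, r j * star (s j)) * s i = r i := by
    intro i hi
    rw [Finset.sum_mul, Finset.sum_eq_single i]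
    · rw [mul_assoc, hs.orth]; simp
    · intro j _ hj; rw [mul_assoc, hs.orth, if_neg hj, mul_zero]
    · exact fun h => absurd hi h
  set v := ∑ j ∈ Finset.range n, r j * star (s j)
  rw [CompletelyClose.diag, Finset.mul_sum, Finset.sum_mul]
  refine Finset.sum_congr rfl fun i hi => ?_
  have : v * (s i * b i * star (s i)) * star v = (v * s i) * b i * star (v * s i) := by
    rw [star_mul]; noncomm_ring
  rw [this, hmul i hi]

theorem CuntzSub.sum [IsClosed (D : Set M)] (hs : Stabilizes s D) (n : ℕ) {b : ℕ → M}
    (hb : ∀ i, b i ∈ D) (hb0 : ∀ i, 0 ≤ b i) :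
    CuntzSub D (∑ i ∈ Finset.range n, b i) (CompletelyClose.diag s n b) := by
  refine .of_approx fun ε hε => ?_
  set δ := ε / (2 * (n + 1)) / 2 with hδ
  have hδ0 : 0 < δ := by positivity
  refine ⟨_, ?_, CuntzSub.sum_conj hs n (r := fun i => cfc (ramp δ (2 * δ)) (b i))
    fun i => cfc_mem_of_map_zero (hb i) (by fun_prop) (ramp_zero hδ0.le)⟩
  rw [← Finset.sum_sub_distrib]
  refine (norm_sum_le _ _).trans_lt ?_
  calc _ ≤ ∑ i ∈ Finset.range n, 2 * δ := by
        gcongr with i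
        rw [star_cfc_real]
        exact norm_ramp_conj_sub_le (hb0 i) hδ0
    _ = ε * (n / (2 * (n + 1))) := by
        rw [Finset.sum_const, Finset.card_range, nsmul_eq_mul, hδ]; field_simp
    _ < ε * 1 := by
        gcongr
        rw [div_lt_one (by positivity)]
        have : (0 : ℝ) ≤ n := by positivity
        linarith
    _ = ε := mul_one ε

/-- Both elements come from x = sᵢ√a, as x*x = a and x x* = sᵢ a sᵢ*. -/
theorem CuntzSub.conj_isometry [IsClosed (D : Set M)] (hs : Stabilizes s D) (i : ℕ) {a : M}
    (ha : a ∈ D) (ha0 : 0 ≤ a) :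
    CuntzSub D (s i * a * star (s i)) a ∧ CuntzSub D a (s i * a * star (s i)) := by
  have hx : s i * sqrtPos a ∈ D := hs.mul_mem i _ (sqrtPos_mem ha)
  have h1 : star (s i * sqrtPos a) * (s i * sqrtPos a) = a := by
    have : star (s i * sqrtPos a) * (s i * sqrtPos a)
        = sqrtPos a * (star (s i) * s i) * sqrtPos a := by
      rw [star_mul, star_sqrtPos]; noncomm_ring
    rw [this, hs.orth, if_pos rfl, mul_one, sqrtPos_mul_self ha0]
  have h2 : (s i * sqrtPos a) * star (s i * sqrtPos a) = s i * a * star (s i) := by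
    rw [star_mul, star_sqrtPos, mul_assoc, ← mul_assoc (sqrtPos a), sqrtPos_mul_self ha0,
      mul_assoc]
  have h3 := CuntzSub.star_mul_self hx
  have h4 := CuntzSub.star_mul_self (star_mem hx)
  rw [star_star] at h4
  rw [h1, h2] at h3 h4
  exact ⟨h4, h3⟩

end Diagonal

/-! ### Transfer of Cuntz comparison between close subalgebras -/

section Transfer

variable {M : Type*} [CStarAlgebra M] [PartialOrder M] [StarOrderedRing M]
  {D E : NonUnitalStarSubalgebra ℂ M} {α : ℝ}

/-- Every contraction of `D` is within `α` of a contraction of `E`. -/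
def UnitBallNear (α : ℝ) (D E : NonUnitalStarSubalgebra ℂ M) : Prop :=
  ∀ x ∈ D, ‖x‖ ≤ 1 → ∃ y ∈ E, ‖y‖ ≤ 1 ∧ ‖x - y‖ ≤ α

theorem UnitBallNear.exists_isSelfAdjoint (h : UnitBallNear α D E) {c : M} (hc : c ∈ D)
    (hsa : IsSelfAdjoint c) (hc1 : ‖c‖ ≤ 1) : ∃ x ∈ E, IsSelfAdjoint x ∧ ‖x - c‖ ≤ α := by
  obtain ⟨y, hy, -, hyc⟩ := h c hc hc1
  refine ⟨(1 / 2 : ℝ) • (y + star y), real_smul_mem (add_mem hy (star_mem hy)) _, ?_, ?_⟩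
  · rw [IsSelfAdjoint, star_smul, star_trivial, star_add, star_star, add_comm]
  · have e : (1 / 2 : ℝ) • (y + star y) - c = (1 / 2 : ℝ) • ((y - c) + star (y - c)) := by
      rw [star_sub, hsa.star_eq]
      have : c = (1 / 2 : ℝ) • (c + c) := by rw [← two_smul ℝ c, smul_smul]; norm_num
      conv_lhs => rw [this, ← smul_sub]
      congr 1; abel
    rw [e, norm_smul]
    have h1 := norm_add_le (y - c) (star (y - c))
    rw [norm_star, norm_sub_rev] at h1
    rw [Real.norm_of_nonneg (by norm_num)]
    linarith

theorem norm_star_conj_le {w d : M} (hw : ‖w‖ ≤ 1) : ‖star w * d * w‖ ≤ ‖d‖ := by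
  calc _ ≤ ‖star w‖ * ‖d‖ * ‖w‖ := (norm_mul_le _ _).trans (by gcongr; exact norm_mul_le _ _)
    _ ≤ 1 * ‖d‖ * 1 := by rw [norm_star]; gcongr
    _ = ‖d‖ := by ring

theorem norm_star_conj_sub_le {w z e : M} (hw : ‖w‖ ≤ 1) (hz : ‖z‖ ≤ 1) (hzw : ‖z - w‖ ≤ α)
    (he : ‖e‖ ≤ 1) : ‖star z * e * z - star w * e * w‖ ≤ 2 * α := by
  have hα := (norm_nonneg _).trans hzw
  have e1 : star z * e * z - star w * e * w
      = star (z - w) * e * z + star w * e * (z - w) := by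
    rw [star_sub]; noncomm_ring
  have h1 : ‖star (z - w) * e * z‖ ≤ α := by
    calc _ ≤ ‖star (z - w)‖ * ‖e‖ * ‖z‖ :=
          (norm_mul_le _ _).trans (by gcongr; exact norm_mul_le _ _)
      _ ≤ α * 1 * 1 := by rw [norm_star]; gcongr
      _ = α := by ring
  have h2 : ‖star w * e * (z - w)‖ ≤ α := by
    calc _ ≤ ‖star w‖ * ‖e‖ * ‖z - w‖ :=
          (norm_mul_le _ _).trans (by gcongr; exact norm_mul_le _ _)
      _ ≤ 1 * 1 * α := by rw [norm_star]; gcongr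
      _ = α := by ring
  rw [e1]
  linarith [norm_add_le (star (z - w) * e * z) (star w * e * (z - w))]

theorem norm_one_le_one : ‖(1 : M)‖ ≤ 1 := by
  rcases subsingleton_or_nontrivial M with h | h
  · simp [Subsingleton.elim (1 : M) 0]
  · exact CStarRing.norm_one.le

theorem isSelfAdjoint_star_conj {a : M} (ha : IsSelfAdjoint a) (w : M) :
    IsSelfAdjoint (star w * a * w) := by
  rw [IsSelfAdjoint, star_mul, star_mul, star_star, ha.star_eq, mul_assoc]

/-- The comparison c ≾ y gives z = √y u with z*z ≈ c, and e z = z gives z*z = 2z*ez - z*z = 2z*(e -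
1/2)z. Moving z and e to w and x' in `D` yields x ≤ 2w*(x' - 1/2)₊w + 1/4. -/
theorem UnitBallNear.cuntzSub_of_unit [IsClosed (D : Set M)] [IsClosed (E : Set M)]
    (hED : UnitBallNear α E D) (hα : α < 1 / 42) {c e y x x' : M} (hc1 : ‖c‖ ≤ 1)
    (he1 : ‖e‖ ≤ 1) (hy : y ∈ E) (hy0 : 0 ≤ y) (hey : e * y = y) (hcy : CuntzSub E c y)
    (hx : x ∈ D) (hxs : IsSelfAdjoint x) (hx' : x' ∈ D) (hxs' : IsSelfAdjoint x')
    (hxc : ‖x - c‖ ≤ α) (hxe : ‖x' - e‖ ≤ α) :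
    CuntzSub D (posCut x (1 / 4)) (posCut x' (1 / 2)) := by
  obtain ⟨u, hu, hz1, hzc⟩ := hcy.exists_contraction hy0 hc1 (η := 1 / 42) (by norm_num)
  set z := sqrtPos y * u with hz
  have hez : e * z = z := by rw [hz, ← mul_assoc, mul_sqrtPos_eq hy0 hey]
  obtain ⟨w, hw, hw1, hzw⟩ := hED z (mul_mem (sqrtPos_mem hy) hu) hz1
  set A := star w * (x' - algebraMap ℝ M (1 / 2)) * w with hA
  have hAsa : IsSelfAdjoint A :=
    isSelfAdjoint_star_conj (hxs'.sub (IsSelfAdjoint.algebraMap M (.all _))) w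
  -- Error budget: α for x against c, 1/42 for z*z against c, 4α + 2α for the doubled term, 2α for
  -- z*z against w*w. The total 9α + 1/42 is below 10/42 < 1/4.
  have key : ‖x - (2 : ℝ) • A‖ ≤ 1 / 4 := by
    have e1 : x - (2 : ℝ) • A = (x - c) - (star z * z - c)
        + ((2 : ℝ) • (star z * e * z - star w * e * w) - (2 : ℝ) • (star w * (x' - e) * w)
          - (star z * 1 * z - star w * 1 * w)) := by
      have h1 : star z * e * z = star z * z := by rw [mul_assoc, hez]
      have h2 : (2 : ℝ) • A = (2 : ℝ) • (star w * x' * w) - star w * w := by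
        rw [hA, Algebra.algebraMap_eq_smul_one, mul_sub, sub_mul, smul_sub]
        congr 1
        simp [smul_smul]
      rw [h1, h2, mul_one, mul_one, two_smul, two_smul, two_smul]
      noncomm_ring
    have n1 := norm_star_conj_sub_le hw1 hz1 hzw he1
    have n2 := norm_star_conj_sub_le hw1 hz1 hzw norm_one_le_one
    have n3 := (norm_star_conj_le (d := x' - e) hw1).trans hxe
    have t2 : ∀ a : M, ‖(2 : ℝ) • a‖ = 2 * ‖a‖ := fun a => by rw [norm_smul]; norm_num
    rw [e1]
    refine (norm_add_le _ _).trans ?_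
    have m1 := norm_sub_le (x - c) (star z * z - c)
    have m2 := norm_sub_le ((2 : ℝ) • (star z * e * z - star w * e * w)
      - (2 : ℝ) • (star w * (x' - e) * w)) (star z * 1 * z - star w * 1 * w)
    have m3 := norm_sub_le ((2 : ℝ) • (star z * e * z - star w * e * w))
      ((2 : ℝ) • (star w * (x' - e) * w))
    rw [t2, t2] at m3
    linarith
  have hpD : posCut x' (1 / 2) ∈ D := posCut_mem hx' (by norm_num)
  have hcD : star w * posCut x' (1 / 2) * w ∈ D := mul_mem (mul_mem (star_mem hw) hpD) hw
  have hc0 : 0 ≤ star w * posCut x' (1 / 2) * w :=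
    star_left_conjugate_nonneg (posCut_nonneg _ _) w
  have hle : x ≤ (2 : ℝ) • (star w * posCut x' (1 / 2) * w) + algebraMap ℝ M (1 / 4) := by
    refine (le_add_of_norm_sub_le hxs (.smul (.all _) hAsa) key).trans ?_
    gcongr
    exact star_left_conjugate_le_conjugate (sub_le_posCut hxs' _) w
  refine ((CuntzSub.posCut_of_le hx (real_smul_mem hcD 2) hxs (by norm_num) hle).trans
    (.smul_left hcD hc0 (by norm_num))).trans ?_
  simpa using CuntzSub.of_conj_mem (b := posCut x' (1 / 2)) (star_mem hw)

/-- The return trip. For z = √p u with p = (y - 1/4)₊, spectral calculus gives z*z ≤ 4 z*yz, and y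
and z can then be replaced by c' and an element w of `E`. No local unit is needed in this direction.
-/
theorem UnitBallNear.cuntzSub_reverse [IsClosed (D : Set M)] [IsClosed (E : Set M)]
    (hDE : UnitBallNear α D E) (hα : α < 1 / 42) {c c' x y : M} (hc : c ∈ E) (hc' : c' ∈ E)
    (hcs : IsSelfAdjoint c) (hc0' : 0 ≤ c') (hc1 : ‖c‖ ≤ 1) (hc1' : ‖c'‖ ≤ 1)
    (hy : y ∈ D) (hxs : IsSelfAdjoint x) (hys : IsSelfAdjoint y)
    (hxc : ‖x - c‖ ≤ α) (hyc : ‖y - c'‖ ≤ α)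
    (h : CuntzSub D (posCut x (5 / 8)) (posCut y (1 / 4))) :
    CuntzSub E (posCut c (19 / 20)) c' := by
  have hxn : ‖posCut x (5 / 8)‖ ≤ 1 := by
    have h1 : x ≤ algebraMap ℝ M (43 / 42) := by
      refine hxs.le_algebraMap_norm_self.trans (algebraMap_mono M ?_)
      have := norm_add_le (x - c) c
      rw [sub_add_cancel] at this
      linarith
    refine norm_cfc_le zero_le_one fun t ht => ?_
    have h2 := (le_algebraMap_iff_spectrum_le (R := ℝ)).1 h1 t ht
    rw [Real.norm_of_nonneg (le_max_right _ _)]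
    exact max_le (by linarith) zero_le_one
  obtain ⟨u, hu, hz1, hzc⟩ := h.exists_contraction (posCut_nonneg _ _) hxn
    (η := 1 / 100) (by norm_num)
  set p := posCut y (1 / 4) with hp
  have hpD : p ∈ D := posCut_mem hy (by norm_num)
  set z := sqrtPos p * u with hz
  have hzy : (1 / 4 : ℝ) • (star z * z) ≤ star z * y * z := by
    have h0 : 0 ≤ sqrtPos p * (y - algebraMap ℝ M (1 / 4)) * sqrtPos p := by
      have e1 : sqrtPos p = cfc (fun t => Real.sqrt (max (t - 1 / 4) 0)) y := by
        rw [hp, sqrtPos, cfc_posCut hys Real.continuous_sqrt]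
      have e2 : y - algebraMap ℝ M (1 / 4) = cfc (fun t : ℝ => t - 1 / 4) y := by
        rw [cfc_sub (fun t => t) (fun _ => (1 / 4 : ℝ)) y, cfc_id' ℝ y, cfc_const (1 / 4) y]
      rw [e1, e2, cfc_conj (by fun_prop) (by fun_prop)]
      refine cfc_nonneg fun t _ => ?_
      rcases le_total t (1 / 4) with ht | ht
      · rw [max_eq_right (by linarith)]; simp
      · exact mul_nonneg (mul_nonneg (Real.sqrt_nonneg _) (by linarith)) (Real.sqrt_nonneg _)
    have h1 := star_left_conjugate_nonneg h0 u
    have e3 : star u * (sqrtPos p * (y - algebraMap ℝ M (1 / 4)) * sqrtPos p) * u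
        = star z * y * z - (1 / 4 : ℝ) • (star z * z) := by
      rw [hz, star_mul, star_sqrtPos, Algebra.algebraMap_eq_smul_one]
      simp only [mul_sub, sub_mul, mul_smul_comm, smul_mul_assoc, mul_one]
      noncomm_ring
    rw [e3] at h1
    exact sub_nonneg.1 h1
  obtain ⟨w, hw, hw1, hzw⟩ := hDE z (mul_mem (sqrtPos_mem hpD) hu) hz1
  have hcD : star w * c' * w ∈ E := mul_mem (mul_mem (star_mem hw) hc') hw
  have hcD0 : 0 ≤ star w * c' * w := star_left_conjugate_nonneg hc0' w
  have step1 : c ≤ x + algebraMap ℝ M α :=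
    le_add_of_norm_sub_le hcs hxs (by rwa [norm_sub_rev])
  have step2 : posCut x (5 / 8) ≤ star z * z + algebraMap ℝ M (1 / 100) :=
    le_add_of_norm_sub_le (posCut_nonneg _ _).isSelfAdjoint (IsSelfAdjoint.star_mul_self z)
      (by rwa [norm_sub_rev])
  have step3 : star z * z ≤ (4 : ℝ) • (star z * y * z) := by
    have := smul_le_smul_of_nonneg_left hzy (by norm_num : (0 : ℝ) ≤ 4)
    rw [smul_smul] at this
    norm_num at this ⊢
    exact this
  have step4 : star z * y * z ≤ star w * c' * w + algebraMap ℝ M (3 * α) := by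
    refine le_add_of_norm_sub_le (isSelfAdjoint_star_conj hys z) hcD0.isSelfAdjoint ?_
    have e1 : star z * y * z - star w * c' * w
        = star z * (y - c') * z + (star z * c' * z - star w * c' * w) := by noncomm_ring
    rw [e1]
    have n1 := norm_star_conj_sub_le hw1 hz1 hzw hc1'
    have n3 := (norm_star_conj_le (d := y - c') hz1).trans hyc
    linarith [norm_add_le (star z * (y - c') * z) (star z * c' * z - star w * c' * w)]
  -- The constants add up to α + 5/8 + 1/100 + 4·3α, which is less than 13/42 + 0.635 < 19/20.
  have hle : c ≤ (4 : ℝ) • (star w * c' * w) + algebraMap ℝ M (19 / 20) := by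
    have s4 := smul_le_smul_of_nonneg_left step4 (by norm_num : (0 : ℝ) ≤ 4)
    have h1 : c ≤ (4 : ℝ) • (star w * c' * w) + (4 : ℝ) • algebraMap ℝ M (3 * α)
        + algebraMap ℝ M (1 / 100) + algebraMap ℝ M (5 / 8) + algebraMap ℝ M α := by
      refine step1.trans ?_
      gcongr
      refine (le_posCut_add hxs (5 / 8)).trans ?_
      gcongr
      refine step2.trans ?_
      gcongr
      refine step3.trans ?_
      rwa [smul_add] at s4
    have h2 : (4 : ℝ) • algebraMap ℝ M (3 * α) + algebraMap ℝ M (1 / 100)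
        + algebraMap ℝ M (5 / 8) + algebraMap ℝ M α ≤ algebraMap ℝ M (19 / 20) := by
      have : (4 : ℝ) • algebraMap ℝ M (3 * α) = algebraMap ℝ M (4 * (3 * α)) := by
        rw [Algebra.algebraMap_eq_smul_one, Algebra.algebraMap_eq_smul_one, smul_smul]
      rw [this, ← map_add, ← map_add, ← map_add]
      exact algebraMap_mono M (by linarith)
    refine h1.trans ?_
    rw [add_assoc, add_assoc, add_assoc] at *
    gcongr
  refine ((CuntzSub.posCut_of_le hc (real_smul_mem hcD 4) hcs (by norm_num) hle).trans
    (.smul_left hcD hcD0 (by norm_num))).trans ?_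
  simpa using CuntzSub.of_conj_mem (b := c') (star_mem hw)

end Transfer

/-! ### Suprema of rapidly increasing sequences -/

section Suprema

variable {M : Type*} [CStarAlgebra M] [PartialOrder M] [StarOrderedRing M]
  {D : NonUnitalStarSubalgebra ℂ M} {s : ℕ → M}

/-- An exact form of a ≾ q away from 0. If v q v* ≥ a - ε and k is a ramp of `a` on [ε, 2ε], then k
v q v* k ≥ k(a - ε)k ≥ ε f(a). The resulting Y lies under every left unit of `q`. -/
theorem CuntzSub.exists_star_mul_self_eq_cfc [IsClosed (D : Set M)] {a q : M} (ha : a ∈ D)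
    (ha0 : 0 ≤ a) (hq : q ∈ D) (hq0 : 0 ≤ q) (h : CuntzSub D a q) {f : ℝ → ℝ} (hf : Continuous f)
    {ε : ℝ} (hε : 0 < ε) (hf0 : ∀ t, 0 ≤ f t) (hf1 : ∀ t, f t ≤ 1)
    (hfε : ∀ t ≤ 2 * ε, f t = 0) :
    ∃ Y ∈ D, star Y * Y = cfc f a ∧ ∀ e, e * q = q → e * Y = Y := by
  obtain ⟨v, hv, hva⟩ := h ε hε
  set k := cfc (ramp ε (2 * ε)) a with hk
  have hkD : k ∈ D := cfc_mem_of_map_zero ha (by fun_prop) (ramp_zero hε.le)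
  have hks : star k = k := star_cfc_real _ _
  have hksa : IsSelfAdjoint k := hks
  set Q := sqrtPos q * ((Real.sqrt (1 / ε)) • (star v * k)) with hQ
  have hQD : Q ∈ D := mul_mem (sqrtPos_mem hq) (real_smul_mem (mul_mem (star_mem hv) hkD) _)
  have hQQ : star Q * Q = (1 / ε) • (k * (v * q * star v) * k) := by
    have : star Q * Q = (Real.sqrt (1 / ε) * Real.sqrt (1 / ε)) •
        (k * v * (sqrtPos q * sqrtPos q) * star v * k) := by
      rw [hQ, star_mul, star_smul, star_trivial, star_mul, star_star, hks, star_sqrtPos]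
      simp only [smul_mul_assoc, mul_smul_comm, smul_smul]
      congr 1; noncomm_ring
    rw [this, Real.mul_self_sqrt (by positivity), sqrtPos_mul_self hq0]
    congr 1; noncomm_ring
  have hle : cfc f a ≤ star Q * Q := by
    have h1 : a - algebraMap ℝ M ε ≤ v * q * star v := by
      rw [sub_le_iff_le_add]
      exact le_add_of_norm_sub_le ha0.isSelfAdjoint
        (star_right_conjugate_nonneg hq0 v).isSelfAdjoint (by rw [norm_sub_rev]; exact hva.le)
    have h2 : k * (a - algebraMap ℝ M ε) * k
        = cfc (fun t => ramp ε (2 * ε) t * (t - ε) * ramp ε (2 * ε) t) a := by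
      rw [← cfc_conj (f := fun t => t - ε) (by fun_prop) (by fun_prop),
        cfc_sub (fun t => t) (fun _ => ε) a, cfc_id' ℝ a, cfc_const ε a]
    rw [hQQ]
    refine le_trans ?_ (smul_le_smul_of_nonneg_left (hksa.conjugate_le_conjugate h1)
      (by positivity : 0 ≤ 1 / ε))
    rw [h2, ← cfc_smul (1 / ε) _ a (by fun_prop)]
    refine cfc_mono (fun t _ => ?_) hf.continuousOn (by fun_prop)
    simp only [smul_eq_mul]
    rcases le_total t (2 * ε) with ht | ht
    · rw [hfε t ht]
      rcases le_total t ε with ht' | ht'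
      · rw [ramp_of_le ht']; simp
      · have := ramp_nonneg (l := ε) (u := 2 * ε) (by linarith) t
        exact mul_nonneg (by positivity) (mul_nonneg (mul_nonneg this (by linarith)) this)
    · rw [ramp_of_ge (by linarith) ht, one_mul, mul_one, one_div, ← div_eq_inv_mul,
        le_div_iff₀ hε]
      nlinarith [hf1 t]
  obtain ⟨Y, hY, hYY, hYe⟩ := exists_star_mul_self_eq (cfc_mem_of_map_zero ha hf
    (hfε 0 (by positivity))) hQD (cfc_nonneg fun t _ => hf0 t) hle
  refine ⟨Y, hY, hYY, fun e he => hYe e ?_⟩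
  rw [hQ, ← mul_assoc, mul_sqrtPos_eq hq0 he]

theorem cfc_le_one_of_le {a : M} {f : ℝ → ℝ} (h : ∀ t, f t ≤ 1) : cfc f a ≤ 1 :=
  cfc_le_one f a fun t _ => h t

theorem star_mul_le_one_of {x : M} {c : M} (h : star x * x = c) (hc : c ≤ 1) : ‖x‖ ≤ 1 := by
  have h0 : 0 ≤ c := h ▸ star_mul_self_nonneg x
  have h1 := (CStarAlgebra.norm_le_one_iff_of_nonneg c h0).2 hc
  rw [← h, CStarRing.norm_star_mul_self] at h1
  nlinarith [norm_nonneg x]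

theorem star_right_conj_le_one {x a : M} (hx : ‖x‖ ≤ 1) (ha : a ≤ 1) : x * a * star x ≤ 1 := by
  have h1 := star_right_conjugate_le_conjugate ha x
  rw [mul_one] at h1
  refine h1.trans ((CStarAlgebra.norm_le_one_iff_of_nonneg _ (mul_star_self_nonneg x)).1 ?_)
  rw [CStarRing.norm_self_mul_star]
  nlinarith [norm_nonneg x]

/-- The supremum is b = ∑ 2⁻ⁿ dₙ: each dₙ is at most 2ⁿ b, and b is a norm limit of partial sums
that are each dominated by a multiple of some d_N. -/
theorem exists_cuntz_sup_of_nested [IsClosed (D : Set M)] {d : ℕ → M} (hd : ∀ n, d n ∈ D)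
    (hd0 : ∀ n, 0 ≤ d n) (hd1 : ∀ n, ‖d n‖ ≤ 1) (hdd : ∀ n, d (n + 1) * d n = d n) :
    ∃ b ∈ D, 0 ≤ b ∧ (∀ n, CuntzSub D (d n) b) ∧
      ∀ η > 0, ∃ n, CuntzSub D (posCut b η) (d n) := by
  have hunit : ∀ n m, n < m → d m * d n = d n := by
    intro n m hnm
    induction m, hnm using Nat.le_induction with
    | base => exact hdd n
    | succ m _ ih => rw [← ih, ← mul_assoc, hdd]
  have hunit' : ∀ n m, n < m → d n * d m = d n := fun n m hnm => by
    have := congrArg star (hunit n m hnm)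
    rwa [star_mul, (hd0 n).isSelfAdjoint.star_eq, (hd0 m).isSelfAdjoint.star_eq] at this
  have hsum : Summable fun n => ((1 / 2 : ℝ) ^ n) • d n := by
    refine Summable.of_norm_bounded (g := fun n => (1 / 2 : ℝ) ^ n)
      (summable_geometric_of_lt_one (by norm_num) (by norm_num)) fun n => ?_
    rw [norm_smul, Real.norm_of_nonneg (by positivity)]
    exact mul_le_of_le_one_right (by positivity) (hd1 n)
  have hterm : ∀ n, 0 ≤ ((1 / 2 : ℝ) ^ n) • d n := fun n => smul_nonneg (by positivity) (hd0 n)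
  have hlim := hsum.hasSum.tendsto_sum_nat
  set b := ∑' n, ((1 / 2 : ℝ) ^ n) • d n with hb
  have hSD : ∀ N, ∑ n ∈ Finset.range N, ((1 / 2 : ℝ) ^ n) • d n ∈ D := fun N =>
    sum_mem fun n _ => real_smul_mem (hd n) _
  have hbD : b ∈ D := (inferInstance : IsClosed (D : Set M)).mem_of_tendsto hlim
    (Eventually.of_forall hSD)
  have hb0 : 0 ≤ b := tsum_nonneg hterm
  refine ⟨b, hbD, hb0, fun n => ?_, fun η hη => ?_⟩
  · refine .of_le_smul (hd n) hbD (hd0 n) hb0 (r := 2 ^ n) (by positivity) ?_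
    have h1 : ((1 / 2 : ℝ) ^ n) • d n ≤ b := hsum.le_tsum n fun j _ => hterm j
    have h2 := smul_le_smul_of_nonneg_left h1 (by positivity : (0 : ℝ) ≤ 2 ^ n)
    rwa [smul_smul, ← mul_pow, mul_one_div_cancel (by norm_num), one_pow, one_smul] at h2
  · obtain ⟨N, hN⟩ := Metric.tendsto_atTop.1 hlim η hη
    refine ⟨N, ?_⟩
    have hN := (hN N le_rfl).le
    rw [dist_comm, dist_eq_norm] at hN
    set S := ∑ n ∈ Finset.range N, ((1 / 2 : ℝ) ^ n) • d n with hS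
    have hS0 : 0 ≤ S := Finset.sum_nonneg fun n _ => hterm n
    refine (CuntzSub.posCut_of_norm hbD (hSD N) hb0.isSelfAdjoint hS0 hN).trans ?_
    -- The partial sum stops at N - 1, so d N acts as a unit on every term.
    have e1 : S = star (d N) * S * d N := by
      rw [(hd0 N).isSelfAdjoint.star_eq, hS, Finset.mul_sum, Finset.sum_mul]
      refine Finset.sum_congr rfl fun n hn => ?_
      rw [mul_smul_comm, smul_mul_assoc, hunit n N (Finset.mem_range.1 hn),
        hunit' n N (Finset.mem_range.1 hn)]
    have h1 : S ≤ ‖S‖ • (star (d N) * d N) := by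
      conv_lhs => rw [e1]
      exact CStarAlgebra.star_left_conjugate_le_norm_smul hS0.isSelfAdjoint
    rw [(hd0 N).isSelfAdjoint.star_eq] at h1
    have hddD : d N * d N ∈ D := mul_mem (hd N) (hd N)
    have hdd0 : 0 ≤ d N * d N := by
      have := mul_star_self_nonneg (d N)
      rwa [(hd0 N).isSelfAdjoint.star_eq] at this
    refine (CuntzSub.of_le_smul (hSD N) hddD hS0 hdd0 (norm_nonneg S) h1).trans ?_
    have h2 := CuntzSub.of_conj_mem (b := d N) (sqrtPos_mem (hd N))
    have h3 : sqrtPos (d N) * d N * star (sqrtPos (d N)) = d N * d N := by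
      conv_rhs => rw [← sqrtPos_mul_self (hd0 N)]
      conv_lhs => enter [1, 2]; rw [← sqrtPos_mul_self (hd0 N)]
      rw [star_sqrtPos]; noncomm_ring
    rwa [h3] at h2

/-! ### Turning a rapidly increasing sequence into a nested one. -/

/-- The partial isometry-like elements that move the `n`-th term of a rapidly increasing sequence
into its final position. -/
def towerMap (s x θ : ℕ → M) : ℕ → M
  | 0 => s 0 * sqrtPos (θ 0)
  | n + 1 => towerMap s x θ n * star (x n)
      + s (n + 1) * sqrtPos (θ (n + 1) - x n * θ n * star (x n))

/-- The new summand has range in that of s_{n+1}, orthogonal to all earlier ones, so the cross terms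
of T*T vanish and xₙθₙxₙ* is completed exactly to θ_{n+1}. -/
theorem towerMap_spec [IsClosed (D : Set M)] (hs : Stabilizes s D) {x θ : ℕ → M}
    (hx : ∀ n, x n ∈ D) (hθ : ∀ n, θ n ∈ D) (hθ0 : ∀ n, 0 ≤ θ n)
    (hpos : ∀ n, 0 ≤ θ (n + 1) - x n * θ n * star (x n)) (n : ℕ) :
    towerMap s x θ n ∈ D ∧ star (towerMap s x θ n) * towerMap s x θ n = θ n ∧
      ∀ j > n, star (s j) * towerMap s x θ n = 0 := by
  have hsb : ∀ i (u : M), star (s i) * (s i * u) = u := fun i u => by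
    rw [← mul_assoc, hs.orth, if_pos rfl, one_mul]
  have hsz : ∀ i j (u : M), i ≠ j → star (s i) * (s j * u) = 0 := fun i j u hij => by
    rw [← mul_assoc, hs.orth, if_neg hij, zero_mul]
  induction n with
  | zero =>
    refine ⟨hs.mul_mem _ _ (sqrtPos_mem (hθ 0)), ?_, fun j hj => ?_⟩
    · rw [towerMap, star_mul, star_sqrtPos, mul_assoc, hsb, sqrtPos_mul_self (hθ0 0)]
    · rw [towerMap, hsz _ _ _ (by omega)]
  | succ n ih =>
    obtain ⟨h1, h2, h3⟩ := ih
    refine ⟨add_mem (mul_mem h1 (star_mem (hx n))) (hs.mul_mem _ _ (sqrtPos_mem (sub_mem (hθ _)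
      (mul_mem (mul_mem (hx n) (hθ n)) (star_mem (hx n)))))), ?_, fun j hj => ?_⟩
    · rw [towerMap]
      set T := towerMap s x θ n
      set r := θ (n + 1) - x n * θ n * star (x n) with hr
      have h4 := h3 (n + 1) (by omega)
      have h5 : star T * s (n + 1) = 0 := by
        have := congrArg star h4
        rwa [star_mul, star_star, star_zero] at this
      have e1 : star (T * star (x n) + s (n + 1) * sqrtPos r)
            * (T * star (x n) + s (n + 1) * sqrtPos r)
          = x n * (star T * T) * star (x n) + x n * (star T * s (n + 1)) * sqrtPos r
            + sqrtPos r * (star (s (n + 1)) * T) * star (x n)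
            + sqrtPos r * (star (s (n + 1)) * (s (n + 1) * sqrtPos r)) := by
        rw [star_add, star_mul, star_mul, star_star, star_sqrtPos]; noncomm_ring
      rw [e1, h2, h4, h5, hsb, sqrtPos_mul_self (hpos n), hr]
      simp
    · rw [towerMap, mul_add, ← mul_assoc, h3 j (by omega), hsz _ _ _ (by omega)]
      simp

/-- Four spectral windows between 1/4 and 1/2 are used: xₙ*xₙ is 1 where θₙ lives, θₙ is 1 where mₙ
lives, and mₙ is 1 where (yₙ - 1/2)₊ lives, while m_{n+1} is a left unit for xₙ. The elements dₙ =
Tₙ mₙ Tₙ* are then nested and Cuntz equivalent to mₙ. -/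
theorem exists_cuntz_sup [IsClosed (D : Set M)] (hs : Stabilizes s D) {y : ℕ → M}
    (hy : ∀ n, y n ∈ D) (hysa : ∀ n, IsSelfAdjoint (y n))
    (h : ∀ n, CuntzSub D (posCut (y n) (1 / 4)) (posCut (y (n + 1)) (1 / 2))) :
    ∃ b ∈ D, 0 ≤ b ∧ (∀ n, CuntzSub D (posCut (y n) (1 / 2)) b) ∧
      ∀ η > 0, ∃ n, CuntzSub D (posCut b η) (posCut (y n) (1 / 4)) := by
  have hxe : ∀ n, ∃ x ∈ D, star x * x = cfc (ramp (5 / 16) (6 / 16)) (y n) ∧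
      ∀ e, e * posCut (y (n + 1)) (1 / 2) = posCut (y (n + 1)) (1 / 2) → e * x = x := fun n => by
    obtain ⟨x, hx, hxx, hxe⟩ := (h n).exists_star_mul_self_eq_cfc (posCut_mem (hy n) (by norm_num))
      (posCut_nonneg _ _) (posCut_mem (hy (n + 1)) (by norm_num)) (posCut_nonneg _ _)
      (f := ramp (1 / 16) (1 / 8)) (by fun_prop) (ε := 1 / 32) (by norm_num)
      (ramp_nonneg (by norm_num)) (ramp_le_one _ _) (fun t ht => ramp_of_le (by linarith))
    refine ⟨x, hx, ?_, hxe⟩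
    rw [hxx, cfc_posCut (hysa n) (by fun_prop)]
    refine cfc_congr fun t _ => ?_
    simp only [ramp]
    congr 2
    · rcases le_total t (1 / 4) with ht | ht
      · rw [max_eq_right (by linarith : t - 1 / 4 ≤ 0), max_eq_right (by norm_num),
          max_eq_right (by linarith)]
      · rw [max_eq_left (by linarith : 0 ≤ t - 1 / 4)]; congr 1; ring
    · norm_num
  choose x hx hxx hxe using hxe
  set θ : ℕ → M := fun n => cfc (ramp (6 / 16) (7 / 16)) (y n) with hθ
  set m : ℕ → M := fun n => cfc (ramp (7 / 16) (8 / 16)) (y n) with hm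
  have hθD : ∀ n, θ n ∈ D := fun n => cfc_mem_of_map_zero (hy n) (by fun_prop)
    (ramp_zero (by norm_num))
  have hmD : ∀ n, m n ∈ D := fun n => cfc_mem_of_map_zero (hy n) (by fun_prop)
    (ramp_zero (by norm_num))
  have hθ0 : ∀ n, 0 ≤ θ n := fun n => cfc_nonneg fun t _ => ramp_nonneg (by norm_num) t
  have hm0 : ∀ n, 0 ≤ m n := fun n => cfc_nonneg fun t _ => ramp_nonneg (by norm_num) t
  have hms : ∀ n, star (m n) = m n := fun n => star_cfc_real _ _
  have hθm : ∀ n, θ n * m n = m n := fun n => cfc_mul_eq_of_eqOn (by fun_prop) (by fun_prop)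
    fun t _ => by
      rcases le_total t (7 / 16) with ht | ht
      · rw [ramp_of_le ht, mul_zero]
      · rw [ramp_of_ge (by norm_num) ht, one_mul]
  have hmθ : ∀ n, m n * θ n = m n := fun n => by
    have := congrArg star (hθm n)
    rwa [star_mul, hms, (hθ0 n).isSelfAdjoint.star_eq] at this
  have hφm : ∀ n, star (x n) * x n * m n = m n := fun n => by
    rw [hxx]
    exact cfc_mul_eq_of_eqOn (by fun_prop) (by fun_prop) fun t _ => by
      rcases le_total t (7 / 16) with ht | ht
      · rw [ramp_of_le ht, mul_zero]
      · rw [ramp_of_ge (by norm_num) (by linarith), one_mul]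
  have hmx : ∀ n, m (n + 1) * x n = x n := fun n => hxe n _ <|
    cfc_mul_eq_of_eqOn (by fun_prop) (by fun_prop) fun t _ => by
      rcases le_total t (1 / 2) with ht | ht
      · rw [max_eq_right (by linarith), mul_zero]
      · rw [ramp_of_ge (by norm_num) (by linarith), one_mul]
  have hθx : ∀ n, θ (n + 1) * x n = x n := fun n => by rw [← hmx n, ← mul_assoc, hθm]
  have hx1 : ∀ n, ‖x n‖ ≤ 1 := fun n => star_mul_le_one_of (hxx n) (cfc_le_one_of_le (ramp_le_one _ _))
  -- The contraction r = xₙθₙxₙ* is unchanged under conjugation by m_{n+1}, hence r ≤ m_{n+1}² ≤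
  -- θ_{n+1}.
  have hpos : ∀ n, 0 ≤ θ (n + 1) - x n * θ n * star (x n) := fun n => by
    rw [sub_nonneg]
    set r := x n * θ n * star (x n) with hr
    have hr1 : r ≤ 1 := star_right_conj_le_one (hx1 n) (cfc_le_one_of_le (ramp_le_one _ _))
    have e1 : r = m (n + 1) * r * star (m (n + 1)) := by
      have : m (n + 1) * r * star (m (n + 1))
          = (m (n + 1) * x n) * θ n * star (m (n + 1) * x n) := by
        rw [hr, star_mul]; noncomm_ring
      rw [this, hmx]
    rw [e1]
    refine (star_right_conjugate_le_conjugate hr1 _).trans ?_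
    rw [mul_one, hms, hm, hθ]
    simp only
    rw [← cfc_mul _ _ (y (n + 1))]
    refine cfc_mono fun t _ => ?_
    have h0 := ramp_nonneg (l := 7 / 16) (u := 8 / 16) (by norm_num) t
    have h1 := ramp_le_one (7 / 16) (8 / 16) t
    rcases le_total t (7 / 16) with ht | ht
    · rw [ramp_of_le ht, mul_zero]; exact ramp_nonneg (by norm_num) t
    · rw [ramp_of_ge (l := 6 / 16) (by norm_num) ht]; nlinarith
  set T := towerMap s x θ with hT
  have hspec := towerMap_spec hs hx hθD hθ0 hpos
  have hTD : ∀ n, T n ∈ D := fun n => (hspec n).1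
  have hTT : ∀ n, star (T n) * T n = θ n := fun n => (hspec n).2.1
  -- The completing summand of the tower annihilates xₙmₙ, because (θ_{n+1} - xₙθₙxₙ*)xₙmₙ = xₙmₙ -
  -- xₙθₙmₙ = 0. This identity is what makes the dₙ nested.
  have hTm : ∀ n, T n * m n = T (n + 1) * (x n * m n) := fun n => by
    have hz : sqrtPos (θ (n + 1) - x n * θ n * star (x n)) * (x n * m n) = 0 := by
      have h1 : (θ (n + 1) - x n * θ n * star (x n)) * (x n * m n) = 0 := by
        have : (θ (n + 1) - x n * θ n * star (x n)) * (x n * m n)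
            = (θ (n + 1) * x n) * m n - x n * (θ n * (star (x n) * x n * m n)) := by noncomm_ring
        rw [this, hθx, hφm, hθm, sub_self]
      have h2 := congrArg star h1
      rw [star_mul, (hpos n).isSelfAdjoint.star_eq, star_zero] at h2
      have h3 := congrArg star (mul_sqrtPos_eq_zero (hpos n) h2)
      rwa [star_mul, star_sqrtPos, star_star, star_zero] at h3
    have : T (n + 1) * (x n * m n) = T n * (star (x n) * x n * m n)
        + s (n + 1) * (sqrtPos (θ (n + 1) - x n * θ n * star (x n)) * (x n * m n)) := by
      rw [hT, towerMap]; noncomm_ring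
    rw [this, hz, hφm, mul_zero, add_zero]
  have hT1 : ∀ n, ‖T n‖ ≤ 1 := fun n =>
    star_mul_le_one_of (hTT n) (cfc_le_one_of_le (ramp_le_one _ _))
  obtain ⟨b, hb, hb0, hb1, hb2⟩ := exists_cuntz_sup_of_nested (D := D)
    (d := fun n => T n * m n * star (T n))
    (fun n => mul_mem (mul_mem (hTD n) (hmD n)) (star_mem (hTD n)))
    (fun n => star_right_conjugate_nonneg (hm0 n) _)
    (fun n => (CStarAlgebra.norm_le_one_iff_of_nonneg _ (star_right_conjugate_nonneg (hm0 n) _)).2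
      (star_right_conj_le_one (hT1 n) (cfc_le_one_of_le (ramp_le_one _ _))))
    (fun n => by
      have e1 : T (n + 1) * m (n + 1) * star (T (n + 1)) * (T (n + 1) * (x n * m n) * star (T n))
          = T (n + 1) * (m (n + 1) * (star (T (n + 1)) * T (n + 1)) * x n * m n) * star (T n) := by
        noncomm_ring
      conv_lhs => enter [2, 1]; rw [hTm]
      rw [e1, hTT, hmθ, hmx, hTm])
  refine ⟨b, hb, hb0, fun n => ?_, fun η hη => ?_⟩
  · refine CuntzSub.trans (b := m n) ?_ (CuntzSub.trans (b := T n * m n * star (T n)) ?_ (hb1 n))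
    · refine .cfc_of_le (hy n) (by fun_prop) (by fun_prop) (by norm_num) (ramp_zero (by norm_num))
        (fun _ _ => le_max_right _ _) (fun t _ => ramp_nonneg (by norm_num) t)
        (norm_nonneg (y n)) fun t ht => ?_
      rcases le_total t (1 / 2) with ht' | ht'
      · rw [max_eq_right (by linarith)]
        exact mul_nonneg (norm_nonneg _) (ramp_nonneg (by norm_num) t)
      · rw [ramp_of_ge (by norm_num) (by linarith), max_eq_left (by linarith), mul_one]
        have := (le_algebraMap_iff_spectrum_le (R := ℝ)).1 (hysa n).le_algebraMap_norm_self t ht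
        linarith
    · have h1 := CuntzSub.of_conj_mem (b := T n * m n * star (T n)) (star_mem (hTD n))
      have e1 : star (T n) * (T n * m n * star (T n)) * star (star (T n))
          = (star (T n) * T n) * m n * (star (T n) * T n) := by rw [star_star]; noncomm_ring
      rwa [e1, hTT, hθm, hmθ] at h1
  · obtain ⟨n, hn⟩ := hb2 η hη
    refine ⟨n, hn.trans ((CuntzSub.of_conj_mem (hTD n)).trans ?_)⟩
    refine .cfc_of_le (hy n) (by fun_prop) (by fun_prop) (ramp_zero (by norm_num)) (by norm_num)
        (fun t _ => ramp_nonneg (by norm_num) t) (fun _ _ => le_max_right _ _)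
        (r := 16) (by norm_num) fun t ht => ?_
    refine (ramp_le_max_div _ _ _).trans ?_
    have : max (t - 7 / 16) 0 ≤ max (t - 1 / 4) 0 := max_le_max (by linarith) le_rfl
    rw [div_le_iff₀ (by norm_num)]
    linarith

end Suprema

/-! ### Quasitraces and functionals -/

section Quasitrace

variable {M : Type*} [CStarAlgebra M] [PartialOrder M] [StarOrderedRing M]
  {D : NonUnitalStarSubalgebra ℂ M}

/-- A lower semicontinuous quasitrace on the positive cone of `D`. -/
structure IsQuasitraceOn (D : NonUnitalStarSubalgebra ℂ M) (τ : M → ℝ≥0∞) : Prop where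
  map_zero : τ 0 = 0
  trace : ∀ x ∈ D, τ (star x * x) = τ (x * star x)
  map_add : ∀ a ∈ D, ∀ b ∈ D, 0 ≤ a → 0 ≤ b → Commute a b → τ (a + b) = τ a + τ b
  map_smul : ∀ t : ℝ, ∀ a ∈ D, 0 ≤ t → 0 ≤ a → τ (t • a) = ENNReal.ofReal t * τ a
  lsc : ∀ a ∈ D, 0 ≤ a → ∀ c < τ a, ∃ δ > 0, ∀ a' ∈ D, 0 ≤ a' → ‖a' - a‖ < δ → c < τ a'

/-- A functional on the Cuntz semigroup of `D`, as a function on the positive cone of `D`. -/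
structure IsFunctionalOn (D : NonUnitalStarSubalgebra ℂ M) (φ : M → ℝ≥0∞) : Prop where
  map_zero : φ 0 = 0
  mono : ∀ a ∈ D, ∀ b ∈ D, 0 ≤ a → 0 ≤ b → CuntzSub D a b → φ a ≤ φ b
  map_add : ∀ a ∈ D, ∀ b ∈ D, 0 ≤ a → 0 ≤ b → a * b = 0 → φ (a + b) = φ a + φ b
  exists_lt : ∀ a ∈ D, 0 ≤ a → ∀ c < φ a, ∃ ε > 0, c < φ (posCut a ε)

/-- The dimension function of a quasitrace, as a supremum over cut-offs of the element. -/
def dimSup (τ : M → ℝ≥0∞) (a : M) : ℝ≥0∞ :=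
  ⨆ n : ℕ, τ (cfc (ramp (1 / (n + 1)) (2 * (1 / (n + 1)))) a)

theorem ramp_anti {δ ε : ℝ} (hδ : 0 < δ) (h : δ ≤ ε) (t : ℝ) :
    ramp ε (2 * ε) t ≤ ramp δ (2 * δ) t := by
  rcases le_total t ε with ht | ht
  · rw [ramp_of_le ht]; exact ramp_nonneg (by linarith) t
  · unfold ramp
    refine min_le_min_left _ ?_
    rw [max_eq_left (by linarith), max_eq_left (by linarith),
      div_le_div_iff₀ (by linarith) (by linarith)]
    nlinarith

/-- Orthogonal positive elements are the positive and negative parts of their difference, which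
reduces claims about the pair to functions of one self-adjoint element. -/
theorem exists_eq_cfc_max {a b : M} (ha : 0 ≤ a) (hb : 0 ≤ b) (hab : a * b = 0) :
    ∃ c : M, IsSelfAdjoint c ∧ a = cfc (fun t : ℝ => max t 0) c ∧
      b = cfc (fun t : ℝ => max (-t) 0) c := by
  obtain ⟨h1, h2⟩ := CFC.posPart_negPart_unique (a := a - b) rfl hab ha hb
  refine ⟨a - b, ha.isSelfAdjoint.sub hb.isSelfAdjoint, ?_, ?_⟩
  · conv_lhs => rw [← h1, CFC.posPart_def]
    exact cfcₙ_eq_cfc (f := fun t : ℝ => max t 0) (by fun_prop) (by simp)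
  · conv_lhs => rw [← h2, CFC.negPart_def]
    exact cfcₙ_eq_cfc (f := fun t : ℝ => max (-t) 0) (by fun_prop) (by simp)

theorem cfc_add_of_mul_eq_zero {a b : M} (ha : 0 ≤ a) (hb : 0 ≤ b) (hab : a * b = 0)
    {f : ℝ → ℝ} (hf : Continuous f) (hf0 : f 0 = 0) : cfc f (a + b) = cfc f a + cfc f b := by
  obtain ⟨c, hc, rfl, rfl⟩ := exists_eq_cfc_max ha hb hab
  have c1 : Continuous fun t : ℝ => f (max t 0) := by fun_prop
  have c2 : Continuous fun t : ℝ => f (max (-t) 0) := by fun_prop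
  rw [← cfc_comp' f (fun t : ℝ => max t 0) c hf.continuousOn,
    ← cfc_comp' f (fun t : ℝ => max (-t) 0) c hf.continuousOn,
    ← cfc_add c (fun t : ℝ => max t 0) (fun t : ℝ => max (-t) 0),
    ← cfc_comp' f (fun t : ℝ => max t 0 + max (-t) 0) c hf.continuousOn,
    ← cfc_add c _ _ c1.continuousOn c2.continuousOn]
  refine cfc_congr fun t _ => ?_
  rcases le_total t 0 with ht | ht
  · simp [ht, hf0]
  · simp [ht, hf0]

theorem cfc_mul_eq_zero_of_mul_eq_zero {a b : M} (ha : 0 ≤ a) (hb : 0 ≤ b) (hab : a * b = 0)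
    {f g : ℝ → ℝ} (hf : Continuous f) (hf0 : ∀ t ≤ 0, f t = 0)
    (hg : Continuous g) (hg0 : ∀ t ≤ 0, g t = 0) : cfc f a * cfc g b = 0 := by
  obtain ⟨c, hc, rfl, rfl⟩ := exists_eq_cfc_max ha hb hab
  rw [← cfc_comp' f (fun t : ℝ => max t 0) c hf.continuousOn,
    ← cfc_comp' g (fun t : ℝ => max (-t) 0) c hg.continuousOn,
    cfc_mul_eq_of_eqOn (by fun_prop) (by fun_prop) (h := fun _ => 0) fun t _ => ?_,
    cfc_const_zero]
  rcases le_total t 0 with ht | ht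
  · rw [max_eq_right ht, hf0 0 le_rfl, zero_mul]
  · rw [max_eq_right (by linarith : -t ≤ 0), hg0 0 le_rfl, mul_zero]

/-! ### From quasitraces to functionals on Cuntz classes. -/

namespace IsQuasitraceOn

variable [IsClosed (D : Set M)] {τ : M → ℝ≥0∞}

/-- A quasitrace is additive only on commuting elements, so monotonicity is available only when a
commutes with b - a. -/
theorem mono_of_commute (hτ : IsQuasitraceOn D τ) {a b : M} (ha : a ∈ D) (hb : b ∈ D)
    (ha0 : 0 ≤ a) (hab : a ≤ b) (hc : Commute a b) : τ a ≤ τ b := by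
  have h := hτ.map_add a ha (b - a) (sub_mem hb ha) ha0 (sub_nonneg.2 hab)
    (hc.sub_right (Commute.refl a))
  rw [add_sub_cancel] at h
  rw [h]; exact le_self_add

theorem cfc_mono (hτ : IsQuasitraceOn D τ) {a : M} (ha : a ∈ D) {f g : ℝ → ℝ}
    (hf : Continuous f) (hg : Continuous g) (hf0 : f 0 = 0) (hg0 : g 0 = 0)
    (h0 : ∀ t ∈ spectrum ℝ a, 0 ≤ f t) (h : ∀ t ∈ spectrum ℝ a, f t ≤ g t) :
    τ (cfc f a) ≤ τ (cfc g a) :=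
  hτ.mono_of_commute (cfc_mem_of_map_zero ha hf hf0) (cfc_mem_of_map_zero ha hg hg0)
    (cfc_nonneg h0) (_root_.cfc_mono h hf.continuousOn hg.continuousOn) (cfc_commute_cfc f g a)

theorem cfc_ramp_le_dimSup (hτ : IsQuasitraceOn D τ) {a : M} (ha : a ∈ D) {ε : ℝ} (hε : 0 < ε) :
    τ (cfc (ramp ε (2 * ε)) a) ≤ dimSup τ a := by
  obtain ⟨n, hn⟩ := exists_nat_one_div_lt hε
  refine le_trans ?_ (le_iSup _ n)
  exact hτ.cfc_mono ha (by fun_prop) (by fun_prop) (ramp_zero hε.le) (ramp_zero (by positivity))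
    (fun t _ => ramp_nonneg (by linarith) t) fun t _ => ramp_anti (by positivity) hn.le t

theorem isFunctionalOn_dimSup (hτ : IsQuasitraceOn D τ) : IsFunctionalOn D (dimSup τ) where
  map_zero := by
    refine le_antisymm (iSup_le fun n => ?_) bot_le
    rw [cfc_apply_zero, ramp_zero (by positivity), _root_.map_zero, hτ.map_zero]
  -- Some Y has Y*Y = ramp(a) while a ramp e of b is a two-sided unit for YY*. Then YY* ≤ e² ≤ e and
  -- YY* commutes with e, so the trace identity and commuting monotonicity suffice.
  mono a ha b hb ha0 hb0 hab := by
    refine iSup_le fun n => ?_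
    set ε : ℝ := 1 / (n + 1) with hε
    have hε0 : 0 < ε := by positivity
    obtain ⟨δ, hδ, h⟩ := hab.exists_posCut ha hb ha0.isSelfAdjoint hb0 (ε := ε / 4) (by positivity)
    obtain ⟨Y, hY, hYY, hYe⟩ := h.exists_star_mul_self_eq_cfc (posCut_mem ha (by positivity))
      (posCut_nonneg _ _) (posCut_mem hb hδ.le) (posCut_nonneg _ _)
      (f := ramp (ε - ε / 4) (2 * ε - ε / 4)) (by fun_prop) (ε := 3 * ε / 8) (by positivity)
      (ramp_nonneg (by linarith)) (ramp_le_one _ _) (fun t ht => ramp_of_le (by linarith))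
    have e1 : cfc (ramp (ε - ε / 4) (2 * ε - ε / 4)) (posCut a (ε / 4))
        = cfc (ramp ε (2 * ε)) a := by
      rw [cfc_posCut ha0.isSelfAdjoint (by fun_prop)]
      refine cfc_congr fun t _ => ?_
      simp only [ramp]
      congr 2
      · rcases le_total t (ε / 4) with ht | ht
        · rw [max_eq_right (by linarith : t - ε / 4 ≤ 0), max_eq_right (by linarith),
            max_eq_right (by linarith)]
        · rw [max_eq_left (by linarith : 0 ≤ t - ε / 4)]; congr 1; ring
      · ring
    rw [e1] at hYY
    rw [← hYY, hτ.trace Y hY]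
    refine le_trans ?_ (hτ.cfc_ramp_le_dimSup hb (ε := δ / 2) (by positivity))
    set e := cfc (ramp (δ / 2) (2 * (δ / 2))) b with he
    have heD : e ∈ D := cfc_mem_of_map_zero hb (by fun_prop) (ramp_zero (by positivity))
    have hes : star e = e := star_cfc_real _ _
    have heY : e * Y = Y := hYe e <| cfc_mul_eq_of_eqOn (by fun_prop) (by fun_prop) fun t _ => by
      rcases le_total t δ with ht | ht
      · rw [max_eq_right (by linarith), mul_zero]
      · rw [ramp_of_ge (by linarith) (by linarith), one_mul]
    have hYn : ‖Y‖ ≤ 1 := star_mul_le_one_of hYY (cfc_le_one_of_le (ramp_le_one _ _))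
    have h1 : e * (Y * star Y) = Y * star Y := by rw [← mul_assoc, heY]
    have h2 : (Y * star Y) * e = Y * star Y := by
      have := congrArg star h1
      rwa [star_mul, star_mul, star_star, hes] at this
    refine hτ.mono_of_commute (mul_mem hY (star_mem hY)) heD (mul_star_self_nonneg Y) ?_
      (h2.trans h1.symm)
    have h3 : Y * star Y ≤ 1 := by simpa using star_right_conj_le_one hYn (le_refl (1 : M))
    have h4 := star_right_conjugate_le_conjugate h3 e
    rw [h1, hes, h2, mul_one] at h4
    refine h4.trans ?_
    rw [he, ← cfc_mul _ _ b]
    refine _root_.cfc_mono fun t _ => ?_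
    have h0 := ramp_nonneg (l := δ / 2) (u := 2 * (δ / 2)) (by linarith) t
    have h1 := ramp_le_one (δ / 2) (2 * (δ / 2)) t
    nlinarith
  map_add a ha b hb ha0 hb0 hab := by
    have hmono : ∀ x ∈ D, Monotone fun n : ℕ =>
        τ (cfc (ramp (1 / ((n : ℝ) + 1)) (2 * (1 / ((n : ℝ) + 1)))) x) := by
      intro x hx n m hnm
      refine hτ.cfc_mono hx (by fun_prop) (by fun_prop) (ramp_zero (by positivity))
        (ramp_zero (by positivity)) (fun t _ => ramp_nonneg ?_ t)
        fun t _ => ramp_anti (by positivity) (by gcongr) t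
      have : (0 : ℝ) < 1 / ((n : ℝ) + 1) := by positivity
      linarith
    rw [dimSup, dimSup, dimSup, ENNReal.iSup_add_iSup_of_monotone (hmono a ha) (hmono b hb)]
    refine iSup_congr fun n => ?_
    have hε0 : (0 : ℝ) < 1 / ((n : ℝ) + 1) := by positivity
    have hr : Continuous (ramp (1 / ((n : ℝ) + 1)) (2 * (1 / ((n : ℝ) + 1)))) := by fun_prop
    rw [cfc_add_of_mul_eq_zero ha0 hb0 hab hr (ramp_zero hε0.le)]
    have hba : b * a = 0 := by
      have := congrArg star hab
      rwa [star_mul, hb0.isSelfAdjoint.star_eq, ha0.isSelfAdjoint.star_eq, star_zero] at this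
    refine hτ.map_add _ (cfc_mem_of_map_zero ha hr (ramp_zero hε0.le)) _
      (cfc_mem_of_map_zero hb hr (ramp_zero hε0.le))
      (cfc_nonneg fun t _ => ramp_nonneg (by linarith) t)
      (cfc_nonneg fun t _ => ramp_nonneg (by linarith) t) ?_
    have hz : ∀ t ≤ 0, ramp (1 / ((n : ℝ) + 1)) (2 * (1 / ((n : ℝ) + 1))) t = 0 :=
      fun t ht => ramp_of_le (by linarith)
    exact (cfc_mul_eq_zero_of_mul_eq_zero ha0 hb0 hab hr hz hr hz).trans
      (cfc_mul_eq_zero_of_mul_eq_zero hb0 ha0 hba hr hz hr hz).symm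
  exists_lt a ha ha0 c hc := by
    obtain ⟨n, hn⟩ := lt_iSup_iff.1 hc
    set ε : ℝ := 1 / (n + 1) with hε
    have hε0 : 0 < ε := by positivity
    refine ⟨ε / 2, by positivity, hn.trans_le (le_trans ?_
      (hτ.cfc_ramp_le_dimSup (posCut_mem ha (by positivity)) (ε := ε / 2) (by positivity)))⟩
    rw [cfc_posCut ha0.isSelfAdjoint (by fun_prop)]
    refine hτ.cfc_mono ha (by fun_prop) (by fun_prop) (ramp_zero hε0.le)
      (ramp_of_le (by rw [zero_sub, max_eq_right (by linarith)]; positivity))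
      (fun t _ => ramp_nonneg (by linarith) t) fun t _ => ?_
    rcases le_total t ε with ht | ht
    · rw [ramp_of_le ht]; exact ramp_nonneg (by linarith) _
    · rw [max_eq_left (by linarith)]
      unfold ramp
      refine min_le_min_left _ ?_
      rw [max_eq_left (by linarith), max_eq_left (by linarith),
        div_le_div_iff₀ (by linarith) (by linarith)]
      nlinarith

/-- Roots and ramps are compared on the spectrum: ε^{1/n} ramp(t) ≤ t^{1/n}, and t^{1/n} ramp(t) ≤
K^{1/n} ramp(t). The constants tend to 1, and lower semicontinuity lets the truncated root replace
the full one. -/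
theorem limsup_root (hτ : IsQuasitraceOn D τ) {a : M} (ha : a ∈ D) (ha0 : 0 ≤ a) :
    limsup (fun n : ℕ => τ (cfc (fun t : ℝ => t ^ (1 / (n : ℝ))) a)) atTop = dimSup τ a := by
  have hcont : ∀ n : ℕ, Continuous fun t : ℝ => t ^ (1 / (n : ℝ)) := fun n =>
    Real.continuous_rpow_const (by positivity)
  have hz : ∀ n : ℕ, 0 < n → (0 : ℝ) ^ (1 / (n : ℝ)) = 0 := fun n hn =>
    Real.zero_rpow (by positivity)
  have hmem : ∀ n : ℕ, 0 < n → cfc (fun t : ℝ => t ^ (1 / (n : ℝ))) a ∈ D := fun n hn =>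
    cfc_mem_of_map_zero ha (hcont n) (hz n hn)
  have hnn : ∀ n : ℕ, 0 ≤ cfc (fun t : ℝ => t ^ (1 / (n : ℝ))) a := fun n =>
    cfc_nonneg fun t ht => Real.rpow_nonneg (spectrum_real_nonneg ha0 ht) _
  have hroot : ∀ r : ℝ, 0 < r → Tendsto (fun n : ℕ => ENNReal.ofReal (r ^ (1 / (n : ℝ))))
      atTop (𝓝 1) := fun r hr => by
    have h1 : Tendsto (fun n : ℕ => r ^ (1 / (n : ℝ))) atTop (𝓝 (r ^ (0 : ℝ))) :=
      (Real.continuousAt_const_rpow hr.ne').tendsto.comp tendsto_one_div_atTop_nhds_zero_nat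
    rw [Real.rpow_zero] at h1
    simpa using ENNReal.tendsto_ofReal h1
  set K := ‖a‖ + 1 with hK
  have hK0 : 0 < K := by positivity
  have hspec : ∀ t ∈ spectrum ℝ a, t ≤ K := fun t ht => by
    have := (le_algebraMap_iff_spectrum_le (R := ℝ)).1
      ha0.isSelfAdjoint.le_algebraMap_norm_self t ht
    linarith
  apply le_antisymm
  · have hbd : ∀ n : ℕ, 0 < n → τ (cfc (fun t : ℝ => t ^ (1 / (n : ℝ))) a)
        ≤ ENNReal.ofReal (K ^ (1 / (n : ℝ))) * dimSup τ a := fun n hn => by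
      refine le_of_forall_lt fun c hc => ?_
      obtain ⟨δ, hδ, hδ'⟩ := hτ.lsc _ (hmem n hn) (hnn n) c hc
      -- Chosen so that t^{1/n} ≤ δ/2 for t ≤ 2ε; truncating the root there moves it by less than δ.
      set ε := (δ / 2) ^ (n : ℝ) / 2 with hε
      have hε0 : 0 < ε := by positivity
      have hε2 : (2 * ε) ^ (1 / (n : ℝ)) = δ / 2 := by
        rw [hε, mul_div_cancel₀ _ two_ne_zero, one_div, Real.rpow_rpow_inv (by positivity)
          (by positivity)]
      set g : ℝ → ℝ := fun t => t ^ (1 / (n : ℝ)) * ramp ε (2 * ε) t with hg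
      have hgc : Continuous g := (hcont n).mul (continuous_ramp _ _)
      have hg0 : g 0 = 0 := by simp only [hg]; rw [ramp_zero hε0.le, mul_zero]
      have hgnn : ∀ t ∈ spectrum ℝ a, 0 ≤ g t := fun t ht =>
        mul_nonneg (Real.rpow_nonneg (spectrum_real_nonneg ha0 ht) _)
          (ramp_nonneg (by linarith) t)
      have h1 := hδ' (cfc g a) (cfc_mem_of_map_zero ha hgc hg0) (cfc_nonneg hgnn) <| by
        refine (norm_cfc_sub_le hgc (hcont n) (c := δ / 2) (by positivity) fun t ht => ?_).trans_lt
          (by linarith)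
        have ht0 := spectrum_real_nonneg ha0 ht
        have hp := Real.rpow_nonneg ht0 (1 / (n : ℝ))
        have r0 := ramp_nonneg (l := ε) (u := 2 * ε) (by linarith) t
        have r1 := ramp_le_one ε (2 * ε) t
        rcases le_total t (2 * ε) with h | h
        · have h2 : t ^ (1 / (n : ℝ)) ≤ δ / 2 := by
            rw [← hε2]; exact Real.rpow_le_rpow ht0 h (by positivity)
          simp only [hg]
          rw [abs_le]; constructor <;> nlinarith
        · simp only [hg]
          rw [ramp_of_ge (by linarith) h, mul_one, sub_self, abs_zero]; positivity
      refine h1.trans_le ?_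
      have h2 : τ (cfc g a) ≤ τ (cfc (fun t => K ^ (1 / (n : ℝ)) • ramp ε (2 * ε) t) a) := by
        refine hτ.cfc_mono ha hgc (by fun_prop) hg0 (by rw [ramp_zero hε0.le, smul_zero]) hgnn
          fun t ht => ?_
        simp only [hg, smul_eq_mul]
        refine mul_le_mul_of_nonneg_right ?_ (ramp_nonneg (by linarith) t)
        exact Real.rpow_le_rpow (spectrum_real_nonneg ha0 ht) (hspec t ht) (by positivity)
      refine h2.trans ?_
      rw [cfc_smul _ _ a, hτ.map_smul _ _ (cfc_mem_of_map_zero ha (by fun_prop)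
        (ramp_zero hε0.le)) (by positivity) (cfc_nonneg fun t _ => ramp_nonneg (by linarith) t)]
      gcongr
      exact hτ.cfc_ramp_le_dimSup ha hε0
    have h1 : Tendsto (fun n : ℕ => ENNReal.ofReal (K ^ (1 / (n : ℝ))) * dimSup τ a) atTop
        (𝓝 (1 * dimSup τ a)) := ENNReal.Tendsto.mul_const (hroot K hK0) (Or.inl one_ne_zero)
    rw [one_mul] at h1
    rw [← h1.limsup_eq]
    exact limsup_le_limsup ((eventually_gt_atTop 0).mono fun n hn => hbd n hn)
  · refine iSup_le fun k => ?_
    set ε : ℝ := 1 / (k + 1) with hε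
    have hε0 : 0 < ε := by positivity
    have h1 : Tendsto (fun n : ℕ => ENNReal.ofReal (ε ^ (1 / (n : ℝ))) * τ (cfc (ramp ε (2 * ε)) a)) atTop
        (𝓝 (1 * τ (cfc (ramp ε (2 * ε)) a))) := ENNReal.Tendsto.mul_const (hroot ε hε0) (Or.inl one_ne_zero)
    rw [one_mul] at h1
    rw [← h1.limsup_eq]
    refine limsup_le_limsup ((eventually_gt_atTop 0).mono fun n hn => ?_)
    beta_reduce
    rw [← hτ.map_smul _ _ (cfc_mem_of_map_zero ha (by fun_prop)
        (ramp_zero hε0.le)) (by positivity) (cfc_nonneg fun t _ => ramp_nonneg (by linarith) t),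
      ← cfc_smul _ _ a]
    refine hτ.cfc_mono ha (by fun_prop) (hcont n) (by rw [ramp_zero hε0.le, smul_zero]) (hz n hn)
      (fun t _ => mul_nonneg (by positivity) (ramp_nonneg (by linarith) t)) fun t ht => ?_
    have ht0 := spectrum_real_nonneg ha0 ht
    rw [smul_eq_mul]
    rcases le_total t ε with h | h
    · rw [ramp_of_le h, mul_zero]; exact Real.rpow_nonneg ht0 _
    · calc _ ≤ ε ^ (1 / (n : ℝ)) * 1 := by gcongr; exact ramp_le_one _ _ _
        _ ≤ t ^ (1 / (n : ℝ)) := by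
          rw [mul_one]; exact Real.rpow_le_rpow hε0.le h (by positivity)

end IsQuasitraceOn

end Quasitrace

/-! ### Additivity of the layer cake integral of a functional on functions -/

section LayerCake

open MeasureTheory

variable {X : Type*} [MetricSpace X] {o : X} {K : Set X} {κ : (X → ℝ) → ℝ≥0∞}

/-- A continuous nonnegative function vanishing at `o`. -/
structure Admissible (o : X) (F : X → ℝ) : Prop where
  cont : Continuous F
  nonneg : ∀ w, 0 ≤ F w
  map_base : F o = 0

/-- A functional on nonnegative continuous functions that only depends on the support of the
function in the compact set `K`. -/
structure IsSupportFunctional (o : X) (K : Set X) (κ : (X → ℝ) → ℝ≥0∞) : Prop where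
  map_zero : κ (fun _ => 0) = 0
  mono : ∀ F G, Admissible o F → Admissible o G → ∀ C : ℝ, 0 ≤ C →
    (∀ w ∈ K, F w ≤ C * G w) → κ F ≤ κ G
  add_le : ∀ F G, Admissible o F → Admissible o G → κ (fun w => F w + G w) ≤ κ F + κ G
  add : ∀ F G, Admissible o F → Admissible o G → (∀ w, F w * G w = 0) →
    κ (fun w => F w + G w) = κ F + κ G
  exists_lt : ∀ F, Admissible o F → ∀ c < κ F, ∃ ε > 0, c < κ (fun w => max (F w - ε) 0)

theorem Admissible.zero : Admissible o fun _ => (0 : ℝ) := ⟨continuous_const, by simp, rfl⟩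

theorem Admissible.add {F G : X → ℝ} (hF : Admissible o F) (hG : Admissible o G) :
    Admissible o fun w => F w + G w :=
  ⟨hF.cont.add hG.cont, fun w => add_nonneg (hF.nonneg w) (hG.nonneg w),
    by rw [hF.map_base, hG.map_base, add_zero]⟩

theorem Admissible.cut {F : X → ℝ} (hF : Admissible o F) {t : ℝ} (ht : 0 ≤ t) :
    Admissible o fun w => max (F w - t) 0 :=
  ⟨(hF.cont.sub continuous_const).max continuous_const, fun w => le_max_right _ _,
    by rw [hF.map_base]; simpa using ht⟩

theorem Admissible.sum {ι : Type*} (s : Finset ι) {F : ι → X → ℝ} (hF : ∀ i, Admissible o (F i)) :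
    Admissible o fun w => ∑ i ∈ s, F i w :=
  ⟨continuous_finsetSum _ fun i _ => (hF i).cont, fun w => Finset.sum_nonneg fun i _ =>
    (hF i).nonneg w, Finset.sum_eq_zero fun i _ => (hF i).map_base⟩

/-- On the compact set of w ∈ K with F(w) ≥ ε the function `G` has a positive minimum; elsewhere on
`K` the cut-down vanishes. -/
theorem exists_cut_le_mul (hK : IsCompact K) {F G : X → ℝ} (hF : Continuous F) (hG : Continuous G)
    (hG0 : ∀ w, 0 ≤ G w) {ε : ℝ} (h : ∀ w ∈ K, ε ≤ F w → 0 < G w) :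
    ∃ C : ℝ, 0 ≤ C ∧ ∀ w ∈ K, max (F w - ε) 0 ≤ C * G w := by
  set L := K ∩ {w | ε ≤ F w}
  have hL : IsCompact L := hK.inter_right (isClosed_le continuous_const hF)
  rcases L.eq_empty_or_nonempty with hE | hne
  · refine ⟨0, le_rfl, fun w hw => ?_⟩
    rw [zero_mul]
    refine max_le ?_ le_rfl
    by_contra hlt
    have : w ∈ L := ⟨hw, by simp only [Set.mem_ofPred_eq]; linarith⟩
    rw [hE] at this; exact this
  · obtain ⟨w₀, hw₀, hmin⟩ := hL.exists_isMinOn hne hG.continuousOn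
    obtain ⟨w₁, hw₁, hmax⟩ := hL.exists_isMaxOn hne hF.continuousOn
    have hpos := h w₀ hw₀.1 hw₀.2
    have hM : 0 ≤ F w₁ - ε := sub_nonneg.2 hw₁.2
    refine ⟨(F w₁ - ε) / G w₀, by positivity, fun w hw => ?_⟩
    rcases le_total ε (F w) with hle | hle
    · have hwL : w ∈ L := ⟨hw, hle⟩
      have h1 : G w₀ ≤ G w := hmin hwL
      have h2 : F w ≤ F w₁ := hmax hwL
      rw [max_eq_left (by linarith), div_mul_eq_mul_div, le_div_iff₀ hpos]
      nlinarith
    · rw [max_eq_right (by linarith)]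
      exact mul_nonneg (by positivity) (hG0 w)

theorem exists_bump {U : Set X} (hU : IsOpen U) :
    ∃ G : X → ℝ, Continuous G ∧ (∀ w, 0 ≤ G w) ∧ (∀ w ∈ U, 0 < G w) ∧ ∀ w ∉ U, G w = 0 := by
  by_cases h : (Uᶜ).Nonempty
  · refine ⟨fun w => Metric.infDist w Uᶜ, Metric.continuous_infDist_pt _,
      fun w => Metric.infDist_nonneg, fun w hw => ?_, fun w hw => Metric.infDist_zero_of_mem hw⟩
    exact (hU.isClosed_compl.notMem_iff_infDist_pos h).1 (by simpa using hw)
  -- The distance to the empty set is 0 by convention, so the whole space needs a separate bump.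
  · refine ⟨fun _ => 1, continuous_const, fun _ => zero_le_one, fun _ _ => one_pos, fun w hw => ?_⟩
    exact absurd ⟨w, hw⟩ h

/-! ### The Borel measure of a support functional. -/

/-- The value of a support functional on an open set. -/
def openValue (o : X) (κ : (X → ℝ) → ℝ≥0∞) (U : Set X) : ℝ≥0∞ :=
  ⨆ F : X → ℝ, ⨆ _ : Admissible o F ∧ ∀ w ∉ U, F w = 0, κ F

theorem openValue_mono {U V : Set X} (h : U ⊆ V) : openValue o κ U ≤ openValue o κ V :=
  iSup₂_le fun F hF => le_iSup₂_of_le F ⟨hF.1, fun w hw => hF.2 w fun hw' => hw (h hw')⟩ le_rfl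

namespace IsSupportFunctional

theorem openValue_empty (hκ : IsSupportFunctional o K κ) : openValue o κ ∅ = 0 := by
  refine le_antisymm (iSup₂_le fun F hF => ?_) bot_le
  have : F = fun _ => 0 := funext fun w => hF.2 w (Set.notMem_empty w)
  rw [this, hκ.map_zero]

theorem sum_le (hκ : IsSupportFunctional o K κ) {ι : Type*} (s : Finset ι) {F : ι → X → ℝ}
    (hF : ∀ i, Admissible o (F i)) : κ (fun w => ∑ i ∈ s, F i w) ≤ ∑ i ∈ s, κ (F i) := by
  classical
  induction s using Finset.induction_on with
  | empty => simp [hκ.map_zero]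
  | insert i s hi ih =>
    simp only [Finset.sum_insert hi]
    exact (hκ.add_le _ _ (hF i) (Admissible.sum s hF)).trans (by gcongr)

/-- The function (F - t)₊ is the largest competitor up to multiples: any G supported in the
superlevel set becomes dominated on `K` by a multiple of it after a small cut. -/
theorem openValue_superlevel (hκ : IsSupportFunctional o K κ) (hK : IsCompact K) {F : X → ℝ}
    (hF : Admissible o F) {t : ℝ} (ht : 0 ≤ t) :
    openValue o κ {w | t < F w} = κ (fun w => max (F w - t) 0) := by
  apply le_antisymm
  · refine iSup₂_le fun G hG => le_of_forall_lt fun c hc => ?_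
    obtain ⟨ε, hε, hcε⟩ := hκ.exists_lt G hG.1 c hc
    obtain ⟨C, hC, hle⟩ := exists_cut_le_mul hK (F := G) (G := fun w => max (F w - t) 0) (ε := ε)
      hG.1.cont (hF.cut ht).cont (hF.cut ht).nonneg fun w _ hw => by
        by_contra hcon
        have : w ∉ {w | t < F w} := fun hlt => hcon
          (lt_max_of_lt_left (sub_pos.2 hlt))
        rw [hG.2 w this] at hw
        linarith
    exact hcε.trans_le (hκ.mono _ _ (hG.1.cut hε.le) (hF.cut ht) C hC hle)
  · refine le_iSup₂_of_le _ ⟨hF.cut ht, fun w hw => ?_⟩ le_rfl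
    exact max_eq_right (sub_nonpos.2 (not_lt.1 hw))

/-- After a small cut only a compact part of the support matters. It is covered by finitely many `U
n`, where finite subadditivity applies. -/
theorem openValue_iUnion_le (hκ : IsSupportFunctional o K κ) (hK : IsCompact K) {U : ℕ → Set X}
    (hU : ∀ n, IsOpen (U n)) : openValue o κ (⋃ n, U n) ≤ ∑' n, openValue o κ (U n) := by
  refine iSup₂_le fun F hF => le_of_forall_lt fun c hc => ?_
  obtain ⟨ε, hε, hcε⟩ := hκ.exists_lt F hF.1 c hc
  choose G hGc hG0 hGpos hGz using fun n => exists_bump (hU n)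
  have hL : IsCompact (K ∩ {w | ε ≤ F w}) :=
    hK.inter_right (isClosed_le continuous_const hF.1.cont)
  obtain ⟨s, hs⟩ := hL.elim_finite_subcover U hU fun w hw => by
    by_contra hcon
    have := hF.2 w hcon
    have h2 : ε ≤ F w := hw.2
    linarith
  -- Multiplying the bumps by F makes them vanish at the base point.
  have hadm : ∀ n, Admissible o fun w => F w * G n w := fun n =>
    ⟨hF.1.cont.mul (hGc n), fun w => mul_nonneg (hF.1.nonneg w) (hG0 n w),
      by rw [hF.1.map_base, zero_mul]⟩
  have hsum := Admissible.sum s hadm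
  obtain ⟨C, hC, hle⟩ := exists_cut_le_mul hK (F := F) (ε := ε) hF.1.cont hsum.cont hsum.nonneg
    fun w hw hε' => by
      obtain ⟨n, hn, hwn⟩ : ∃ n ∈ s, w ∈ U n := by simpa using hs ⟨hw, hε'⟩
      refine Finset.sum_pos' (fun i _ => (hadm i).nonneg w) ⟨n, hn, ?_⟩
      exact mul_pos (by linarith) (hGpos n w hwn)
  refine hcε.trans_le ((hκ.mono _ _ (hF.1.cut hε.le) hsum C hC hle).trans
    ((hκ.sum_le s hadm).trans (le_trans ?_ (ENNReal.sum_le_tsum s))))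
  refine Finset.sum_le_sum fun n _ => le_iSup₂_of_le _ ⟨hadm n, fun w hw => ?_⟩ le_rfl
  rw [hGz n w hw, mul_zero]

theorem openValue_add_le (hκ : IsSupportFunctional o K κ) {U V W : Set X} (hU : U ⊆ W)
    (hV : V ⊆ W) (hd : Disjoint U V) :
    openValue o κ U + openValue o κ V ≤ openValue o κ W := by
  refine ENNReal.biSup_add_biSup_le' ⟨_, Admissible.zero, fun _ _ => rfl⟩
    ⟨_, Admissible.zero, fun _ _ => rfl⟩ fun F hF G hG => ?_
  rw [← hκ.add F G hF.1 hG.1 fun w => ?_]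
  · refine le_iSup₂_of_le _ ⟨hF.1.add hG.1, fun w hw => ?_⟩ le_rfl
    rw [hF.2 w fun h => hw (hU h), hG.2 w fun h => hw (hV h), add_zero]
  · by_cases hw : w ∈ U
    · rw [hG.2 w (Set.disjoint_left.1 hd hw), mul_zero]
    · rw [hF.2 w hw, zero_mul]

/-- The outer measure induced by `openValue` is additive on sets at positive distance, by thickening
them to disjoint open sets. It is thus a metric outer measure, and Carathéodory makes all Borel sets
measurable. Infinite values are allowed. -/
theorem exists_measure [MeasurableSpace X] [BorelSpace X] (hκ : IsSupportFunctional o K κ)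
    (hK : IsCompact K) : ∃ μ : Measure X, ∀ U, IsOpen U → μ U = openValue o κ U := by
  set μ := inducedOuterMeasure (fun (U : Set X) (_ : IsOpen U) => openValue o κ U) isOpen_empty
    hκ.openValue_empty with hμ
  have msU : ∀ ⦃U : ℕ → Set X⦄ (_ : ∀ i, IsOpen (U i)),
      openValue o κ (⋃ i, U i) ≤ ∑' i, openValue o κ (U i) :=
    fun U hU => hκ.openValue_iUnion_le hK hU
  have hmono : ∀ ⦃U V : Set X⦄ (_ : IsOpen U) (_ : IsOpen V), U ⊆ V →
      openValue o κ U ≤ openValue o κ V := fun U V _ _ h => openValue_mono h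
  have hopen : ∀ U, IsOpen U → μ U = openValue o κ U := fun U hU =>
    inducedOuterMeasure_eq' (fun _ h => isOpen_iUnion h) msU hmono hU
  have hmetric : μ.IsMetric := by
    rintro S T ⟨r, hr, hST⟩
    refine le_antisymm (measure_union_le S T) ?_
    rw [hμ, inducedOuterMeasure_eq_iInf (fun _ h => isOpen_iUnion h) msU hmono (S ∪ T), ← hμ]
    refine le_iInf fun O => le_iInf fun hO => le_iInf fun hsub => ?_
    obtain ⟨δ, hδ, hδr⟩ : ∃ δ : ℝ, 0 < δ ∧ ENNReal.ofReal δ ≤ r := by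
      obtain ⟨q, hq0, hq⟩ := ENNReal.lt_iff_exists_nnreal_btwn.1 (pos_iff_ne_zero.2 hr)
      exact ⟨q, by simpa using hq0, by simpa using hq.le⟩
    have hd : Disjoint (Metric.thickening (δ / 2) S) (Metric.thickening (δ / 2) T) := by
      rw [Set.disjoint_left]
      intro w hwS hwT
      obtain ⟨x, hx, hwx⟩ := Metric.mem_thickening_iff.1 hwS
      obtain ⟨y, hy, hwy⟩ := Metric.mem_thickening_iff.1 hwT
      have h1 : dist x y < δ := by
        linarith [dist_triangle_left x y w]
      have h2 := hδr.trans (hST x hx y hy)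
      rw [edist_dist, ENNReal.ofReal_le_ofReal_iff dist_nonneg] at h2
      linarith
    have oS : IsOpen (O ∩ Metric.thickening (δ / 2) S) := hO.inter Metric.isOpen_thickening
    have oT : IsOpen (O ∩ Metric.thickening (δ / 2) T) := hO.inter Metric.isOpen_thickening
    calc μ S + μ T ≤ μ (O ∩ Metric.thickening (δ / 2) S) + μ (O ∩ Metric.thickening (δ / 2) T) := by
          gcongr
          · exact Set.subset_inter (Set.subset_union_left.trans hsub)
              (Metric.self_subset_thickening (by positivity) S)
          · exact Set.subset_inter (Set.subset_union_right.trans hsub)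
              (Metric.self_subset_thickening (by positivity) T)
      _ ≤ _ := by
          rw [hopen _ oS, hopen _ oT]
          exact hκ.openValue_add_le Set.inter_subset_left Set.inter_subset_left
            (hd.mono Set.inter_subset_right Set.inter_subset_right)
  have hle : ‹MeasurableSpace X› ≤ μ.caratheodory := by
    rw [BorelSpace.measurable_eq (α := X)]
    exact hmetric.borel_le_caratheodory
  exact ⟨μ.toMeasure hle, fun U hU => by rw [toMeasure_apply _ _ hU.measurableSet, hopen U hU]⟩

/-- The layer cake integral of a support functional is additive. -/
theorem lintegral_cut_add (hκ : IsSupportFunctional o K κ) (hK : IsCompact K) {F G : X → ℝ}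
    (hF : Admissible o F) (hG : Admissible o G) :
    ∫⁻ t in Set.Ioi (0 : ℝ), κ (fun w => max (F w + G w - t) 0)
      = (∫⁻ t in Set.Ioi (0 : ℝ), κ (fun w => max (F w - t) 0))
        + ∫⁻ t in Set.Ioi (0 : ℝ), κ (fun w => max (G w - t) 0) := by
  let : MeasurableSpace X := borel X
  have : BorelSpace X := ⟨rfl⟩
  obtain ⟨μ, hμ⟩ := hκ.exists_measure hK
  -- Cavalieri's principle: the layer cake integral is an integral against μ, so it inherits
  -- additivity.
  have key : ∀ P : X → ℝ, Admissible o P → ∫⁻ w, ENNReal.ofReal (P w) ∂μ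
      = ∫⁻ t in Set.Ioi (0 : ℝ), κ (fun w => max (P w - t) 0) := fun P hP => by
    rw [lintegral_eq_lintegral_meas_lt μ (Eventually.of_forall hP.nonneg)
      hP.cont.measurable.aemeasurable]
    refine setLIntegral_congr_fun measurableSet_Ioi fun t ht => ?_
    rw [hμ _ (isOpen_lt continuous_const hP.cont),
      hκ.openValue_superlevel hK hP (le_of_lt ht)]
  rw [← key _ hF, ← key _ hG, ← key _ (hF.add hG), ← lintegral_add_left
    hF.cont.measurable.ennreal_ofReal]
  refine lintegral_congr fun w => ?_
  rw [ENNReal.ofReal_add (hF.nonneg w) (hG.nonneg w)]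

end IsSupportFunctional

end LayerCake

/-! ### The layer cake quasitrace of a functional on Cuntz classes -/

section LayerCakeQuasitrace

open MeasureTheory

variable {M : Type*} [CStarAlgebra M] [PartialOrder M] [StarOrderedRing M]
  {D : NonUnitalStarSubalgebra ℂ M} [IsClosed (D : Set M)] {φ : M → ℝ≥0∞} {s : ℕ → M}

theorem Stabilizes.conj_mul_conj (hs : Stabilizes s D) {i j : ℕ} (hij : i ≠ j) (a b : M) :
    s i * a * star (s i) * (s j * b * star (s j)) = 0 := by
  rw [mul_assoc (s i * a), ← mul_assoc (star (s i)), ← mul_assoc (star (s i)), hs.orth,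
    if_neg hij, zero_mul, zero_mul, mul_zero]

namespace IsFunctionalOn

theorem congr (hφ : IsFunctionalOn D φ) {a b : M} (ha : a ∈ D) (hb : b ∈ D) (ha0 : 0 ≤ a)
    (hb0 : 0 ≤ b) (hab : CuntzSub D a b) (hba : CuntzSub D b a) : φ a = φ b :=
  le_antisymm (hφ.mono a ha b hb ha0 hb0 hab) (hφ.mono b hb a ha hb0 ha0 hba)

theorem map_diag_two (hφ : IsFunctionalOn D φ) (hs : Stabilizes s D) {f : ℕ → M}
    (hf : ∀ i, f i ∈ D) (hf0 : ∀ i, 0 ≤ f i) : φ (diag s 2 f) = φ (f 0) + φ (f 1) := by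
  have h : ∀ i, φ (s i * f i * star (s i)) = φ (f i) := fun i =>
    hφ.congr (hs.conj_mem i (hf i)) (hf i) (star_right_conjugate_nonneg (hf0 i) _) (hf0 i)
      (CuntzSub.conj_isometry hs i (hf i) (hf0 i)).1 (CuntzSub.conj_isometry hs i (hf i) (hf0 i)).2
  rw [diag, Finset.sum_range_succ, Finset.sum_range_one, hφ.map_add _ (hs.conj_mem 0 (hf 0)) _
    (hs.conj_mem 1 (hf 1)) (star_right_conjugate_nonneg (hf0 0) _)
    (star_right_conjugate_nonneg (hf0 1) _) (hs.conj_mul_conj zero_ne_one _ _), h, h]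

/-- Stability enters here: a + b is Cuntz below the orthogonal sum of `a` and `b`, on which φ is
additive. -/
theorem add_le (hφ : IsFunctionalOn D φ) (hs : Stabilizes s D) {a b : M} (ha : a ∈ D) (hb : b ∈ D)
    (ha0 : 0 ≤ a) (hb0 : 0 ≤ b) : φ (a + b) ≤ φ a + φ b := by
  set f : ℕ → M := fun i => if i = 0 then a else b with hf
  have hfD : ∀ i, f i ∈ D := fun i => by simp only [hf]; split_ifs <;> assumption
  have hf0 : ∀ i, 0 ≤ f i := fun i => by simp only [hf]; split_ifs <;> assumption
  have h := CuntzSub.sum hs 2 hfD hf0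
  rw [Finset.sum_range_succ, Finset.sum_range_one] at h
  exact (hφ.mono _ (add_mem ha hb) _ (diag_mem hs hfD) (add_nonneg ha0 hb0) (diag_nonneg s 2 hf0)
    h).trans (hφ.map_diag_two hs hfD hf0).le

theorem posCut_antitoneOn (hφ : IsFunctionalOn D φ) {a : M} (ha : a ∈ D) :
    AntitoneOn (fun t => φ (posCut a t)) (Set.Ici 0) := fun _ ht _ hu htu =>
  hφ.mono _ (posCut_mem ha hu) _ (posCut_mem ha ht) (posCut_nonneg _ _) (posCut_nonneg _ _)
    (CuntzSub.posCut_anti ha ht htu)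

theorem map_real_smul (hφ : IsFunctionalOn D φ) {a : M} (ha : a ∈ D) (ha0 : 0 ≤ a) {r : ℝ}
    (hr : 0 < r) : φ (r • a) = φ a := by
  refine hφ.congr (real_smul_mem ha r) ha (smul_nonneg hr.le ha0) ha0
    (CuntzSub.smul_left ha ha0 hr.le) ?_
  have := CuntzSub.smul_left (real_smul_mem ha r) (smul_nonneg hr.le ha0) (inv_nonneg.2 hr.le)
  rwa [inv_smul_smul₀ hr.ne'] at this

end IsFunctionalOn

theorem posCut_eq_self {a : M} (ha : 0 ≤ a) : posCut a 0 = a := by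
  have := norm_sub_posCut_le ha le_rfl
  exact sub_eq_zero.1 (norm_le_zero_iff.1 this)

theorem posCut_zero_left {t : ℝ} (ht : 0 ≤ t) : posCut (0 : M) t = 0 := by
  rw [posCut, cfc_apply_zero, zero_sub, max_eq_right (neg_nonpos.2 ht), map_zero]

theorem posCut_eq_zero {a : M} {t : ℝ} (h : ∀ x ∈ spectrum ℝ a, x ≤ t) : posCut a t = 0 := by
  rw [posCut, cfc_congr (g := fun _ => 0) fun x hx => max_eq_right (sub_nonpos.2 (h x hx)),
    cfc_const_zero]

theorem posCut_real_smul {a : M} (ha : IsSelfAdjoint a) {r : ℝ} (hr : 0 < r) (t : ℝ) :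
    posCut (r • a) t = r • posCut a (r⁻¹ * t) := by
  have h1 : r • a = cfc (fun x : ℝ => r * x) a := (cfc_const_mul_id r a).symm
  rw [h1, posCut, posCut, ← cfc_comp' (fun x : ℝ => max (x - t) 0) (fun x => r * x) a,
    ← cfc_smul r (fun x : ℝ => max (x - r⁻¹ * t) 0) a (by fun_prop)]
  refine cfc_congr fun x _ => ?_
  simp only [smul_eq_mul, mul_max_of_nonneg _ _ hr.le, mul_zero, mul_sub, mul_inv_cancel_left₀ hr.ne']

/-- The cut-downs of `x* x` and `x x*` are Cuntz equivalent. -/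
theorem CuntzSub.posCut_star_mul_self {x : M} (hx : x ∈ D) {t : ℝ} (ht : 0 < t) :
    CuntzSub D (posCut (star x * x) t) (posCut (x * star x) t) := by
  have haD : star x * x ∈ D := mul_mem (star_mem hx) hx
  have hbD : x * star x ∈ D := mul_mem hx (star_mem hx)
  have hsa : IsSelfAdjoint (star x * x) := IsSelfAdjoint.star_mul_self x
  refine CuntzSub.of_posCut (posCut_nonneg _ _) fun η hη => ?_
  rw [CompletelyClose.posCut_posCut hsa hη.le]
  set k := cfc (ramp t (t + η)) (star x * x) with hk
  have hkD : k ∈ D := cfc_mem_of_map_zero haD (by fun_prop) (ramp_zero ht.le)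
  have hks : star k = k := star_cfc_real _ _
  set f := posCut (x * star x) t with hf
  have hv : (k * star x) * f * star (k * star x) = k * (star x * f * x) * k := by
    rw [star_mul, star_star, hks]; noncomm_ring
  have h1 : CuntzSub D (k * (star x * f * x) * k) f := by
    rw [← hv]; exact CuntzSub.of_conj_mem (mul_mem hkD (star_mem hx))
  refine CuntzSub.trans (CuntzSub.of_le_smul (r := t⁻¹) (posCut_mem haD (by positivity)) ?_
    (posCut_nonneg _ _) ?_ (by positivity) ?_) h1
  · rw [← hv]
    exact mul_mem (mul_mem (mul_mem hkD (star_mem hx)) (posCut_mem hbD ht.le))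
      (star_mem (mul_mem hkD (star_mem hx)))
  · rw [← hv]; exact star_right_conjugate_nonneg (posCut_nonneg _ _) _
  -- With h = x*x, conjugating (xx* - t)₊ ≥ xx* - t by x gives x*(xx* - t)₊x ≥ h² - th, and u² - tu
  -- ≥ t(u - t - η) for u ≥ t. The ramp k removes the part below t, where h² - th is negative.
  · have h2 := star_left_conjugate_le_conjugate (sub_le_posCut
      (IsSelfAdjoint.mul_star_self x) t) x
    have h3 := star_right_conjugate_le_conjugate h2 k
    rw [hks, ← hf] at h3
    have h4 : star x * (x * star x - algebraMap ℝ M t) * x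
        = cfc (fun u : ℝ => u * u - t * u) (star x * x) := by
      rw [cfc_sub .., cfc_mul .., cfc_const_mul .., cfc_id' ℝ (star x * x), mul_sub, sub_mul,
        Algebra.algebraMap_eq_smul_one]
      simp [mul_assoc]
    rw [h4, cfc_conj (by fun_prop) (by fun_prop)] at h3
    have h5 := smul_le_smul_of_nonneg_left h3 (inv_nonneg.2 ht.le)
    refine le_trans ?_ h5
    rw [← cfc_smul (t⁻¹ : ℝ) _ _ (by fun_prop), posCut]
    refine cfc_mono fun u hu => ?_
    simp only [smul_eq_mul]
    have hu0 : 0 ≤ u := spectrum_real_nonneg (star_mul_self_nonneg x) hu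
    rcases le_total u t with hut | hut
    · rw [max_eq_right (by linarith), ramp_of_le hut]; simp
    · have hfac : 0 ≤ u * u - t * u := by nlinarith
      rcases le_total u (t + η) with hu' | hu'
      · rw [max_eq_right (by linarith)]
        have := ramp_nonneg (l := t) (u := t + η) (by linarith) u
        positivity
      · rw [max_eq_left (by linarith), ramp_of_ge (by linarith) hu', one_mul, mul_one,
          inv_mul_eq_div, le_div_iff₀ ht]
        nlinarith

/-- The integral of a functional over the cut-downs of an element. -/
def layerCake (φ : M → ℝ≥0∞) (a : M) : ℝ≥0∞ := ∫⁻ t in Set.Ioi (0 : ℝ), φ (posCut a t)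

namespace IsFunctionalOn

theorem layerCake_zero (hφ : IsFunctionalOn D φ) : layerCake φ 0 = 0 := by
  rw [layerCake, setLIntegral_congr_fun (g := fun _ => 0) measurableSet_Ioi fun t ht => by
    simp only [posCut_zero_left (M := M) (le_of_lt ht), hφ.map_zero]]
  simp

theorem layerCake_trace (hφ : IsFunctionalOn D φ) {x : M} (hx : x ∈ D) :
    layerCake φ (star x * x) = layerCake φ (x * star x) := by
  refine setLIntegral_congr_fun measurableSet_Ioi fun t ht => ?_
  have h1 := CuntzSub.posCut_star_mul_self (star_mem hx) (Set.mem_Ioi.1 ht)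
  rw [star_star] at h1
  have ht' := le_of_lt (Set.mem_Ioi.1 ht)
  exact hφ.congr (posCut_mem (mul_mem (star_mem hx) hx) ht')
    (posCut_mem (mul_mem hx (star_mem hx)) ht') (posCut_nonneg _ _) (posCut_nonneg _ _)
    (CuntzSub.posCut_star_mul_self hx (Set.mem_Ioi.1 ht)) h1

theorem layerCake_smul (hφ : IsFunctionalOn D φ) {a : M} (ha : a ∈ D) (ha0 : 0 ≤ a) {r : ℝ}
    (hr : 0 ≤ r) : layerCake φ (r • a) = ENNReal.ofReal r * layerCake φ a := by
  rcases hr.eq_or_lt with rfl | hr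
  · rw [zero_smul, hφ.layerCake_zero, ENNReal.ofReal_zero, zero_mul]
  have hr' : r⁻¹ ≠ 0 := inv_ne_zero hr.ne'
  have h1 : layerCake φ (r • a)
      = ∫⁻ t, (Set.Ioi (0 : ℝ)).indicator (fun u => φ (posCut a u)) (r⁻¹ * t) := by
    rw [layerCake, ← lintegral_indicator measurableSet_Ioi]
    refine lintegral_congr fun t => ?_
    by_cases ht : 0 < t
    · have ht' : 0 < r⁻¹ * t := by positivity
      rw [Set.indicator_of_mem (Set.mem_Ioi.2 ht), Set.indicator_of_mem (Set.mem_Ioi.2 ht'),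
        posCut_real_smul ha0.isSelfAdjoint hr, hφ.map_real_smul (posCut_mem ha ht'.le)
        (posCut_nonneg _ _) hr]
    · have ht' : ¬ 0 < r⁻¹ * t := fun h => ht ((pos_iff_pos_of_mul_pos h).1 (by positivity))
      rw [Set.indicator_of_notMem (by simpa using ht), Set.indicator_of_notMem (by simpa using ht')]
  have h3 := (Homeomorph.mulLeft₀ r⁻¹ hr').measurableEmbedding.lintegral_map (μ := volume)
    ((Set.Ioi (0 : ℝ)).indicator fun u => φ (posCut a u))
  rw [h1]
  refine h3.symm.trans ?_
  have h2 : Measure.map (Homeomorph.mulLeft₀ r⁻¹ hr') volume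
      = ENNReal.ofReal r • (volume : Measure ℝ) := by
    have := Real.map_volume_mul_left hr'
    rw [inv_inv, abs_of_pos hr] at this
    exact this
  rw [h2, lintegral_smul_measure, lintegral_indicator measurableSet_Ioi, layerCake, smul_eq_mul]

/-- Monotone convergence, with the integrand recovered from slightly larger cuts. Antitone functions
are measurable, so no measurability of φ is assumed. -/
theorem layerCake_eq_iSup (hφ : IsFunctionalOn D φ) {a : M} (ha : a ∈ D) (ha0 : 0 ≤ a) :
    layerCake φ a = ⨆ n : ℕ, ∫⁻ t in Set.Ioi (0 : ℝ), φ (posCut a (t + 1 / ((n : ℝ) + 1))) := by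
  have hanti := hφ.posCut_antitoneOn ha
  rw [← lintegral_iSup']
  · refine setLIntegral_congr_fun measurableSet_Ioi fun t ht => ?_
    have ht' : 0 ≤ t := le_of_lt (Set.mem_Ioi.1 ht)
    refine le_antisymm (le_of_forall_lt fun c hc => ?_) (iSup_le fun n => ?_)
    · obtain ⟨ε, hε, hcε⟩ := hφ.exists_lt _ (posCut_mem ha ht') (posCut_nonneg _ _) c hc
      rw [CompletelyClose.posCut_posCut ha0.isSelfAdjoint hε.le] at hcε
      obtain ⟨n, hn⟩ := exists_nat_one_div_lt hε
      have hn0 : (0 : ℝ) < 1 / ((n : ℝ) + 1) := by positivity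
      refine hcε.trans_le (le_iSup_of_le n (hanti ?_ ?_ (by linarith)))
      · exact Set.mem_Ici.2 (by linarith)
      · exact Set.mem_Ici.2 (by linarith)
    · have hn0 : (0 : ℝ) < 1 / ((n : ℝ) + 1) := by positivity
      exact hanti ht' (Set.mem_Ici.2 (by linarith)) (by linarith)
  · intro n
    have hn0 : (0 : ℝ) < 1 / ((n : ℝ) + 1) := by positivity
    refine aemeasurable_restrict_of_antitoneOn measurableSet_Ioi fun t ht u hu htu => ?_
    have h1 := Set.mem_Ioi.1 ht
    have h2 := Set.mem_Ioi.1 hu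
    exact hanti (Set.mem_Ici.2 (by linarith)) (Set.mem_Ici.2 (by linarith)) (by linarith)
  · filter_upwards [ae_restrict_mem measurableSet_Ioi] with t ht n m hnm
    have h1 := Set.mem_Ioi.1 ht
    have hn0 : (0 : ℝ) < 1 / ((n : ℝ) + 1) := by positivity
    have hm0 : (0 : ℝ) < 1 / ((m : ℝ) + 1) := by positivity
    have hle : 1 / ((m : ℝ) + 1) ≤ 1 / ((n : ℝ) + 1) := by gcongr
    exact hanti (Set.mem_Ici.2 (by linarith)) (Set.mem_Ici.2 (by linarith)) (by linarith)

/-- A shift of the cut level by 1/(n + 1) absorbs any perturbation of norm below 1/(n + 1), by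
comparison of (a - t - 1/(n + 1))₊ with (a' - t)₊. -/
theorem layerCake_lsc (hφ : IsFunctionalOn D φ) {a : M} (ha : a ∈ D) (ha0 : 0 ≤ a) {c : ℝ≥0∞}
    (hc : c < layerCake φ a) :
    ∃ δ > 0, ∀ a' ∈ D, 0 ≤ a' → ‖a' - a‖ < δ → c < layerCake φ a' := by
  rw [hφ.layerCake_eq_iSup ha ha0] at hc
  obtain ⟨n, hn⟩ := lt_iSup_iff.1 hc
  have hn0 : (0 : ℝ) < 1 / ((n : ℝ) + 1) := by positivity
  refine ⟨_, hn0, fun a' ha' ha0' hd => hn.trans_le ?_⟩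
  refine setLIntegral_mono_ae' measurableSet_Ioi (Eventually.of_forall fun t ht => ?_)
  have h1 := le_of_lt (Set.mem_Ioi.1 ht)
  rw [← norm_neg, neg_sub] at hd
  exact hφ.mono _ (posCut_mem ha (by linarith)) _ (posCut_mem ha' h1) (posCut_nonneg _ _)
    (posCut_nonneg _ _) (CuntzSub.posCut_posCut ha ha' ha0.isSelfAdjoint ha0'.isSelfAdjoint h1 hd.le)

/-- The functional is recovered from its layer cake quasitrace. -/
theorem dimSup_layerCake (hφ : IsFunctionalOn D φ) {a : M} (ha : a ∈ D) (ha0 : 0 ≤ a) :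
    dimSup (layerCake φ) a = φ a := by
  -- Values of φ are written as integrals over (0, 1). A ramp of a is at most 1, so its cut-downs
  -- matter only for t < 1, and there they lie between (a - ε)₊ and a in Cuntz order.
  have hconst : ∀ c : ℝ≥0∞, ∫⁻ t in Set.Ioi (0 : ℝ), (Set.Iio (1 : ℝ)).indicator (fun _ => c) t
      = c := fun c => by
    rw [lintegral_indicator measurableSet_Iio, Measure.restrict_restrict measurableSet_Iio,
      lintegral_const, Measure.restrict_apply_univ, Set.Iio_inter_Ioi, Real.volume_Ioo]
    simp
  refine le_antisymm (iSup_le fun n => ?_) (le_of_forall_lt fun c hc => ?_)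
  · have hε0 : (0 : ℝ) < 1 / ((n : ℝ) + 1) := by positivity
    set ε : ℝ := 1 / ((n : ℝ) + 1) with hε
    have heD : cfc (ramp ε (2 * ε)) a ∈ D :=
      cfc_mem_of_map_zero ha (by fun_prop) (ramp_zero hε0.le)
    have he0 : 0 ≤ cfc (ramp ε (2 * ε)) a := cfc_nonneg fun t _ => ramp_nonneg (by linarith) t
    rw [← hconst (φ a)]
    refine setLIntegral_mono_ae' measurableSet_Ioi (Eventually.of_forall fun t ht => ?_)
    have ht0 := Set.mem_Ioi.1 ht
    by_cases h1 : t < 1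
    · rw [Set.indicator_of_mem (Set.mem_Iio.2 h1)]
      refine hφ.mono _ (posCut_mem heD ht0.le) _ ha (posCut_nonneg _ _) ha0 ?_
      refine (CuntzSub.posCut_self heD he0 ht0.le).trans ?_
      nth_rw 2 [← cfc_id' ℝ a]
      refine CuntzSub.cfc_of_le ha (by fun_prop) (by fun_prop) (ramp_zero hε0.le) rfl
        (fun x _ => ramp_nonneg (by linarith) x) (fun x hx => spectrum_real_nonneg ha0 hx)
        (r := ε⁻¹) (by positivity) fun x hx => ?_
      have hx0 := spectrum_real_nonneg ha0 hx
      refine (ramp_le_max_div _ _ _).trans ?_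
      rw [show 2 * ε - ε = ε by ring, inv_mul_eq_div]
      gcongr
      exact max_le (by linarith) hx0
    · rw [Set.indicator_of_notMem (by simpa using h1), posCut_eq_zero, hφ.map_zero]
      intro x hx
      rw [cfc_map_spectrum (ramp ε (2 * ε)) a] at hx
      obtain ⟨y, -, rfl⟩ := hx
      exact (ramp_le_one _ _ _).trans (not_lt.1 h1)
  · obtain ⟨ε, hε, hcε⟩ := hφ.exists_lt a ha ha0 c hc
    obtain ⟨n, hn⟩ := exists_nat_one_div_lt (half_pos hε)
    have hδ0 : (0 : ℝ) < 1 / ((n : ℝ) + 1) := by positivity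
    set δ : ℝ := 1 / ((n : ℝ) + 1) with hδ
    refine hcε.trans_le (le_iSup_of_le n ?_)
    rw [← hδ, ← hconst (φ (posCut a ε))]
    refine setLIntegral_mono_ae' measurableSet_Ioi (Eventually.of_forall fun t ht => ?_)
    have ht0 := Set.mem_Ioi.1 ht
    by_cases h1 : t < 1
    · rw [Set.indicator_of_mem (Set.mem_Iio.2 h1)]
      have heD : cfc (ramp δ (2 * δ)) a ∈ D :=
        cfc_mem_of_map_zero ha (by fun_prop) (ramp_zero hδ0.le)
      refine hφ.mono _ (posCut_mem ha hε.le) _ (posCut_mem heD ht0.le) (posCut_nonneg _ _)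
        (posCut_nonneg _ _) ?_
      rw [posCut, posCut, ← cfc_comp' (fun x : ℝ => max (x - t) 0) (ramp δ (2 * δ)) a]
      refine CuntzSub.cfc_of_le ha (by fun_prop) (by fun_prop) (max_eq_right (by linarith))
        (max_eq_right (by rw [ramp_zero hδ0.le]; linarith)) (fun x _ => le_max_right _ _)
        (fun x _ => le_max_right _ _) (r := ‖a‖ / (1 - t))
        (div_nonneg (norm_nonneg _) (by linarith)) fun x hx => ?_
      have h1t : 0 < 1 - t := by linarith
      rcases le_total x ε with hxe | hxe
      · rw [max_eq_right (by linarith)]; positivity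
      · rw [ramp_of_ge (by linarith) (by linarith), max_eq_left (by linarith),
          max_eq_left (by linarith), div_mul_cancel₀ _ h1t.ne']
        have := spectrum.norm_le_norm_mul_of_mem hx
        have h2 : ‖x‖ ≤ ‖a‖ * 1 := this.trans (by gcongr; exact norm_one_le_one)
        rw [Real.norm_eq_abs] at h2
        linarith [le_abs_self x]
    · rw [Set.indicator_of_notMem (by simpa using h1)]
      exact bot_le

end IsFunctionalOn

end LayerCakeQuasitrace

/-! ### Additivity of the layer cake integral on commuting elements -/

section CommutingSum

open MeasureTheory

variable {M : Type*} [CStarAlgebra M] [PartialOrder M] [StarOrderedRing M]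
  {D : NonUnitalStarSubalgebra ℂ M} {φ : M → ℝ≥0∞} {s : ℕ → M}

/-- The functional calculus of a normal element at a real valued function on the plane. -/
def normalCalc (z : M) (F : ℂ → ℝ) : M := cfc (fun w : ℂ => (F w : ℂ)) z

variable {z : M} [IsStarNormal z]

theorem normalCalc_mem [IsClosed (D : Set M)] (hz : z ∈ D) {F : ℂ → ℝ} (hF : Continuous F)
    (h0 : F 0 = 0) : normalCalc z F ∈ D := by
  rw [normalCalc, ← cfcₙ_eq_cfc (by fun_prop) (by simp [h0])]
  exact cfcₙ_mem (𝕜' := ℂ) _ hz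

theorem normalCalc_congr {F G : ℂ → ℝ} (h : ∀ w ∈ spectrum ℂ z, F w = G w) :
    normalCalc z F = normalCalc z G :=
  cfc_congr fun w hw => by simp only [h w hw]

theorem normalCalc_zero : normalCalc z (fun _ => 0) = 0 := by
  simp [normalCalc, cfc_const_zero]

theorem normalCalc_add {F G : ℂ → ℝ} (hF : Continuous F) (hG : Continuous G) :
    normalCalc z (fun w => F w + G w) = normalCalc z F + normalCalc z G := by
  rw [normalCalc, normalCalc, normalCalc, ← cfc_add (a := z) (fun w : ℂ => (F w : ℂ)) fun w => (G w : ℂ)]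
  simp

theorem normalCalc_mul {F G : ℂ → ℝ} (hF : Continuous F) (hG : Continuous G) :
    normalCalc z (fun w => F w * G w) = normalCalc z F * normalCalc z G := by
  rw [normalCalc, normalCalc, normalCalc, ← cfc_mul (fun w : ℂ => (F w : ℂ)) (fun w => (G w : ℂ)) z]
  simp

theorem isSelfAdjoint_normalCalc (F : ℂ → ℝ) : IsSelfAdjoint (normalCalc z F) := by
  rw [IsSelfAdjoint, normalCalc, ← cfc_star]
  simp

theorem normalCalc_nonneg {F : ℂ → ℝ} (hF : Continuous F) (h0 : ∀ w ∈ spectrum ℂ z, 0 ≤ F w) :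
    0 ≤ normalCalc z F := by
  have h : normalCalc z F = star (normalCalc z fun w => √(F w)) * normalCalc z fun w => √(F w) := by
    rw [(isSelfAdjoint_normalCalc _).star_eq, ← normalCalc_mul (by fun_prop) (by fun_prop)]
    exact normalCalc_congr fun w hw => (Real.mul_self_sqrt (h0 w hw)).symm
  rw [h]
  exact star_mul_self_nonneg _

theorem cfc_normalCalc {F : ℂ → ℝ} (hF : Continuous F) {f : ℝ → ℝ} (hf : Continuous f) :
    cfc f (normalCalc z F) = normalCalc z fun w => f (F w) := by
  rw [cfc_real_eq_complex f (isSelfAdjoint_normalCalc F), normalCalc, normalCalc,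
    ← cfc_comp' (fun w : ℂ => (f w.re : ℂ)) (fun w : ℂ => (F w : ℂ)) z
      (Continuous.continuousOn (by fun_prop)) (Continuous.continuousOn (by fun_prop))]
  simp

theorem posCut_normalCalc {F : ℂ → ℝ} (hF : Continuous F) (t : ℝ) :
    posCut (normalCalc z F) t = normalCalc z fun w => max (F w - t) 0 :=
  cfc_normalCalc hF (by fun_prop)

/-- Within the functional calculus of one normal element, a pointwise bound F ≤ C G on the spectrum
is an operator inequality, so φ sees only supports. -/
theorem IsFunctionalOn.isSupportFunctional [IsClosed (D : Set M)] (hφ : IsFunctionalOn D φ)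
    (hs : Stabilizes s D) (hz : z ∈ D) :
    IsSupportFunctional 0 (spectrum ℂ z) fun F => φ (normalCalc z F) where
  map_zero := by rw [normalCalc_zero, hφ.map_zero]
  mono F G hF hG C hC h := by
    have hFD := normalCalc_mem hz hF.cont hF.map_base
    have hGD := normalCalc_mem hz hG.cont hG.map_base
    have hF0 := normalCalc_nonneg (z := z) hF.cont fun w _ => hF.nonneg w
    have hG0 := normalCalc_nonneg (z := z) hG.cont fun w _ => hG.nonneg w
    refine hφ.mono _ hFD _ hGD hF0 hG0 (CuntzSub.of_le_smul hFD hGD hF0 hG0 hC ?_)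
    have h1 : C • normalCalc z G = normalCalc z F + normalCalc z fun w => C * G w - F w := by
      rw [← normalCalc_add hF.cont (by have := hG.cont; have := hF.cont; fun_prop)]
      simp only [add_sub_cancel]
      rw [normalCalc, normalCalc, ← cfc_smul C _ z (by have := hG.cont; fun_prop)]
      simp
    rw [h1]
    exact le_add_of_nonneg_right (normalCalc_nonneg
      (by have := hG.cont; have := hF.cont; fun_prop) fun w hw => sub_nonneg.2 (h w hw))
  add_le F G hF hG := by
    rw [normalCalc_add hF.cont hG.cont]
    exact hφ.add_le hs (normalCalc_mem hz hF.cont hF.map_base)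
      (normalCalc_mem hz hG.cont hG.map_base) (normalCalc_nonneg hF.cont fun w _ => hF.nonneg w)
      (normalCalc_nonneg hG.cont fun w _ => hG.nonneg w)
  add F G hF hG h := by
    rw [normalCalc_add hF.cont hG.cont]
    refine hφ.map_add _ (normalCalc_mem hz hF.cont hF.map_base) _
      (normalCalc_mem hz hG.cont hG.map_base) (normalCalc_nonneg hF.cont fun w _ => hF.nonneg w)
      (normalCalc_nonneg hG.cont fun w _ => hG.nonneg w) ?_
    rw [← normalCalc_mul hF.cont hG.cont]
    simp only [h, normalCalc_zero]
  exists_lt F hF c hc := by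
    obtain ⟨ε, hε, h⟩ := hφ.exists_lt _ (normalCalc_mem hz hF.cont hF.map_base)
      (normalCalc_nonneg hF.cont fun w _ => hF.nonneg w) c hc
    rw [posCut_normalCalc hF.cont] at h
    exact ⟨ε, hε, h⟩

/-- Take z = a + ib, which is normal because `a` and `b` commute; `a` and `b` are its real and
imaginary parts. -/
theorem exists_normal_of_commute [IsClosed (D : Set M)] {a b : M} (ha : a ∈ D) (hb : b ∈ D)
    (ha0 : 0 ≤ a) (hb0 : 0 ≤ b) (hab : Commute a b) : ∃ z ∈ D, IsStarNormal z ∧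
      a = normalCalc z (fun w => max w.re 0) ∧ b = normalCalc z fun w => max w.im 0 := by
  have hsa := ha0.isSelfAdjoint
  have hsb := hb0.isSelfAdjoint
  set z := a + Complex.I • b with hz
  have hzs : star z = a - Complex.I • b := by
    rw [hz, star_add, star_smul, hsa.star_eq, hsb.star_eq]
    simp [sub_eq_add_neg]
  have hn : IsStarNormal z := by
    refine ⟨?_⟩
    rw [hzs, hz]
    have h1 : Commute a (Complex.I • b) := hab.smul_right _
    exact ((Commute.refl a).add_right h1).sub_left (h1.symm.add_right (Commute.refl _))
  have hre : a = normalCalc z fun w => w.re := by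
    rw [normalCalc, cfc_re_id z, realPart_apply_coe, hzs, hz, add_add_sub_cancel, ← two_smul ℝ a,
      smul_smul]
    norm_num
  have him : b = normalCalc z fun w => w.im := by
    rw [normalCalc, cfc_im_id z, imaginaryPart_apply_coe, hzs, hz, add_sub_sub_cancel,
      ← two_smul ℝ (Complex.I • b), smul_smul (2⁻¹ : ℝ)]
    norm_num [smul_smul]
  refine ⟨z, add_mem ha (SMulMemClass.smul_mem _ hb), hn, ?_, ?_⟩
  · conv_lhs => rw [← posCut_eq_self ha0, hre, posCut_normalCalc (by fun_prop)]
    simp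
  · conv_lhs => rw [← posCut_eq_self hb0, him, posCut_normalCalc (by fun_prop)]
    simp

namespace IsFunctionalOn

variable [IsClosed (D : Set M)]

theorem layerCake_add (hφ : IsFunctionalOn D φ) (hs : Stabilizes s D) {a b : M} (ha : a ∈ D)
    (hb : b ∈ D) (ha0 : 0 ≤ a) (hb0 : 0 ≤ b) (hab : Commute a b) :
    layerCake φ (a + b) = layerCake φ a + layerCake φ b := by
  obtain ⟨z, hz, hn, haz, hbz⟩ := exists_normal_of_commute ha hb ha0 hb0 hab
  have hF : Admissible (0 : ℂ) fun w => max w.re 0 :=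
    ⟨by fun_prop, fun w => le_max_right _ _, by simp⟩
  have hG : Admissible (0 : ℂ) fun w => max w.im 0 :=
    ⟨by fun_prop, fun w => le_max_right _ _, by simp⟩
  have key := (hφ.isSupportFunctional hs hz).lintegral_cut_add (spectrum.isCompact z) hF hG
  have h : ∀ F : ℂ → ℝ, Admissible 0 F → layerCake φ (normalCalc z F)
      = ∫⁻ t in Set.Ioi (0 : ℝ), φ (normalCalc z fun w => max (F w - t) 0) := fun F hF => by
    simp only [layerCake, posCut_normalCalc hF.cont]
  rw [haz, hbz, ← normalCalc_add hF.cont hG.cont, h _ hF, h _ hG, h _ (hF.add hG)]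
  exact key

/-- The layer cake integral of a functional is a lower semicontinuous quasitrace. -/
theorem isQuasitraceOn_layerCake (hφ : IsFunctionalOn D φ) (hs : Stabilizes s D) :
    IsQuasitraceOn D (layerCake φ) where
  map_zero := hφ.layerCake_zero
  trace _ hx := hφ.layerCake_trace hx
  map_add _ ha _ hb ha0 hb0 hab := hφ.layerCake_add hs ha hb ha0 hb0 hab
  map_smul _ _ ha ht ha0 := hφ.layerCake_smul ha ha0 ht
  lsc _ ha ha0 _ hc := hφ.layerCake_lsc ha ha0 hc

end IsFunctionalOn

end CommutingSum

/-! ### Transfer of functionals between close algebras -/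

section Transfer

variable {M : Type*} [CStarAlgebra M] [PartialOrder M] [StarOrderedRing M]
  {D E : NonUnitalStarSubalgebra ℂ M} {φ : M → ℝ≥0∞} {s : ℕ → M} {α : ℝ}

theorem eq_zero_of_cuntzSub_zero {c : M} (h : CuntzSub D c 0) : c = 0 := by
  by_contra hc
  obtain ⟨v, -, hv⟩ := h ‖c‖ (norm_pos_iff.2 hc)
  simp at hv

/-- The sequence `p, q, q, …`. -/
def pairSeq (p q : M) : ℕ → M := fun i => if i = 0 then p else q

theorem forall_pairSeq {P : M → Prop} {p q : M} (hp : P p) (hq : P q) (i : ℕ) :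
    P (pairSeq p q i) := by
  unfold pairSeq; split_ifs <;> assumption

theorem forall_pairSeq₂ {P : M → M → Prop} {p q p' q' : M} (hp : P p p') (hq : P q q') (i : ℕ) :
    P (pairSeq p q i) (pairSeq p' q' i) := by
  unfold pairSeq; split_ifs <;> assumption

theorem diag_pairSeq (p q : M) :
    diag s 2 (pairSeq p q) = s 0 * p * star (s 0) + s 1 * q * star (s 1) := by
  rw [diag, Finset.sum_range_succ, Finset.sum_range_one]; rfl

/-- For v = s₀√p + s₁√q one has v*v = p + q, while vv* is the orthogonal sum because √p√q = 0. -/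
theorem CuntzSub.diag_pairSeq_of_mul_eq_zero [IsClosed (E : Set M)] (hs : Stabilizes s E) {p q : M}
    (hp : p ∈ E) (hq : q ∈ E) (hp0 : 0 ≤ p) (hq0 : 0 ≤ q) (hpq : p * q = 0) :
    CuntzSub E (CompletelyClose.diag s 2 (pairSeq p q)) (p + q) := by
  have h1 : p * sqrtPos q = 0 := mul_sqrtPos_eq_zero hq0 hpq
  have h2 : sqrtPos q * p = 0 := by
    have := congrArg star h1
    rwa [star_mul, star_sqrtPos, hp0.isSelfAdjoint.star_eq, star_zero] at this
  have h3 : sqrtPos q * sqrtPos p = 0 := mul_sqrtPos_eq_zero hp0 h2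
  have h4 : sqrtPos p * sqrtPos q = 0 := by
    have := congrArg star h3
    rwa [star_mul, star_sqrtPos, star_sqrtPos, star_zero] at this
  set v := s 0 * sqrtPos p + s 1 * sqrtPos q with hv
  have hvE : v ∈ E := add_mem (hs.mul_mem 0 _ (sqrtPos_mem hp)) (hs.mul_mem 1 _ (sqrtPos_mem hq))
  have hvs : star v = sqrtPos p * star (s 0) + sqrtPos q * star (s 1) := by
    rw [hv, star_add, star_mul, star_mul, star_sqrtPos, star_sqrtPos]
  have e1 : v * star v = CompletelyClose.diag s 2 (pairSeq p q) := by
    rw [hvs, hv, diag_pairSeq, mul_add, add_mul, add_mul]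
    have a1 : s 0 * sqrtPos p * (sqrtPos p * star (s 0)) = s 0 * p * star (s 0) := by
      rw [mul_assoc, ← mul_assoc (sqrtPos p), sqrtPos_mul_self hp0, mul_assoc]
    have a2 : s 1 * sqrtPos q * (sqrtPos q * star (s 1)) = s 1 * q * star (s 1) := by
      rw [mul_assoc, ← mul_assoc (sqrtPos q), sqrtPos_mul_self hq0, mul_assoc]
    have a3 : s 1 * sqrtPos q * (sqrtPos p * star (s 0)) = 0 := by
      rw [mul_assoc, ← mul_assoc (sqrtPos q), h3, zero_mul, mul_zero]
    have a4 : s 0 * sqrtPos p * (sqrtPos q * star (s 1)) = 0 := by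
      rw [mul_assoc, ← mul_assoc (sqrtPos p), h4, zero_mul, mul_zero]
    rw [a1, a2, a3, a4, add_zero, zero_add]
  have e2 : star v * v = p + q := by
    rw [hvs, hv, mul_add, add_mul, add_mul]
    have b : ∀ i j, ∀ x y : M, x * star (s i) * (s j * y) = x * (star (s i) * s j) * y := by
      intros; noncomm_ring
    rw [b, b, b, b, hs.orth, hs.orth, hs.orth, hs.orth]
    simp [sqrtPos_mul_self hp0, sqrtPos_mul_self hq0]
  have := CuntzSub.star_mul_self (star_mem hvE)
  rwa [star_star, e1, e2] at this

/-- A positive contraction of the algebra generated by `b` acting as a unit on the cut-down of `b`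
at level `u`. -/
def cutUnit (b : M) (l u : ℝ) : M := cfc (ramp l u) b

theorem cutUnit_mem [IsClosed (E : Set M)] {b : M} (hb : b ∈ E) {l u : ℝ} (hl : 0 ≤ l) :
    cutUnit b l u ∈ E := cfc_mem_of_map_zero hb (by fun_prop) (ramp_zero hl)

theorem cutUnit_nonneg (b : M) {l u : ℝ} (hlu : l < u) : 0 ≤ cutUnit b l u :=
  cfc_nonneg fun t _ => ramp_nonneg hlu t

theorem norm_cutUnit_le (b : M) {l u : ℝ} (hlu : l < u) : ‖cutUnit b l u‖ ≤ 1 :=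
  norm_cfc_le zero_le_one fun t _ => by
    rw [Real.norm_eq_abs, abs_of_nonneg (ramp_nonneg hlu t)]; exact ramp_le_one _ _ _

theorem cutUnit_mul_posCut (b : M) {l u : ℝ} (hlu : l < u) :
    cutUnit b l u * posCut b u = posCut b u :=
  cfc_mul_eq_of_eqOn (by fun_prop) (by fun_prop) fun t _ => by
    rcases le_total t u with ht | ht
    · rw [max_eq_right (by linarith), mul_zero]
    · rw [ramp_of_ge hlu ht, one_mul]

theorem CuntzSub.cutUnit [IsClosed (E : Set M)] {b : M} (hb : b ∈ E) {l u : ℝ} (hl : 0 ≤ l)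
    (hlu : l < u) : CuntzSub E (cutUnit b l u) (posCut b l) :=
  CuntzSub.cfc_of_le hb (by fun_prop) (by fun_prop) (ramp_zero hl)
    (max_eq_right (by linarith)) (fun t _ => ramp_nonneg hlu t) (fun t _ => le_max_right _ _)
    (r := (u - l)⁻¹) (by have : 0 < u - l := by linarith
                         positivity) fun t _ => by
      rw [inv_mul_eq_div]; exact ramp_le_max_div _ _ _

/-- An element `x` of `D` close to a positive contraction `c` of `E` that is Cuntz below a
cut-down of `b`. -/
structure IsNearWitness (α : ℝ) (D E : NonUnitalStarSubalgebra ℂ M) (b c x : M) : Prop where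
  mem : c ∈ E
  nonneg : 0 ≤ c
  norm_le : ‖c‖ ≤ 1
  mem' : x ∈ D
  isSelfAdjoint : IsSelfAdjoint x
  near : ‖x - c‖ ≤ α
  cuntzSub : ∃ δ > 0, CuntzSub E c (posCut b δ)

/-- The functional on `E` obtained from a functional on the close algebra `D`. -/
def transfer (α : ℝ) (D E : NonUnitalStarSubalgebra ℂ M) (φ : M → ℝ≥0∞) (b : M) : ℝ≥0∞ :=
  ⨆ p : M × M, ⨆ _ : IsNearWitness α D E b p.1 p.2, φ (posCut p.2 (1 / 4))

theorem IsNearWitness.le_transfer {b c x : M} (h : IsNearWitness α D E b c x) :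
    φ (posCut x (1 / 4)) ≤ transfer α D E φ b :=
  le_iSup₂_of_le (c, x) h le_rfl

theorem transfer_le {b : M} {r : ℝ≥0∞}
    (h : ∀ c x, IsNearWitness α D E b c x → φ (posCut x (1 / 4)) ≤ r) :
    transfer α D E φ b ≤ r := iSup₂_le fun p hp => h p.1 p.2 hp

theorem IsNearWitness.mono {a b c x : M} (h : IsNearWitness α D E a c x)
    (hab : ∀ δ > 0, ∃ δ' > 0, CuntzSub E (posCut a δ) (posCut b δ')) :
    IsNearWitness α D E b c x := by
  obtain ⟨δ, hδ, hc⟩ := h.cuntzSub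
  obtain ⟨δ', hδ', h'⟩ := hab δ hδ
  exact { h with cuntzSub := ⟨δ', hδ', hc.trans h'⟩ }

theorem isNearWitness_zero (hα : 0 ≤ α) (b : M) : IsNearWitness α D E b 0 0 where
  mem := zero_mem E
  nonneg := le_rfl
  norm_le := by simp
  mem' := zero_mem D
  isSelfAdjoint := .zero M
  near := by simpa using hα
  cuntzSub := ⟨1, one_pos, by simpa using CuntzSub.of_conj_mem (b := posCut b 1) (zero_mem E)⟩

theorem posCut_add_of_mul_eq_zero {a b : M} (ha : 0 ≤ a) (hb : 0 ≤ b) (hab : a * b = 0) {t : ℝ}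
    (ht : 0 ≤ t) : posCut (a + b) t = posCut a t + posCut b t :=
  cfc_add_of_mul_eq_zero ha hb hab (by fun_prop) (max_eq_right (by linarith))

theorem posCut_mul_of_mul_eq_zero {a b : M} (ha : 0 ≤ a) (hb : 0 ≤ b) (hab : a * b = 0) {t : ℝ}
    (ht : 0 ≤ t) : posCut a t * posCut b t = 0 :=
  cfc_mul_eq_zero_of_mul_eq_zero ha hb hab (by fun_prop) (fun u hu => max_eq_right (by linarith))
    (by fun_prop) fun u hu => max_eq_right (by linarith)

theorem Stabilizes.norm_diag_sub_le (hs : Stabilizes s D) (n : ℕ) {f g : ℕ → M} (hα : 0 ≤ α)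
    (hf : ∀ i, IsSelfAdjoint (f i)) (hg : ∀ i, IsSelfAdjoint (g i)) (h : ∀ i, ‖f i - g i‖ ≤ α) :
    ‖diag s n f - diag s n g‖ ≤ α := by
  rw [← diag_sub]
  exact hs.norm_diag_le n hα (fun i => (hf i).sub (hg i)) h

variable [IsClosed (D : Set M)] [IsClosed (E : Set M)]

/-- Elements of `D` close to a witness are Cuntz below elements of `D` close to a local unit. -/
theorem UnitBallNear.cuntzSub_diag (hED : UnitBallNear α E D) (hα : α < 1 / 42)
    (hα0 : 0 ≤ α) (hsD : Stabilizes s D) (hsE : Stabilizes s E) {c x : M} (hc1 : ‖c‖ ≤ 1)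
    (hx : x ∈ D) (hxs : IsSelfAdjoint x) (hxc : ‖x - c‖ ≤ α) (n : ℕ) {f e y : ℕ → M}
    (he0 : ∀ i, 0 ≤ e i) (he1 : ∀ i, ‖e i‖ ≤ 1) (hf : ∀ i, f i ∈ E) (hf0 : ∀ i, 0 ≤ f i)
    (hef : ∀ i, e i * f i = f i) (hy : ∀ i, y i ∈ D) (hys : ∀ i, IsSelfAdjoint (y i))
    (hye : ∀ i, ‖y i - e i‖ ≤ α) (hcf : CuntzSub E c (diag s n f)) :
    CuntzSub D (posCut x (1 / 4)) (diag s n fun i => posCut (y i) (1 / 2)) := by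
  rw [← hsD.posCut_diag n hys (by norm_num)]
  refine hED.cuntzSub_of_unit hα (e := diag s n e) hc1
    (hsE.norm_diag_le n zero_le_one (fun i => (he0 i).isSelfAdjoint) he1)
    (diag_mem hsE hf) (diag_nonneg s n hf0) ?_ hcf hx hxs (diag_mem hsD hy) ?_ hxc
    (hsD.norm_diag_sub_le n hα0 hys (fun i => (he0 i).isSelfAdjoint) hye)
  · rw [hsE.diag_mul]; simp only [hef]
  · rw [IsSelfAdjoint, star_diag]; simp only [(hys _).star_eq]

/-- The room between the cut levels 1/4 and 1/2 makes the supremum additive, although witnesses in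
`D` are only approximate images of elements of `E`. -/
theorem IsFunctionalOn.transfer (hφ : IsFunctionalOn D φ) (hED : UnitBallNear α E D)
    (hα : α < 1 / 42) (hα0 : 0 ≤ α) (hsD : Stabilizes s D) (hsE : Stabilizes s E) :
    IsFunctionalOn E (transfer α D E φ) where
  -- Here c = 0, so ‖x‖ ≤ α < 1/4 and the cut-down of x vanishes.
  map_zero := by
    refine le_antisymm (transfer_le fun c x h => ?_) bot_le
    obtain ⟨δ, hδ, hc⟩ := h.cuntzSub
    rw [posCut_zero_left hδ.le] at hc
    have hx := h.near
    rw [eq_zero_of_cuntzSub_zero hc, sub_zero] at hx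
    have hz : posCut x (1 / 4) = 0 := posCut_eq_zero fun t ht => by
      have h1 := (spectrum.norm_le_norm_mul_of_mem ht).trans
        (mul_le_of_le_one_right (norm_nonneg _) norm_one_le_one)
      rw [Real.norm_eq_abs] at h1
      linarith [le_abs_self t]
    exact (congrArg φ hz).trans_le hφ.map_zero.le
  mono a ha b hb ha0 hb0 hab := transfer_le fun c x h => (h.mono fun δ hδ =>
    CuntzSub.exists_posCut ha hb ha0.isSelfAdjoint hb0 hab hδ).le_transfer
  map_add a ha b hb ha0 hb0 hab := by
    -- For ≤, the local units of a and b at level δ have neighbours y and z in D, and (x - 1/4)₊ ≾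
    -- (y - 1/2)₊ ⊕ (z - 1/2)₊. For ≥, the orthogonal sum of two witnesses is a witness for a + b.
    refine le_antisymm (transfer_le fun c x h => ?_) ?_
    · obtain ⟨δ, hδ, hc⟩ := h.cuntzSub
      rw [posCut_add_of_mul_eq_zero ha0 hb0 hab hδ.le] at hc
      have hfE : ∀ i, pairSeq (posCut a δ) (posCut b δ) i ∈ E :=
        forall_pairSeq (posCut_mem ha hδ.le) (posCut_mem hb hδ.le)
      have hf0 : ∀ i, 0 ≤ pairSeq (posCut a δ) (posCut b δ) i :=
        forall_pairSeq (posCut_nonneg _ _) (posCut_nonneg _ _)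
      have hsum := CuntzSub.sum hsE 2 hfE hf0
      rw [Finset.sum_range_succ, Finset.sum_range_one] at hsum
      have hlt : δ / 2 < δ := by linarith
      have hw : ∀ p ∈ E, ∃ y, IsNearWitness α D E p (cutUnit p (δ / 2) δ) y := fun p hp => by
        have he := cutUnit_mem hp (u := δ) (half_pos hδ).le
        obtain ⟨y, hy, hys, hyn⟩ := hED.exists_isSelfAdjoint he
          (cutUnit_nonneg p hlt).isSelfAdjoint (norm_cutUnit_le p hlt)
        exact ⟨y, he, cutUnit_nonneg p hlt, norm_cutUnit_le p hlt, hy, hys, hyn, δ / 2,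
          half_pos hδ, CuntzSub.cutUnit hp (half_pos hδ).le hlt⟩
      obtain ⟨y, hy⟩ := hw a ha
      obtain ⟨z, hz⟩ := hw b hb
      have hyD : ∀ i, pairSeq y z i ∈ D := forall_pairSeq hy.mem' hz.mem'
      have key := hED.cuntzSub_diag hα hα0 hsD hsE h.norm_le h.mem' h.isSelfAdjoint h.near 2
        (e := pairSeq (cutUnit a (δ / 2) δ) (cutUnit b (δ / 2) δ)) (y := pairSeq y z)
        (forall_pairSeq hy.nonneg hz.nonneg) (forall_pairSeq (P := fun p => ‖p‖ ≤ 1) hy.norm_le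
        hz.norm_le) hfE hf0 (forall_pairSeq₂ (P := fun p q => p * q = q) (cutUnit_mul_posCut a hlt)
        (cutUnit_mul_posCut b hlt)) hyD (forall_pairSeq hy.isSelfAdjoint hz.isSelfAdjoint)
        (forall_pairSeq₂ (P := fun p q => ‖p - q‖ ≤ α) hy.near hz.near) (hc.trans hsum)
      have hpD : ∀ i, posCut (pairSeq y z i) (1 / 2) ∈ D := fun i => posCut_mem (hyD i) (by norm_num)
      have hle : ∀ y ∈ D, φ (posCut y (1 / 2)) ≤ φ (posCut y (1 / 4)) := fun y hy =>
        hφ.mono _ (posCut_mem hy (by norm_num)) _ (posCut_mem hy (by norm_num)) (posCut_nonneg _ _)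
          (posCut_nonneg _ _) (CuntzSub.posCut_anti hy (by norm_num) (by norm_num))
      refine (hφ.mono _ (posCut_mem h.mem' (by norm_num)) _ (diag_mem hsD hpD) (posCut_nonneg _ _)
        (diag_nonneg s 2 fun i => posCut_nonneg _ _) key).trans ?_
      rw [hφ.map_diag_two hsD hpD fun i => posCut_nonneg _ _]
      exact add_le_add ((hle y hy.mem').trans hy.le_transfer) ((hle z hz.mem').trans hz.le_transfer)
    · refine ENNReal.biSup_add_biSup_le' (p := fun p : M × M => IsNearWitness α D E a p.1 p.2)
        (q := fun p : M × M => IsNearWitness α D E b p.1 p.2) ⟨0, isNearWitness_zero hα0 a⟩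
        ⟨0, isNearWitness_zero hα0 b⟩ fun p hp q hq => ?_
      · obtain ⟨δ₁, hδ₁, h₁⟩ := hp.cuntzSub
        obtain ⟨δ₂, hδ₂, h₂⟩ := hq.cuntzSub
        have hδ : 0 < min δ₁ δ₂ := lt_min hδ₁ hδ₂
        set δ := min δ₁ δ₂
        have hxD : ∀ i, pairSeq p.2 q.2 i ∈ D := forall_pairSeq hp.mem' hq.mem'
        have hxs : ∀ i, IsSelfAdjoint (pairSeq p.2 q.2 i) :=
          forall_pairSeq hp.isSelfAdjoint hq.isSelfAdjoint
        have hc0 : ∀ i, 0 ≤ pairSeq p.1 q.1 i := forall_pairSeq hp.nonneg hq.nonneg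
        have hw : IsNearWitness α D E (a + b) (diag s 2 (pairSeq p.1 q.1))
            (diag s 2 (pairSeq p.2 q.2)) :=
          { mem := diag_mem hsE (forall_pairSeq hp.mem hq.mem)
            nonneg := diag_nonneg s 2 hc0
            norm_le := hsE.norm_diag_le 2 zero_le_one (fun i => (hc0 i).isSelfAdjoint)
              (forall_pairSeq (P := fun p => ‖p‖ ≤ 1) hp.norm_le hq.norm_le)
            mem' := diag_mem hsD hxD
            isSelfAdjoint := by
              rw [IsSelfAdjoint, star_diag]; simp only [(hxs _).star_eq]
            near := hsD.norm_diag_sub_le 2 hα0 hxs (fun i => (hc0 i).isSelfAdjoint)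
              (forall_pairSeq₂ (P := fun p q => ‖p - q‖ ≤ α) hp.near hq.near)
            cuntzSub := by
              refine ⟨δ, hδ, ?_⟩
              rw [posCut_add_of_mul_eq_zero ha0 hb0 hab hδ.le]
              refine (CuntzSub.diag hsE 2 hc0 (forall_pairSeq (posCut_nonneg a δ)
                (posCut_nonneg b δ)) (forall_pairSeq₂ (P := CuntzSub E)
                (h₁.trans (CuntzSub.posCut_anti ha hδ.le (min_le_left _ _)))
                (h₂.trans (CuntzSub.posCut_anti hb hδ.le (min_le_right _ _))))).trans ?_
              exact CuntzSub.diag_pairSeq_of_mul_eq_zero hsE (posCut_mem ha hδ.le)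
                (posCut_mem hb hδ.le) (posCut_nonneg _ _) (posCut_nonneg _ _)
                (posCut_mul_of_mul_eq_zero ha0 hb0 hab hδ.le) }
        refine le_trans (le_of_eq ?_) hw.le_transfer
        rw [hsD.posCut_diag 2 hxs (by norm_num), hφ.map_diag_two hsD
          (fun i => posCut_mem (hxD i) (by norm_num)) fun i => posCut_nonneg _ _]
        rfl
  exists_lt b hb hb0 c hc := by
    obtain ⟨p, hp⟩ := lt_iSup_iff.1 hc
    obtain ⟨h, hlt⟩ := lt_iSup_iff.1 hp
    obtain ⟨δ, hδ, hcδ⟩ := h.cuntzSub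
    refine ⟨δ / 2, half_pos hδ, hlt.trans_le (IsNearWitness.le_transfer (c := p.1)
      { h with cuntzSub := ⟨δ / 2, half_pos hδ, ?_⟩ })⟩
    rwa [posCut_posCut hb0.isSelfAdjoint (half_pos hδ).le, add_halves]

end Transfer

/-! ### Strict comparison passes to close stable algebras -/

section StrictComparison

variable {M : Type*} [CStarAlgebra M] [PartialOrder M] [StarOrderedRing M]
  {D E : NonUnitalStarSubalgebra ℂ M} {s : ℕ → M} {α : ℝ}

/-- All cut-downs of `a` are Cuntz below a multiple of `b`. -/
def MultipleSub (s : ℕ → M) (D : NonUnitalStarSubalgebra ℂ M) (a b : M) : Prop :=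
  ∀ ε > 0, ∃ n, CuntzSub D (posCut a ε) (diag s n fun _ => b)

/-- Strict comparison for positive elements of a stable subalgebra. -/
def StrictComparisonOn (s : ℕ → M) (D : NonUnitalStarSubalgebra ℂ M) : Prop :=
  ∀ a ∈ D, ∀ b ∈ D, 0 ≤ a → 0 ≤ b → MultipleSub s D a b →
    (∀ τ, IsQuasitraceOn D τ → dimSup τ b = 1 → dimSup τ a < dimSup τ b) → CuntzSub D a b

/-- Local units of `a` and `b` are moved to `D`, compared there, and the comparison is brought back.
-/
theorem UnitBallNear.strictComparisonOn [IsClosed (D : Set M)] [IsClosed (E : Set M)]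
    (hDE : UnitBallNear α D E) (hED : UnitBallNear α E D) (hα : α < 1 / 42) (hα0 : 0 ≤ α)
    (hsD : Stabilizes s D) (hsE : Stabilizes s E) (h : StrictComparisonOn s D) :
    StrictComparisonOn s E := by
  intro a ha b hb ha0 hb0 hmul hτ
  refine CuntzSub.of_posCut ha0 fun ε hε => ?_
  have hlt : ε / 2 < ε := by linarith
  set c := cutUnit a (ε / 2) ε with hc
  have hcE : c ∈ E := cutUnit_mem ha (half_pos hε).le
  have hc0 : 0 ≤ c := cutUnit_nonneg a hlt
  have hc1 : ‖c‖ ≤ 1 := norm_cutUnit_le a hlt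
  have hca : CuntzSub E c (posCut a (ε / 2)) := CuntzSub.cutUnit ha (half_pos hε).le hlt
  obtain ⟨x, hx, hxs, hxc⟩ := hED.exists_isSelfAdjoint hcE hc0.isSelfAdjoint hc1
  set r : ℕ → ℝ := fun n => 1 / ((n : ℝ) + 1) with hr
  have hr0 : ∀ n, 0 < r n := fun n => by simp only [hr]; positivity
  have hrlt : ∀ n, r (n + 1) < r n := fun n =>
    one_div_lt_one_div_of_lt (by positivity) (by push_cast; linarith)
  set e : ℕ → M := fun n => cutUnit b (r (n + 1)) (r n) with he
  have heE : ∀ n, e n ∈ E := fun n => cutUnit_mem hb (hr0 _).le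
  have he0 : ∀ n, 0 ≤ e n := fun n => cutUnit_nonneg b (hrlt n)
  have he1 : ∀ n, ‖e n‖ ≤ 1 := fun n => norm_cutUnit_le b (hrlt n)
  have heb : ∀ n, CuntzSub E (e n) (posCut b (r (n + 1))) := fun n =>
    CuntzSub.cutUnit hb (hr0 _).le (hrlt n)
  choose y hy hys hye using fun n =>
    hED.exists_isSelfAdjoint (heE n) (he0 n).isSelfAdjoint (he1 n)
  have hcut : ∀ δ > 0, ∃ m, CuntzSub E (posCut b δ) (posCut b (r m)) := fun δ hδ => by
    obtain ⟨m, hm⟩ := exists_nat_one_div_lt hδ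
    exact ⟨m, CuntzSub.posCut_anti hb (hr0 m).le hm.le⟩
  -- Whatever lies under (b - r m)₊ has its neighbour in D under (y m - 1/2)₊, because e m is a unit
  -- for (b - r m)₊.
  have hunit : ∀ m, ∀ c' x', ‖c'‖ ≤ 1 → x' ∈ D → IsSelfAdjoint x' → ‖x' - c'‖ ≤ α →
      CuntzSub E c' (posCut b (r m)) →
      CuntzSub D (posCut x' (1 / 4)) (posCut (y m) (1 / 2)) := fun m c' x' h1 h2 h3 h4 h5 =>
    hED.cuntzSub_of_unit hα h1 (he1 m) (posCut_mem hb (hr0 m).le) (posCut_nonneg _ _)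
      (cutUnit_mul_posCut b (hrlt m)) h5 h2 h3 (hy m) (hys m) h4 (hye m)
  obtain ⟨b', hb', hb0', hsup, hinf⟩ := exists_cuntz_sup hsD hy hys fun n =>
    hunit (n + 1) (e n) (y n) (he1 n) (hy n) (hys n) (hye n) (heb n)
  have ha' : posCut x (1 / 2) ∈ D := posCut_mem hx (by norm_num)
  have hx4 : CuntzSub D (posCut x (1 / 2)) (posCut x (1 / 4)) :=
    CuntzSub.posCut_anti hx (by norm_num) (by norm_num)
  -- Two cuts by ε/4 reach the level ε/2 below which c was built; the finite multiple of b is then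
  -- replaced by the same multiple of (y m - 1/2)₊ ≾ b'.
  have hmul' : MultipleSub s D (posCut x (1 / 2)) b' := fun ε' hε' => by
    obtain ⟨n, hn⟩ := hmul (ε / 4) (by positivity)
    have hdE : (diag s n fun _ => b) ∈ E := diag_mem hsE fun _ => hb
    obtain ⟨δ, hδ, hn'⟩ := CuntzSub.exists_posCut (posCut_mem ha (by positivity)) hdE
      (posCut_nonneg a (ε / 4)).isSelfAdjoint (diag_nonneg s n fun _ => hb0) hn
      (ε := ε / 4) (by positivity)
    rw [posCut_posCut ha0.isSelfAdjoint (by positivity), hsE.posCut_diag n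
      (fun _ => hb0.isSelfAdjoint) hδ.le, show ε / 4 + ε / 4 = ε / 2 by ring] at hn'
    obtain ⟨m, hm⟩ := hcut δ hδ
    have key := hED.cuntzSub_diag hα hα0 hsD hsE hc1 hx hxs hxc n (e := fun _ => e m)
      (f := fun _ => posCut b (r m)) (y := fun _ => y m) (fun _ => he0 m) (fun _ => he1 m)
      (fun _ => posCut_mem hb (hr0 m).le) (fun _ => posCut_nonneg _ _)
      (fun _ => cutUnit_mul_posCut b (hrlt m)) (fun _ => hy m) (fun _ => hys m) (fun _ => hye m)
      ((hca.trans hn').trans (CuntzSub.diag hsE n (fun _ => posCut_nonneg _ _)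
        (fun _ => posCut_nonneg _ _) fun _ => hm))
    exact ⟨n, (CuntzSub.posCut_self ha' (posCut_nonneg _ _) hε'.le).trans <| hx4.trans <|
      key.trans <| CuntzSub.diag hsD n (fun _ => posCut_nonneg _ _) (fun _ => hb0')
        fun _ => hsup m⟩
  have hcomp : CuntzSub D (posCut x (1 / 2)) b' := by
    refine h _ ha' _ hb' (posCut_nonneg _ _) hb0' hmul' fun τ' hτ' hnorm => ?_
    have hφ := hτ'.isFunctionalOn_dimSup
    have hψ := hφ.transfer hED hα hα0 hsD hsE
    -- The pairs (e n, y n) are cofinal among the witnesses for b, and b' is the supremum of their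
    -- classes. Hence the normalisation of τ' at b' becomes that of the transferred quasitrace at b.
    have hval : transfer α D E (dimSup τ') b = dimSup τ' b' := by
      refine le_antisymm (transfer_le fun c' x' hw => ?_) (le_of_forall_lt fun t ht => ?_)
      · obtain ⟨δ, hδ, hcδ⟩ := hw.cuntzSub
        obtain ⟨m, hm⟩ := hcut δ hδ
        exact hφ.mono _ (posCut_mem hw.mem' (by norm_num)) _ hb' (posCut_nonneg _ _) hb0'
          ((hunit m c' x' hw.norm_le hw.mem' hw.isSelfAdjoint hw.near (hcδ.trans hm)).trans
            (hsup m))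
      · obtain ⟨η, hη, htη⟩ := hφ.exists_lt b' hb' hb0' t ht
        obtain ⟨n, hn⟩ := hinf η hη
        refine htη.trans_le ((hφ.mono _ (posCut_mem hb' hη.le) _ (posCut_mem (hy n) (by norm_num))
          (posCut_nonneg _ _) (posCut_nonneg _ _) hn).trans (IsNearWitness.le_transfer (c := e n)
          ⟨heE n, he0 n, he1 n, hy n, hys n, hye n, r (n + 1), hr0 _, heb n⟩))
    have hquasi := hτ _ (hψ.isQuasitraceOn_layerCake hsE)
    rw [hψ.dimSup_layerCake ha ha0, hψ.dimSup_layerCake hb hb0, hval] at hquasi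
    refine lt_of_le_of_lt ?_ (hquasi hnorm)
    exact (hφ.mono _ ha' _ (posCut_mem hx (by norm_num)) (posCut_nonneg _ _) (posCut_nonneg _ _)
      hx4).trans (IsNearWitness.le_transfer (c := c)
      ⟨hcE, hc0, hc1, hx, hxs, hxc, ε / 2, half_pos hε, hca⟩)
  obtain ⟨δ, hδ, hδ'⟩ := CuntzSub.exists_posCut ha' hb' (posCut_nonneg _ _).isSelfAdjoint hb0'
    hcomp (ε := 1 / 8) (by norm_num)
  rw [posCut_posCut hxs (by norm_num), show (1 / 2 + 1 / 8 : ℝ) = 5 / 8 by norm_num] at hδ'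
  obtain ⟨n, hn⟩ := hinf δ hδ
  have hrev := hDE.cuntzSub_reverse hα hcE (heE n) hc0.isSelfAdjoint (he0 n) hc1 (he1 n) (hy n) hxs
    (hys n) hxc (hye n) (hδ'.trans hn)
  -- Where a ≥ ε, c equals 1 and (c - 19/20)₊ equals 1/20, so the factor 20‖a‖ dominates (a - ε)₊.
  refine CuntzSub.trans ?_ (hrev.trans ((heb n).trans (CuntzSub.posCut_self hb hb0 (hr0 _).le)))
  rw [hc, cutUnit, posCut, posCut, ← cfc_comp' (fun t : ℝ => max (t - 19 / 20) 0)
    (ramp (ε / 2) ε) a]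
  refine CuntzSub.cfc_of_le ha (by fun_prop) (by fun_prop) (max_eq_right (by linarith))
    (max_eq_right (by rw [ramp_zero (half_pos hε).le]; norm_num)) (fun t _ => le_max_right _ _)
    (fun t _ => le_max_right _ _) (r := 20 * ‖a‖) (by positivity) fun t ht => ?_
  rcases le_total t ε with hte | hte
  · rw [max_eq_right (by linarith)]; positivity
  · rw [ramp_of_ge hlt hte, max_eq_left (by linarith), max_eq_left (by norm_num)]
    have h1 := (spectrum.norm_le_norm_mul_of_mem ht).trans
      (mul_le_of_le_one_right (norm_nonneg _) norm_one_le_one)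
    rw [Real.norm_eq_abs] at h1
    linarith [le_abs_self t]

end StrictComparison

/-! ### Isometries permuting the coordinates of the amplification -/

section Amplification

open ContinuousLinearMap

variable {H : Type*} [NormedAddCommGroup H] [InnerProductSpace ℂ H]

/-- The coordinate embedding of `H` into `ℓ²(ℕ; H)`. -/
def singleIsometry (k : ℕ) : H →ₗᵢ[ℂ] Ampl H where
  toLinearMap := (lp.singleContinuousLinearMap ℂ (fun _ : ℕ => H) 2 k).toLinearMap
  norm_map' x := lp.norm_single (E := fun _ : ℕ => H) (p := 2) (by norm_num) k x

theorem orthogonalFamily_single {f : ℕ → ℕ} (hf : f.Injective) :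
    OrthogonalFamily ℂ (fun _ : ℕ => H) fun k => singleIsometry (f k) := by
  intro i j hij v w
  change inner ℂ (lp.single 2 (f i) v) (lp.single 2 (f j) w : Ampl H) = 0
  rw [lp.inner_single_left, lp.coeFn_single, Pi.single_eq_of_ne (hf.ne hij),
    inner_zero_right]

variable [CompleteSpace H]

/-- The isometry of `ℓ²(ℕ; H)` moving the coordinate `k` to the coordinate `f k`. -/
def shiftCLM {f : ℕ → ℕ} (hf : f.Injective) : Ampl H →L[ℂ] Ampl H :=
  (orthogonalFamily_single hf).linearIsometry.toContinuousLinearMap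

theorem shiftCLM_single {f : ℕ → ℕ} (hf : f.Injective) (k : ℕ) (v : H) :
    shiftCLM hf (lp.single 2 k v) = lp.single 2 (f k) v :=
  (orthogonalFamily_single hf).linearIsometry_apply_single v

theorem shiftCLM_apply_eq_zero {f : ℕ → ℕ} (hf : f.Injective) {m : ℕ} (hm : ∀ k, f k ≠ m)
    (x : Ampl H) : shiftCLM hf x m = 0 := by
  have h : (lp.evalCLM ℂ (fun _ : ℕ => H) 2 m).comp (shiftCLM hf) = 0 := by
    refine lp.ext_continuousLinearMap (by norm_num) fun k => ?_
    ext v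
    change (shiftCLM hf (lp.single 2 k v)) m = 0
    rw [shiftCLM_single, lp.coeFn_single, Pi.single_eq_of_ne (hm k).symm]
  exact DFunLike.congr_fun h x

theorem star_shiftCLM_mul_self {f : ℕ → ℕ} (hf : f.Injective) :
    star (shiftCLM (H := H) hf) * shiftCLM (H := H) hf = 1 := by
  ext1 x
  refine ext_inner_left ℂ fun y => ?_
  change inner ℂ y (adjoint (shiftCLM hf) (shiftCLM hf x)) = inner ℂ y x
  rw [adjoint_inner_right]
  exact (orthogonalFamily_single hf).linearIsometry.inner_map_map y x

/-- The two isometries land in disjoint sets of coordinates, so every term of the inner product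
vanishes. -/
theorem star_shiftCLM_mul_of_disjoint {f g : ℕ → ℕ} (hf : f.Injective) (hg : g.Injective)
    (hfg : ∀ i j, f i ≠ g j) : star (shiftCLM (H := H) hf) * shiftCLM (H := H) hg = 0 := by
  ext1 x
  refine ext_inner_left ℂ fun y => ?_
  change inner ℂ y (adjoint (shiftCLM hf) (shiftCLM hg x)) = inner ℂ y 0
  rw [adjoint_inner_right, inner_zero_right, lp.inner_eq_tsum]
  refine (tsum_congr fun m => ?_).trans tsum_zero
  by_cases hm : ∃ k, f k = m
  · obtain ⟨k, rfl⟩ := hm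
    rw [shiftCLM_apply_eq_zero hg fun j => (hfg k j).symm, inner_zero_right]
  · push Not at hm
    rw [shiftCLM_apply_eq_zero hf hm, inner_zero_left]

theorem shiftCLM_mul_unitTensor {f : ℕ → ℕ} (hf : f.Injective) (x : H →L[ℂ] H) (i j : ℕ) :
    shiftCLM hf * unitTensor x i j = unitTensor x (f i) j := by
  ext1 v
  exact shiftCLM_single hf i (x (v j))

theorem star_unitTensor (x : H →L[ℂ] H) (i j : ℕ) :
    star (unitTensor x i j) = unitTensor (star x) j i := by
  ext1 v
  refine ext_inner_left ℂ fun w => ?_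
  change inner ℂ w (adjoint (unitTensor x i j) v) = inner ℂ w (lp.single 2 j (adjoint x (v i)))
  rw [adjoint_inner_right, lp.inner_single_right, adjoint_inner_right]
  exact lp.inner_single_left (𝕜 := ℂ) (G := fun _ : ℕ => H) i (x (w j)) v

theorem shiftCLM_mul_mem {f : ℕ → ℕ} (hf : f.Injective) (A : NonUnitalStarSubalgebra ℂ (H →L[ℂ] H))
    {T : Ampl H →L[ℂ] Ampl H} (hT : T ∈ stabilization A) :
    shiftCLM hf * T ∈ stabilization A := by
  set 𝒜 := NonUnitalStarAlgebra.adjoin ℂ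
    {T : Ampl H →L[ℂ] Ampl H | ∃ x ∈ A, ∃ i j : ℕ, T = unitTensor x i j} with h𝒜
  -- Left multiplication by the shift and right multiplication by its adjoint are treated together,
  -- since the star step of the induction exchanges them.
  have key : ∀ T ∈ 𝒜, shiftCLM hf * T ∈ 𝒜 ∧ T * star (shiftCLM (H := H) hf) ∈ 𝒜 := fun T hT => by
    induction hT using NonUnitalStarAlgebra.adjoin_induction with
    | mem T hT =>
      obtain ⟨x, hx, i, j, rfl⟩ := hT
      refine ⟨?_, ?_⟩
      · rw [shiftCLM_mul_unitTensor]
        exact NonUnitalStarAlgebra.subset_adjoin ℂ _ ⟨x, hx, _, _, rfl⟩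
      · rw [← star_star (unitTensor x i j), ← star_mul, star_unitTensor, shiftCLM_mul_unitTensor]
        exact star_mem (NonUnitalStarAlgebra.subset_adjoin ℂ _ ⟨star x, star_mem hx, _, _, rfl⟩)
    | add a b _ _ ha hb =>
      exact ⟨by rw [mul_add]; exact add_mem ha.1 hb.1, by rw [add_mul]; exact add_mem ha.2 hb.2⟩
    | zero => exact ⟨by rw [mul_zero]; exact zero_mem _, by rw [zero_mul]; exact zero_mem _⟩
    | mul a b ha' hb' ha hb =>
      exact ⟨by rw [← mul_assoc]; exact mul_mem ha.1 hb', by rw [mul_assoc]; exact mul_mem ha' hb.2⟩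
    | smul r a _ ha =>
      exact ⟨by rw [mul_smul_comm]; exact SMulMemClass.smul_mem r ha.1,
        by rw [smul_mul_assoc]; exact SMulMemClass.smul_mem r ha.2⟩
    | star a _ ha =>
      exact ⟨by rw [← star_star (shiftCLM (H := H) hf), ← star_mul]; exact star_mem ha.2,
        by rw [← star_mul]; exact star_mem ha.1⟩
  exact map_mem_closure (continuous_const_mul (shiftCLM hf)) hT fun T hT => (key T hT).1

theorem injective_pair (n : ℕ) : (Nat.pair n).Injective := fun _ _ h => (Nat.pair_eq_pair.1 h).2

/-- Isometries with orthogonal ranges on `ℓ²(ℕ; H)`. -/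
def amplIsometry (n : ℕ) : Ampl H →L[ℂ] Ampl H := shiftCLM (injective_pair n)

theorem stabilizes_stabilization (A : NonUnitalStarSubalgebra ℂ (H →L[ℂ] H)) :
    Stabilizes (amplIsometry (H := H)) (stabilization A) where
  orth i j := by
    split_ifs with h
    · subst h; exact star_shiftCLM_mul_self _
    · exact star_shiftCLM_mul_of_disjoint _ _ fun k l hkl => h (Nat.pair_eq_pair.1 hkl).1
  mul_mem i _ hx := shiftCLM_mul_mem (injective_pair i) A hx

theorem unitBallNear_of_kkDist_lt {D E : NonUnitalStarSubalgebra ℂ (H →L[ℂ] H)} {α : ℝ}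
    (h : kkDist D E < α) : UnitBallNear α D E := by
  intro x hx hx1
  have hb : ∀ F : NonUnitalStarSubalgebra ℂ (H →L[ℂ] H),
      (unitBall F).Nonempty ∧ Bornology.IsBounded (unitBall F) := fun F =>
    ⟨⟨0, zero_mem F, by simp⟩, (Metric.isBounded_closedBall (x := 0) (r := 1)).subset
      fun y hy => mem_closedBall_zero_iff.2 hy.2⟩
  obtain ⟨y, hy, hxy⟩ := Metric.exists_dist_lt_of_hausdorffDist_lt (s := unitBall D) ⟨hx, hx1⟩ h
    (Metric.hausdorffEDist_ne_top_of_nonempty_of_bounded (hb D).1 (hb E).1 (hb D).2 (hb E).2)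
  exact ⟨y, hy.1, hy.2, by rw [← dist_eq_norm]; exact hxy.le⟩

end Amplification

/-! ### Comparison inside a closed subalgebra and in the ambient algebra -/

section Ambient

variable {M : Type*} [CStarAlgebra M] [PartialOrder M] [StarOrderedRing M]
  {D : NonUnitalStarSubalgebra ℂ M} [IsClosed (D : Set M)] {τ : M → ℝ≥0∞} {s : ℕ → M}

theorem isPos_iff {a : D} : IsPos a ↔ 0 ≤ (a : M) := by
  constructor
  · rintro ⟨x, rfl⟩
    exact star_mul_self_nonneg (x : M)
  · intro h
    refine ⟨⟨sqrtPos a, sqrtPos_mem a.2⟩, Subtype.ext ?_⟩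
    change (a : M) = star (sqrtPos (a : M)) * sqrtPos (a : M)
    rw [star_sqrtPos, sqrtPos_mul_self h]

theorem cuntzLE_iff {a b : D} : CuntzLE a b ↔ CuntzSub D (a : M) b := by
  constructor
  · rintro ⟨v, hv⟩
    refine CuntzSub.of_tendsto (v := fun n => (v n : M)) (fun n => (v n).2) ?_
    exact (continuous_subtype_val.tendsto a).comp hv
  · intro h
    choose v hvD hv using fun n : ℕ => h (1 / ((n : ℝ) + 1)) (by positivity)
    refine ⟨fun n => ⟨v n, hvD n⟩, tendsto_subtype_rng.2 ?_⟩
    refine tendsto_iff_norm_sub_tendsto_zero.2 ?_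
    exact squeeze_zero (fun _ => norm_nonneg _) (fun n => (hv n).le)
      tendsto_one_div_add_atTop_nhds_zero_nat

theorem isLscQuasitrace_iff : IsLscQuasitrace (fun x : D => τ x) ↔ IsQuasitraceOn D τ := by
  constructor
  · intro h
    refine ⟨h.map_zero, fun x hx => h.trace ⟨x, hx⟩, fun a ha b hb ha0 hb0 hab => ?_,
      fun t a ha ht ha0 => ?_, fun a ha ha0 c hc => ?_⟩
    · exact h.map_add ⟨a, ha⟩ ⟨b, hb⟩ (isPos_iff.2 ha0) (isPos_iff.2 hb0) (Subtype.ext hab)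
    · have := h.map_smul t ⟨a, ha⟩ ht (isPos_iff.2 ha0)
      rwa [← Complex.coe_smul t a]
    · have := h.lsc ⟨a, ha⟩ (isPos_iff.2 ha0) c hc
      rw [eventually_nhdsWithin_iff, Metric.eventually_nhds_iff] at this
      obtain ⟨δ, hδ, h'⟩ := this
      refine ⟨δ, hδ, fun a' ha' ha0' hd => h' (y := ⟨a', ha'⟩) ?_ (isPos_iff.2 ha0')⟩
      rw [← dist_eq_norm] at hd
      exact hd
  · intro h
    refine ⟨h.map_zero, fun x => h.trace x x.2, fun a b ha hb hab => ?_, fun t a ht ha => ?_,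
      fun a ha c hc => ?_⟩
    · exact h.map_add a a.2 b b.2 (isPos_iff.1 ha) (isPos_iff.1 hb) (congrArg Subtype.val hab)
    · have := h.map_smul t a a.2 ht (isPos_iff.1 ha)
      rwa [← Complex.coe_smul t (a : M)] at this
    · obtain ⟨δ, hδ, h'⟩ := h.lsc a a.2 (isPos_iff.1 ha) c hc
      rw [eventually_nhdsWithin_iff, Metric.eventually_nhds_iff]
      refine ⟨δ, hδ, fun a' hd ha' => h' a' a'.2 (isPos_iff.1 ha') ?_⟩
      rw [← dist_eq_norm]
      exact hd

/-- The case n = 0 is excluded because then the exponent is 0 and the function does not vanish at 0.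
-/
theorem coe_root {a : D} (ha : 0 ≤ (a : M)) {n : ℕ} (hn : n ≠ 0) :
    ((root a n : D) : M) = cfc (fun t : ℝ => t ^ (1 / (n : ℝ))) (a : M) := by
  have hc : Continuous fun t : ℝ => t ^ (1 / (n : ℝ)) :=
    Real.continuous_rpow_const (by positivity)
  have h0 : (0 : ℝ) ^ (1 / (n : ℝ)) = 0 := Real.zero_rpow (by positivity)
  have hsa : IsSelfAdjoint a := Subtype.ext ha.isSelfAdjoint
  rw [← cfcₙ_eq_cfc hc.continuousOn h0]
  exact NonUnitalStarAlgHomClass.map_cfcₙ (S := ℂ) (NonUnitalStarSubalgebraClass.subtype D)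
    (fun t : ℝ => t ^ (1 / (n : ℝ))) a hc.continuousOn h0 continuous_subtype_val hsa
    ha.isSelfAdjoint

theorem dimFn_eq (hτ : IsQuasitraceOn D τ) {a : D} (ha : 0 ≤ (a : M)) :
    dimFn (fun x : D => τ x) a = dimSup τ (a : M) := by
  rw [← hτ.limsup_root a.2 ha, dimFn]
  refine limsup_congr ?_
  filter_upwards [eventually_ne_atTop 0] with n hn
  rw [coe_root ha hn]

/-- A witness v for comparison with n copies of `b` gives the approximation ∑ (v sᵢ k) b (v sᵢ k)*.
The ramp k of `b` places the coefficients in `D`. -/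
theorem memClosedIdeal_of_multipleSub (hs : Stabilizes s D) {a b : D} (ha : 0 ≤ (a : M))
    (hb : 0 ≤ (b : M)) (h : MultipleSub s D (a : M) b) : MemClosedIdeal a b := by
  set I := TwoSidedIdeal.span ({b} : Set D) with hI
  have hbI : b ∈ I := TwoSidedIdeal.subset_span rfl
  refine Metric.mem_closure_iff.2 fun ε hε => ?_
  obtain ⟨n, hn⟩ := h (ε / 4) (by positivity)
  obtain ⟨v, hv, hva⟩ := hn (ε / 4) (by positivity)
  obtain ⟨δ, hδ, hδv⟩ : ∃ δ > 0, ‖v‖ * (2 * δ) * ‖v‖ < ε / 4 := by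
    refine ⟨ε / (16 * (‖v‖ * ‖v‖ + 1)), by positivity, ?_⟩
    have : ‖v‖ * (2 * (ε / (16 * (‖v‖ * ‖v‖ + 1)))) * ‖v‖
        = ε / 8 * (‖v‖ * ‖v‖ / (‖v‖ * ‖v‖ + 1)) := by field_simp; ring
    rw [this]
    have h1 : ‖v‖ * ‖v‖ / (‖v‖ * ‖v‖ + 1) ≤ 1 :=
      div_le_one_of_le₀ (by linarith) (by positivity)
    nlinarith
  set k := cfc (ramp δ (2 * δ)) (b : M) with hk
  have hkD : k ∈ D := cfc_mem_of_map_zero b.2 (by fun_prop) (ramp_zero hδ.le)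
  have hks : star k = k := star_cfc_real _ _
  have hkb : ‖k * b * k - b‖ ≤ 2 * δ := norm_ramp_conj_sub_le hb hδ
  have hkbs : IsSelfAdjoint (k * (b : M) * k) := by
    have := (hb.isSelfAdjoint).conjugate k
    rwa [hks] at this
  have hd : ‖diag s n (fun _ => k * b * k) - diag s n fun _ => (b : M)‖ ≤ 2 * δ :=
    hs.norm_diag_sub_le n (by positivity) (fun _ => hkbs) (fun _ => hb.isSelfAdjoint) fun _ => hkb
  set y : ℕ → D := fun i => ⟨v * (s i * k), mul_mem hv (hs.mul_mem i k hkD)⟩ with hy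
  have hyI : ∑ i ∈ Finset.range n, y i * b * star (y i) ∈ I :=
    sum_mem fun i _ => I.mul_mem_right _ _ (I.mul_mem_left _ _ hbI)
  refine ⟨_, hyI, ?_⟩
  have hcoe : ((∑ i ∈ Finset.range n, y i * b * star (y i) : D) : M)
      = v * diag s n (fun _ => k * b * k) * star v := by
    rw [AddSubmonoidClass.coe_finsetSum, diag, Finset.mul_sum, Finset.sum_mul]
    refine Finset.sum_congr rfl fun i _ => ?_
    change v * (s i * k) * b * star (v * (s i * k)) = _
    rw [star_mul, star_mul, hks]
    noncomm_ring
  change dist (a : M) ((∑ i ∈ Finset.range n, y i * b * star (y i) : D) : M) < ε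
  rw [hcoe, dist_comm, dist_eq_norm]
  have e1 : v * diag s n (fun _ => k * b * k) * star v - a
      = v * (diag s n (fun _ => k * b * k) - diag s n fun _ => (b : M)) * star v
        + (v * (diag s n fun _ => (b : M)) * star v - posCut (a : M) (ε / 4))
        + (posCut (a : M) (ε / 4) - a) := by noncomm_ring
  have e2 : ‖v * (diag s n (fun _ => k * b * k) - diag s n fun _ => (b : M)) * star v‖ < ε / 4 := by
    refine lt_of_le_of_lt ((norm_mul_le _ _).trans ?_) hδv
    rw [norm_star]
    gcongr
    exact (norm_mul_le _ _).trans (by gcongr)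
  have e3 := norm_sub_posCut_le ha (t := ε / 4) (by positivity)
  rw [e1]
  refine (norm_add₃_le).trans_lt ?_
  linarith

/-- Finite sums `∑ r b r*`. -/
theorem exists_sum_conj_of_mem_closure {b x : M}
    (h : x ∈ AddSubmonoid.closure {x : M | ∃ r ∈ D, x = r * b * star r}) :
    ∃ (n : ℕ) (r : ℕ → M), (∀ i, r i ∈ D) ∧ x = ∑ i ∈ Finset.range n, r i * b * star (r i) := by
  induction h using AddSubmonoid.closure_induction_left with
  | zero => exact ⟨0, fun _ => 0, fun _ => zero_mem D, by simp⟩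
  | add_left x hx y hy ih =>
    obtain ⟨q, hq, rfl⟩ := hx
    obtain ⟨n, r, hr, rfl⟩ := ih
    refine ⟨n + 1, fun i => Nat.casesOn i q r, fun i => ?_, ?_⟩
    · cases i with
      | zero => exact hq
      | succ i => exact hr i
    · rw [Finset.sum_range_succ', add_comm]; rfl

/-- Ideal elements are bounded, after sandwiching and symmetrising, by finite sums ∑ rᵢ b rᵢ*, and
such a sum is Cuntz below n copies of `b`. -/
theorem multipleSub_of_memClosedIdeal (hs : Stabilizes s D) {a b : D} (ha : 0 ≤ (a : M))
    (hb : 0 ≤ (b : M)) (h : MemClosedIdeal a b) : MultipleSub s D (a : M) b := by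
  set T := AddSubmonoid.closure {x : M | ∃ r ∈ D, x = r * (b : M) * star r} with hT
  have hspan : ∀ y ∈ TwoSidedIdeal.span ({b} : Set D), ∀ p ∈ D, ∀ q ∈ D,
      ∃ c ∈ T, p * (y : M) * q + star (p * (y : M) * q) ≤ c := by
    intro y hy
    induction hy using TwoSidedIdeal.span_induction with
    | mem x hx =>
      obtain rfl : x = b := hx
      intro p hp q hq
      refine ⟨p * x * star p + star q * x * star (star q), add_mem
        (AddSubmonoid.subset_closure ⟨p, hp, rfl⟩)
        (AddSubmonoid.subset_closure ⟨star q, star_mem hq, rfl⟩), ?_⟩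
      -- Polarization: (p - q*) x (p - q*)* ≥ 0 says that pxq + (pxq)* ≤ pxp* + q*xq.
      have := star_right_conjugate_nonneg hb (p - star q)
      rw [← sub_nonneg]
      refine this.trans_eq ?_
      simp only [star_sub, star_mul, star_star, hb.isSelfAdjoint.star_eq]
      noncomm_ring
    | zero => exact fun p _ q _ => ⟨0, zero_mem _, by simp⟩
    | add x y _ _ hx hy =>
      intro p hp q hq
      obtain ⟨c, hc, hcx⟩ := hx p hp q hq
      obtain ⟨d, hd, hdy⟩ := hy p hp q hq
      refine ⟨c + d, add_mem hc hd, (le_of_eq ?_).trans (add_le_add hcx hdy)⟩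
      push_cast
      rw [mul_add, add_mul, star_add]
      abel
    | neg x _ hx =>
      intro p hp q hq
      obtain ⟨c, hc, hcx⟩ := hx (-p) (neg_mem hp) q hq
      exact ⟨c, hc, by simpa using hcx⟩
    | left_absorb z x _ hx =>
      intro p hp q hq
      obtain ⟨c, hc, hcx⟩ := hx (p * z) (mul_mem hp z.2) q hq
      exact ⟨c, hc, by simpa [mul_assoc] using hcx⟩
    | right_absorb z x _ hx =>
      intro p hp q hq
      obtain ⟨c, hc, hcx⟩ := hx p hp (z * q) (mul_mem z.2 hq)
      exact ⟨c, hc, by simpa [mul_assoc] using hcx⟩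
  intro ε hε
  obtain ⟨y, hy, hay⟩ := Metric.mem_closure_iff.1 h (ε / 2) (by positivity)
  -- Sandwiching y between copies of k supplies coefficients in D, where no unit is available, and
  -- keeps the result within ε/2 + ε/2 of a.
  set k := cfc (ramp (ε / 4) (2 * (ε / 4))) (a : M) with hk
  have hkD : k ∈ D := cfc_mem_of_map_zero a.2 (by fun_prop) (ramp_zero (by positivity))
  have hk1 : ‖k‖ ≤ 1 := norm_cutUnit_le (a : M) (by linarith)
  have hka : ‖k * a * k - a‖ ≤ 2 * (ε / 4) := norm_ramp_conj_sub_le ha (by positivity)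
  obtain ⟨c, hcT, hc⟩ := hspan y hy k hkD k hkD
  obtain ⟨n, r, hr, rfl⟩ := exists_sum_conj_of_mem_closure hcT
  have hya : ‖(y : M) - a‖ < ε / 2 := by
    rw [← dist_eq_norm, dist_comm]; exact hay
  have hz : ‖(a : M) - k * y * k‖ ≤ ε := by
    have e : (a : M) - k * y * k = -(k * a * k - a) - k * (y - a) * k := by noncomm_ring
    have e2 : ‖k * ((y : M) - a) * k‖ ≤ ‖(y : M) - a‖ :=
      calc ‖k * ((y : M) - a) * k‖ ≤ ‖k‖ * ‖(y : M) - a‖ * ‖k‖ := norm_mul₃_le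
        _ ≤ 1 * ‖(y : M) - a‖ * 1 := by gcongr
        _ = _ := by ring
    rw [e]
    refine (norm_sub_le _ _).trans ?_
    rw [norm_neg]
    linarith
  set z := k * (y : M) * k with hzdef
  have hz' : ‖(a : M) - (2⁻¹ : ℝ) • (z + star z)‖ ≤ ε := by
    have e : (a : M) - (2⁻¹ : ℝ) • (z + star z)
        = (2⁻¹ : ℝ) • (((a : M) - z) + star ((a : M) - z)) := by
      rw [star_sub, ha.isSelfAdjoint.star_eq]
      module
    rw [e, norm_smul, Real.norm_of_nonneg (by norm_num)]
    have := norm_add_le ((a : M) - z) (star ((a : M) - z))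
    rw [norm_star] at this
    linarith
  have hsum : (∑ i ∈ Finset.range n, r i * (b : M) * star (r i)) ∈ D :=
    sum_mem fun i _ => mul_mem (mul_mem (hr i) b.2) (star_mem (hr i))
  have hsum0 : 0 ≤ ∑ i ∈ Finset.range n, r i * (b : M) * star (r i) :=
    Finset.sum_nonneg fun i _ => star_right_conjugate_nonneg hb _
  have hle := le_add_of_norm_sub_le ha.isSelfAdjoint
    ((IsSelfAdjoint.all (2⁻¹ : ℝ)).smul (IsSelfAdjoint.add_star_self z)) hz'
  refine ⟨n, CuntzSub.trans (CuntzSub.posCut_of_le a.2 (real_smul_mem hsum (2⁻¹ : ℝ))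
    ha.isSelfAdjoint hε.le (hle.trans ?_)) ((CuntzSub.smul_left hsum hsum0 (by norm_num)).trans
    (CuntzSub.sum_conj hs n hr))⟩
  gcongr

theorem strictComparisonOn_of_forall (hs : Stabilizes s D)
    (h : ∀ a b : D, IsPos a → IsPos b → MemClosedIdeal a b →
      (∀ τ : D → ℝ≥0∞, IsLscQuasitrace τ → dimFn τ b = 1 → dimFn τ a < dimFn τ b) → CuntzLE a b) :
    StrictComparisonOn s D := by
  classical
  intro a ha b hb ha0 hb0 hab hτ
  refine cuntzLE_iff.1 (h ⟨a, ha⟩ ⟨b, hb⟩ (isPos_iff.2 ha0) (isPos_iff.2 hb0)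
    (memClosedIdeal_of_multipleSub hs ha0 hb0 hab) fun τ₀ hτ₀ => ?_)
  obtain ⟨τ, rfl⟩ : ∃ τ : M → ℝ≥0∞, τ₀ = fun x : D => τ x :=
    -- Extension by 0 off D; only values on D are ever used.
    ⟨fun x => if hx : x ∈ D then τ₀ ⟨x, hx⟩ else 0, by ext x; simp⟩
  have hτ' := isLscQuasitrace_iff.1 hτ₀
  rw [dimFn_eq hτ' (a := ⟨a, ha⟩) ha0, dimFn_eq hτ' (a := ⟨b, hb⟩) hb0]
  exact hτ τ hτ'

theorem StrictComparisonOn.cuntzLE (hs : Stabilizes s D) (h : StrictComparisonOn s D) {a b : D}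
    (ha : IsPos a) (hb : IsPos b) (hab : MemClosedIdeal a b)
    (hτ : ∀ τ : D → ℝ≥0∞, IsLscQuasitrace τ → dimFn τ b = 1 → dimFn τ a < dimFn τ b) :
    CuntzLE a b := by
  have ha0 := isPos_iff.1 ha
  have hb0 := isPos_iff.1 hb
  refine cuntzLE_iff.2 (h a a.2 b b.2 ha0 hb0 (multipleSub_of_memClosedIdeal hs ha0 hb0 hab)
    fun τ hτ' => ?_)
  rw [← dimFn_eq hτ' ha0, ← dimFn_eq hτ' hb0]
  exact hτ _ (isLscQuasitrace_iff.2 hτ')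

end Ambient

end CompletelyClose

end

/-! ### Application to the two stabilizations. -/

theorem mainTheorem10 {H : Type*} [NormedAddCommGroup H] [InnerProductSpace ℂ H] [CompleteSpace H]
    (A B : NonUnitalStarSubalgebra ℂ (H →L[ℂ] H))
    (hA : IsClosed (A : Set (H →L[ℂ] H))) (hB : IsClosed (B : Set (H →L[ℂ] H)))
    (hAB : CompletelyClose.cbDist A B < 1 / 42)
    (hcomp : CompletelyClose.HasStrictComparison A) :
    CompletelyClose.HasStrictComparison B := by
  -- A number strictly above the Hausdorff distance is needed, since the distance itself need not be
  -- attained by nearby contractions.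
  obtain ⟨α, hα, hα'⟩ := exists_between hAB
  have hα0 : 0 ≤ α := Metric.hausdorffDist_nonneg.trans hα.le
  have hcA : IsClosed (CompletelyClose.stabilization A :
      Set (CompletelyClose.Ampl H →L[ℂ] CompletelyClose.Ampl H)) :=
    NonUnitalStarSubalgebra.isClosed_topologicalClosure _
  have hcB : IsClosed (CompletelyClose.stabilization B :
      Set (CompletelyClose.Ampl H →L[ℂ] CompletelyClose.Ampl H)) :=
    NonUnitalStarSubalgebra.isClosed_topologicalClosure _
  have hsA := CompletelyClose.stabilizes_stabilization A
  have hsB := CompletelyClose.stabilizes_stabilization B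
  have hBA : CompletelyClose.kkDist (CompletelyClose.stabilization B)
      (CompletelyClose.stabilization A) < α := by
    rw [CompletelyClose.kkDist, Metric.hausdorffDist_comm]; exact hα
  have key := (CompletelyClose.unitBallNear_of_kkDist_lt hα).strictComparisonOn
    (CompletelyClose.unitBallNear_of_kkDist_lt hBA) hα' hα0 hsA hsB
    (CompletelyClose.strictComparisonOn_of_forall hsA hcomp)
  exact fun a b ha hb hab hτ => key.cuntzLE hsB ha hb hab hτ
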